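/- Let $d\ge 1$ be an integer and $0\le s<d$. Write $B(0,r)$ for the open ball of radius $r$ around the origin. **Riesz-type functions.** Let $n\geq 1$ and let $r_0,C_1,c_0>0$, $c_s<1$, $C_2,C_{\mathrm{loc}}\in\mathbb R$ and $(C^{(k)})_{k\ge 0}$ be constants. A function $G$ on $\mathbb R^n$, whose value at $0$ plays no role, is *of Riesz type of order $s$ in $\mathbb R^n$* with these constants if $G\in C^\infty(\mathbb R^n\setminus\{0\})$ and 1. $G(X)=G(-X)$ for $X\ne0$, and $G(X)\to+\infty$ as $X\to0$; 2. $G$ is locally integrable on $B(0,r_0)$ and $\Delta G\le 0$ in $B(0,r_0)$ in the sense of distributions; 3. for all $k\ge0$ and $X\neq 0$, $|\nabla^{\otimes k}G(X)|\le C^{(k)}\big(|X|^{-s-k}+|\log|X||\,\mathbf 1_{s=k=0}\big)$; 4. $|X||\nabla G(X)|+|X|^2|\nabla^{\otimes2}G(X)|\le C_{\mathrm{loc}}\,G(X)$ for $X\in B(0,r_0)\setminus\{0\}$; 5. away from the origin the Fourier transform $\hat G$ (as a tempered distribution) is a locally integrable function with $C_1|\Xi|^{s-n}\le\hat G(\Xi)\le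 C_2|\Xi|^{s-n}$ for $\Xi\ne0$; 6. for all $X,Y\in B(0,r_0)\setminus\{0\}$ with $|Y|\ge2|X|$: $G(Y)<c_s\,G(X)$ if $s>0$, and $G(X)-G(Y)\ge c_0$ if $s=0$. Here $|\nabla^{\otimes k}G|$ is the norm of the $k$-th derivative as a $k$-linear map. **Admissible potentials.** If $s\le d-2$, put $m=0$ and assume that $\mathsf g$ is of Riesz type of order $s$ in $\mathbb R^d$. If $s>d-2$, assume that for some integer $m\ge0$ there is a function $\mathsf G$ of Riesz type of order $s$ in $\mathbb R^{d+m}$ with $\mathsf G(x,0)=\mathsf g(x)$ for all $x\in\mathbb R^d\setminus\{0\}$. **Modulated energy.** For $\underline x_N=(x_1,\dots,x_N)\in(\mathbb R^d)^N$ and a probability measure $\mu$ on $\mathbb R^d$, with $\triangle$ the diagonal of $(\mathbb R^d)^2$, let $$F_N(\underline x_N,\mu)=\int_{(\mathbb R^d)^2\setminus\triangle}\mathsf g(x-y)\,d\Big(\frac1N\sum_{i=1}^N\delta_{x_i}-\mu\Big)(x)\,d\Big(\frac1N\sum_{i=1}^N\delta_{x_i}-\mu\Big)(y).$$ **Corollary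 (control of microscale interactions).** There is a constant $C>0$, depending only on $d,s,m$ and the constants $r_0,C_1,C_2,C_{\mathrm{loc}},c_s,c_0,(C^{(k)})_{k\ge0}$, such that the following holds for every $\mathsf g$ satisfying the above assumptions with these constants. For every $N\ge1$, every pairwise distinct $\underline x_N\in(\mathbb R^d)^N$, every probability measure $\mu$ on $\mathbb R^d$ that is absolutely continuous with density in $L^\infty$ (with, if $s=0$, also $\int_{\mathbb R^d}\log(1+|x|)\,d\mu(x)<\infty$), and every $0<\varepsilon<\min\{\frac18,\frac{r_0}8\}$, $$\frac1{N^2}\sum_{\substack{1\le i\ne j\le N\\|x_i-x_j|\le\varepsilon}}\big(\mathsf g(x_i-x_j)\mathbf 1_{s>0}+\mathbf 1_{s=0}\big)\le C\bigg(F_N(\underline x_N,\mu)+C\Big(\frac{\varepsilon^{-s}+|\log\varepsilon|\mathbf 1_{s=0}}N+\varepsilon^2+\|\mu\|_{L^\infty}\big(\varepsilon^{d-s}+\varepsilon^d|\log\varepsilon|\mathbf 1_{s=0}+\varepsilon^2|\log\varepsilon|\mathbf 1_{s=d-2}\big)\Big)\bigg),$$ where $\|\mu\|_{L^\infty}$ is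 the $L^\infty$ norm of the density of $\mu$. -/

import Mathlib

open MeasureTheory Filter Topology
open scoped ENNReal FourierTransform SchwartzMap Laplacian ContDiff

/-- Euclidean space of dimension `n`. -/
abbrev Euc (n : ℕ) : Type := EuclideanSpace ℝ (Fin n)

/-- The numerical constants appearing in the assumptions on the potential. -/
structure PotentialConstants where
  /-- radius of the ball on which the local assumptions hold -/
  r₀ : ℝ
  r₀_pos : 0 < r₀
  /-- constant in the bound for the derivatives of order `k` -/
  Cder : ℕ → ℝ
  /-- constant in the local bound of the first two derivatives by the potential -/
  Cloc : ℝ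
  /-- constant in the lower bound for the Fourier transform -/
  C₁ : ℝ
  C₁_pos : 0 < C₁
  /-- constant in the upper bound for the Fourier transform -/
  C₂ : ℝ
  /-- doubling constant for `s > 0` -/
  cs : ℝ
  cs_lt_one : cs < 1
  /-- doubling constant for `s = 0` -/
  c₀ : ℝ
  c₀_pos : 0 < c₀

/-- `Δ G ≤ 0` in the ball `B(0,r)` in the sense of distributions. -/
def SuperharmonicInBall {n : ℕ} (G : Euc n → ℝ) (r : ℝ) : Prop :=
  LocallyIntegrableOn G (Metric.ball 0 r) volume ∧
  ∀ φ : Euc n → ℝ, ContDiff ℝ ∞ φ → HasCompactSupport φ → tsupport φ ⊆ Metric.ball 0 r →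
    (∀ X, 0 ≤ φ X) → ∫ X, G X * Δ φ X ≤ 0

/-- The Fourier transform of `G`, as a tempered distribution, coincides with the function `Ghat`
on the complement of the origin. -/
def HasFourierTransformOffZero {n : ℕ} (G Ghat : Euc n → ℝ) : Prop :=
  LocallyIntegrableOn Ghat {0}ᶜ volume ∧
  ∀ φ : 𝓢(Euc n, ℂ), (0 : Euc n) ∉ tsupport φ →
    ∫ X, (G X : ℂ) * 𝓕 (φ : Euc n → ℂ) X = ∫ Ξ, (Ghat Ξ : ℂ) * φ Ξ

/-- The assumptions on a Riesz-type potential `G` with singularity of order `s`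
(logarithmic if `s = 0`) on `ℝⁿ ∖ {0}`. The value of `G` at the origin is irrelevant. -/
structure IsRieszType (n : ℕ) (s : ℝ) (P : PotentialConstants) (G : Euc n → ℝ) : Prop where
  smooth : ContDiffOn ℝ ∞ G {0}ᶜ
  even : ∀ X, X ≠ 0 → G X = G (-X)
  tendsto_atTop : Tendsto G (𝓝[≠] 0) atTop
  superharmonic : SuperharmonicInBall G P.r₀
  deriv_bound : ∀ k : ℕ, ∀ X, X ≠ 0 →
    ‖iteratedFDeriv ℝ k G X‖ ≤
      P.Cder k * (1 / ‖X‖ ^ (s + k) + if s = 0 ∧ k = 0 then |Real.log ‖X‖| else 0)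
  deriv_local : ∀ X ∈ Metric.ball (0 : Euc n) P.r₀, X ≠ 0 →
    ‖X‖ * ‖fderiv ℝ G X‖ + ‖X‖ ^ 2 * ‖iteratedFDeriv ℝ 2 G X‖ ≤ P.Cloc * G X
  fourier : ∃ Ghat : Euc n → ℝ, HasFourierTransformOffZero G Ghat ∧
    ∀ Ξ, Ξ ≠ 0 →
      P.C₁ / ‖Ξ‖ ^ ((n : ℝ) - s) ≤ Ghat Ξ ∧ Ghat Ξ ≤ P.C₂ / ‖Ξ‖ ^ ((n : ℝ) - s)
  doubling_pos : 0 < s → ∀ X ∈ Metric.ball (0 : Euc n) P.r₀, ∀ Y ∈ Metric.ball (0 : Euc n) P.r₀,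
    X ≠ 0 → Y ≠ 0 → 2 * ‖X‖ ≤ ‖Y‖ → G Y < P.cs * G X
  doubling_log : s = 0 → ∀ X ∈ Metric.ball (0 : Euc n) P.r₀, ∀ Y ∈ Metric.ball (0 : Euc n) P.r₀,
    X ≠ 0 → Y ≠ 0 → 2 * ‖X‖ ≤ ‖Y‖ → P.c₀ ≤ G X - G Y

/-- The embedding `x ↦ (x, 0)` of `ℝᵈ` into `ℝᵈ⁺ᵐ`. -/
def zeroExtend {d : ℕ} (m : ℕ) (x : Euc d) : Euc (d + m) :=
  WithLp.toLp 2 (Fin.append (fun i => x i) (fun _ : Fin m => (0 : ℝ)))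

/-- Admissible potentials on `ℝᵈ`: for `s ≤ d - 2` the assumptions are made on `g` itself
(and `m = 0`); for `s > d - 2` they are made on an extension `G` of `g` to `ℝᵈ⁺ᵐ`. -/
def IsAdmissible (d m : ℕ) (s : ℝ) (P : PotentialConstants) (g : Euc d → ℝ) : Prop :=
  (s ≤ (d : ℝ) - 2 ∧ m = 0 ∧ IsRieszType d s P g) ∨
  ((d : ℝ) - 2 < s ∧ ∃ G : Euc (d + m) → ℝ,
    (∀ x, x ≠ 0 → G (zeroExtend m x) = g x) ∧ IsRieszType (d + m) s P G)

/-- The empirical measure `(1/N) ∑ᵢ δ_{xᵢ}`. -/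
noncomputable def empiricalMeasure {d N : ℕ} (x : Fin N → Euc d) : Measure (Euc d) :=
  (N : ℝ≥0∞)⁻¹ • ∑ i, Measure.dirac (x i)

/-- `∫∫_{x ≠ y} g(x - y) dν₁(x) dν₂(y)` -/
noncomputable def offDiagInteraction {d : ℕ} (g : Euc d → ℝ) (ν₁ ν₂ : Measure (Euc d)) : ℝ :=
  ∫ p in (Set.diagonal (Euc d))ᶜ, g (p.1 - p.2) ∂(ν₁.prod ν₂)

/-- The modulated energy: the integral of `g(x - y)` off the diagonal against the product of
the signed measure `μ_N - μ` with itself, `μ_N` being the empirical measure. -/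
noncomputable def modulatedEnergy {d N : ℕ} (g : Euc d → ℝ) (x : Fin N → Euc d)
    (μ : Measure (Euc d)) : ℝ :=
  offDiagInteraction g (empiricalMeasure x) (empiricalMeasure x)
    - offDiagInteraction g (empiricalMeasure x) μ
    - offDiagInteraction g μ (empiricalMeasure x)
    + offDiagInteraction g μ μ

/-- The Lebesgue density of `μ`. -/
noncomputable def density {d : ℕ} (μ : Measure (Euc d)) (x : Euc d) : ℝ :=
  (μ.rnDeriv volume x).toReal

/-- `‖μ‖_{L^∞}`, the essential supremum of the Lebesgue density of `μ`. -/
noncomputable def densitySupNorm {d : ℕ} (μ : Measure (Euc d)) : ℝ :=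
  (eLpNorm (density μ) ∞ volume).toReal

/-! Let `G` be the potential on `ℝⁿ`, `n = d + m`, whose restriction to `ℝᵈ` is `g`. Everything
rests on a splitting `G = p + S` at scale `ε` (`exists_decomposition`). The part `p` is
conditionally positive definite, in the form `p 0 - p X = ∫ q ξ (1 - cos (2π⟪X, ξ⟫))` with `q ≥ 0`,
and `p 0` is at most of order `ε⁻ˢ` (plus `|log ε|` if `s = 0`). The part `S` is nonnegative, has
integral `O(ε^(d-s))` over `ℝᵈ`, and dominates `G` (or `1`, if `s = 0`) up to a constant for `‖X‖ ≤
ε`. The modulated energy is additive in the kernel. By positive definiteness, `p` contributes at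
least `-p(0)/N`, the price of removing the diagonal (`interaction_sub_nonneg`). Since `S ≥ 0`, its
contribution is at least the particle sum minus the two cross terms, each at most `‖μ‖_∞ ∫ S`
(`sum_sub_le_modulatedEnergy`). Adding the two gives the estimate.

At a single scale `R`, the Gaussian average of the normalized central differences of order `2k` of
`G` is `smearRem`; what is left of `G` is `smoothPart`. High order differences make `smearRem` decay
at a prescribed polynomial rate (`ScaleControl.exists_smearRem_bound`), and `smoothPart` multiplies
the transform of `G` by an alternating sum of Gaussians that is bounded below by a Gaussian
(`exists_le_neg_sum_cdCoeff_mul_gauss`). As the transform is only known off the origin, only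
increments are represented (`ScaleControl.smear_zero_sub_smear`).

The obstacle is that `smearRem` may be negative. Its negative part is at most a multiple of
`scaleProfile`, so it can be compensated by adding a positive kernel with matching tails,
`tailKernel`; but this kernel is then subtracted from the other part and may spoil positivity in
Fourier space. Dyadic scales `ε / 2^j` resolve the conflict. Over all scales `j < L + I` the
potential is split and averaged, but the correction is added only for `j < L`. In Fourier space the
sum of the corrections is bounded by a Gaussian at scale `ε / 2^L` with a constant independent of
`L` (`exists_dyadic_sum_le`), so a number `I` of extra scales, chosen before `L`, pays for it
(`exists_longHat_nonneg`). In physical space the last `I` scales are uncompensated, and a large `L`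
pays for them: by the surplus of the coarser scales if `s = 0` (`le_mul_shortPart_of_zero`), and if
`s > 0` also by the lower bound `G X ≥ c ‖X‖⁻ˢ` near the origin (`le_mul_shortPart_of_pos`). That
bound comes from testing the lower Fourier bound on annuli and from the doubling condition
(`exists_riesz_lower_bound`). -/

/-! ### The Gaussian -/

/-- The Gaussian `exp (-π |x|²)`, which is its own Fourier transform. -/
noncomputable def gauss {n : ℕ} (x : Euc n) : ℝ := Real.exp (-(Real.pi * ‖x‖ ^ 2))

lemma gauss_pos {n : ℕ} (x : Euc n) : 0 < gauss x := Real.exp_pos _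

lemma gauss_le_one {n : ℕ} (x : Euc n) : gauss x ≤ 1 :=
  Real.exp_le_one_iff.2 (neg_nonpos.2 (by positivity))

lemma gauss_mono {n : ℕ} {x y : Euc n} (h : ‖x‖ ≤ ‖y‖) : gauss y ≤ gauss x := by
  unfold gauss; gcongr

lemma contDiff_gauss {n : ℕ} : ContDiff ℝ ∞ (gauss : Euc n → ℝ) := by
  unfold gauss
  exact Real.contDiff_exp.comp (contDiff_const.mul (contDiff_norm_sq ℝ)).neg

lemma continuous_gauss {n : ℕ} : Continuous (gauss : Euc n → ℝ) := contDiff_gauss.continuous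

lemma gauss_neg {n : ℕ} (x : Euc n) : gauss (-x) = gauss x := by simp [gauss]

/-- The derivatives of a composition with `exp` are at most `j!` times the Gaussian times a power of
a polynomially growing bound for the derivatives of the exponent, and the Gaussian absorbs any
polynomial. -/
lemma gauss_decay {n : ℕ} (k j : ℕ) :
    ∃ C, ∀ x : Euc n, ‖x‖ ^ k * ‖iteratedFDeriv ℝ j (gauss : Euc n → ℝ) x‖ ≤ C := by
  have htg : Function.HasTemperateGrowth (fun x : Euc n => -(Real.pi * ‖x‖ ^ 2)) :=
    ((Function.HasTemperateGrowth.const Real.pi).mul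
      (Function.hasTemperateGrowth_norm_sq (Euc n))).neg
  obtain ⟨m, C, hC, hb⟩ := htg.norm_iteratedFDeriv_le_uniform j
  set C' := max C 1
  have key : ∀ x : Euc n, ‖iteratedFDeriv ℝ j (gauss : Euc n → ℝ) x‖ ≤
      j.factorial * gauss x * (C' * (1 + ‖x‖) ^ m) ^ j := by
    intro x
    refine norm_iteratedFDeriv_comp_le (g := Real.exp) (N := ∞) Real.contDiff_exp htg.1
      (by exact_mod_cast le_top) x (fun i _ => ?_) (fun i hi hij => ?_)
    · rw [norm_iteratedFDeriv_eq_norm_iteratedDeriv, iteratedDeriv_eq_iterate, Real.iter_deriv_exp]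
      simp [gauss]
    · have h1 : 1 ≤ C' * (1 + ‖x‖) ^ m :=
        one_le_mul_of_one_le_of_one_le (le_max_right _ _)
          (one_le_pow₀ (by linarith [norm_nonneg x]))
      calc _ ≤ C * (1 + ‖x‖) ^ m := hb i hij x
        _ ≤ C' * (1 + ‖x‖) ^ m := by gcongr; exact le_max_left _ _
        _ ≤ _ := le_self_pow₀ h1 (by omega)
  set N := k + m * j
  have hexp : ∀ t : ℝ, 0 ≤ t → (1 + t) ^ N * Real.exp (-(Real.pi * t ^ 2)) ≤
      N.factorial * Real.exp 2 := by
    intro t ht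
    have h1 := Real.pow_div_factorial_le_exp (1 + t) (by linarith) N
    rw [div_le_iff₀ (by positivity)] at h1
    calc _ ≤ (Real.exp (1 + t) * N.factorial) * Real.exp (-(Real.pi * t ^ 2)) := by gcongr
      _ = N.factorial * Real.exp (1 + t - Real.pi * t ^ 2) := by
        rw [sub_eq_add_neg, Real.exp_add (1 + t)]; ring
      _ ≤ _ := by
        gcongr
        nlinarith [Real.pi_gt_three, sq_nonneg (t - 1), sq_nonneg t]
  refine ⟨j.factorial * C' ^ j * (N.factorial * Real.exp 2), fun x => ?_⟩
  calc _ ≤ (1 + ‖x‖) ^ k * (j.factorial * gauss x * (C' * (1 + ‖x‖) ^ m) ^ j) := by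
        gcongr
        · linarith
        · exact key x
    _ = j.factorial * C' ^ j * ((1 + ‖x‖) ^ N * Real.exp (-(Real.pi * ‖x‖ ^ 2))) := by
        simp only [gauss, N, pow_add, pow_mul, mul_pow]; ring
    _ ≤ _ := mul_le_mul_of_nonneg_left (hexp _ (norm_nonneg _)) (by positivity)

/-- The Gaussian as a Schwartz function. -/
noncomputable def gaussSchwartz (n : ℕ) : 𝓢(Euc n, ℝ) where
  toFun := gauss
  smooth' := contDiff_gauss
  decay' := gauss_decay

lemma integrable_pow_mul_gauss {n : ℕ} (q : ℕ) :
    Integrable (fun x : Euc n => ‖x‖ ^ q * gauss x) := by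
  have := (gaussSchwartz n).integrable_pow_mul volume q
  refine this.congr (.of_forall fun x => ?_)
  have h : (gaussSchwartz n) x = gauss x := rfl
  simp only [h, Real.norm_of_nonneg (gauss_pos x).le]

lemma integrable_gauss {n : ℕ} : Integrable (gauss : Euc n → ℝ) := by
  simpa using integrable_pow_mul_gauss (n := n) 0

lemma pow_mul_gauss_bounded {n : ℕ} (q : ℕ) : ∃ C, 0 ≤ C ∧ ∀ x : Euc n, ‖x‖ ^ q * gauss x ≤ C := by
  obtain ⟨C, hC⟩ := gauss_decay (n := n) q 0
  simp only [norm_iteratedFDeriv_zero, Real.norm_eq_abs, abs_of_pos (gauss_pos _)] at hC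
  exact ⟨C, le_trans (by have := gauss_pos (0 : Euc n); positivity) (hC 0), hC⟩

lemma integral_gauss_smul_mul_cexp {n : ℕ} {t : ℝ} (ht : 0 < t) (X : Euc n) :
    ∫ ξ : Euc n, (gauss (t • ξ) : ℂ) * Complex.exp (2 * Real.pi * Complex.I * inner ℝ X ξ) =
      ((t ^ n)⁻¹ * gauss (t⁻¹ • X) : ℝ) := by
  have hb : 0 < ((Real.pi * t ^ 2 : ℝ) : ℂ).re := by rw [Complex.ofReal_re]; positivity
  have := GaussianFourier.integral_cexp_neg_mul_sq_norm_add hb (2 * Real.pi * Complex.I) X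
  convert this using 1
  · congr 1; ext ξ
    rw [Complex.exp_add]
    congr 1
    simp [gauss, norm_smul, mul_pow]; ring_nf
  · have hpi := Real.pi_ne_zero
    have h1 : ((Real.pi : ℂ) / ((Real.pi * t ^ 2 : ℝ) : ℂ)) = ((t⁻¹ ^ 2 : ℝ) : ℂ) := by
      push_cast
      have : (Real.pi : ℂ) ≠ 0 := by exact_mod_cast hpi
      have : (t : ℂ) ≠ 0 := by exact_mod_cast ht.ne'
      field_simp
    rw [h1]
    have h2 : ((t⁻¹ ^ 2 : ℝ) : ℂ) ^ ((Module.finrank ℝ (Euc n) : ℂ) / 2) = (((t ^ n)⁻¹ : ℝ) : ℂ) := by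
      have : ((Module.finrank ℝ (Euc n) : ℂ) / 2) = (((n : ℝ) / 2 : ℝ) : ℂ) := by simp
      rw [this, ← Complex.ofReal_cpow (by positivity)]
      congr 1
      rw [← Real.rpow_natCast, ← Real.rpow_mul (by positivity), ← inv_pow, ← Real.rpow_natCast]
      congr 1; push_cast; ring
    rw [h2]
    push_cast
    congr 1
    simp only [gauss, norm_smul, Real.norm_eq_abs, abs_of_pos (inv_pos.2 ht)]
    push_cast
    congr 1
    have : (Real.pi : ℂ) ≠ 0 := by exact_mod_cast hpi
    have : (t : ℂ) ≠ 0 := by exact_mod_cast ht.ne'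
    field_simp
    rw [Complex.I_sq]; ring

lemma integral_gauss {n : ℕ} : ∫ x : Euc n, gauss x = 1 := by
  have := integral_gauss_smul_mul_cexp (n := n) one_pos 0
  simp only [one_smul, inner_zero_left, Complex.ofReal_zero, mul_zero, Complex.exp_zero, mul_one,
    one_pow, inv_one, one_mul, smul_zero] at this
  rw [integral_complex_ofReal] at this
  have h2 := Complex.ofReal_injective this
  simpa [gauss] using h2

lemma integrable_gauss_smul {n : ℕ} {t : ℝ} (ht : 0 < t) :
    Integrable (fun ξ : Euc n => gauss (t • ξ)) :=
  integrable_gauss.comp_smul ht.ne'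

lemma integrable_ofReal_mul_cexp {n : ℕ} {f : Euc n → ℝ} (hf : Integrable f) (X : Euc n) :
    Integrable (fun ξ : Euc n =>
      (f ξ : ℂ) * Complex.exp (2 * Real.pi * Complex.I * inner ℝ X ξ)) := by
  refine hf.norm.mono' (hf.ofReal.1.mul (Continuous.aestronglyMeasurable (by fun_prop)))
    (.of_forall fun ξ => ?_)
  have : (2 * Real.pi * Complex.I * (inner ℝ X ξ : ℝ) : ℂ) =
    ((2 * Real.pi * inner ℝ X ξ : ℝ) : ℂ) * Complex.I := by push_cast; ring
  rw [norm_mul, this, Complex.norm_exp_ofReal_mul_I, mul_one, Complex.norm_real]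

lemma integral_gauss_smul_mul_cos {n : ℕ} {t : ℝ} (ht : 0 < t) (X : Euc n) :
    ∫ ξ : Euc n, gauss (t • ξ) * Real.cos (2 * Real.pi * inner ℝ X ξ) =
      (t ^ n)⁻¹ * gauss (t⁻¹ • X) := by
  have h := congrArg Complex.re (integral_gauss_smul_mul_cexp ht X)
  rw [Complex.ofReal_re] at h
  rw [← h, ← RCLike.re_eq_complex_re, ← integral_re]
  · congr 1; ext ξ
    have : (2 * Real.pi * Complex.I * (inner ℝ X ξ : ℝ) : ℂ) =
      ((2 * Real.pi * inner ℝ X ξ : ℝ) : ℂ) * Complex.I := by push_cast; ring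
    rw [this, RCLike.re_eq_complex_re, Complex.re_ofReal_mul, Complex.exp_ofReal_mul_I_re]
  · exact integrable_ofReal_mul_cexp (integrable_gauss_smul ht) X

/-! ### Integrable powers of the norm -/

lemma integrableOn_ball_norm_rpow {n : ℕ} (hn : 0 < n) {a : ℝ} (han : a < n) :
    IntegrableOn (fun x : Euc n => ‖x‖ ^ (-a)) (Metric.ball 0 1) := by
  have : Nonempty (Fin n) := ⟨⟨0, hn⟩⟩
  rw [integrableOn_fun_norm_addHaar volume (f := fun y : ℝ => y ^ (-a))]
  have h : IntegrableOn (fun y : ℝ => y ^ ((n : ℝ) - 1 - a)) (Set.Ioo 0 1) :=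
    (intervalIntegral.integrableOn_Ioo_rpow_iff one_pos).2 (by linarith)
  refine h.congr_fun (fun y hy => ?_) measurableSet_Ioo
  simp only [finrank_euclideanSpace, Fintype.card_fin, smul_eq_mul]
  rw [← Real.rpow_natCast, ← Real.rpow_add hy.1, Nat.cast_sub (Nat.one_le_iff_ne_zero.2 hn.ne')]
  congr 1; push_cast; ring

/-- Split according to whether `Y + τ • h` lies in the unit ball. Outside, the power is at most `1`;
inside, `u ≤ M`, and the change of variables by `τ` does not increase the integral because `1 ≤
|τ|`. The point is the uniformity in `Y` and `τ`. -/
lemma exists_integral_mul_shift_rpow_le {n : ℕ} (hn : 0 < n) {a : ℝ} (ha : 0 ≤ a) (han : a < n) :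
    ∃ V, 0 ≤ V ∧ ∀ (u : Euc n → ℝ) (M : ℝ), Integrable u → (∀ h, 0 ≤ u h) → (∀ h, u h ≤ M) →
      ∀ (Y : Euc n) (τ : ℝ), 1 ≤ |τ| → Integrable (fun h => u h * ‖Y + τ • h‖ ^ (-a)) ∧
        ∫ h, u h * ‖Y + τ • h‖ ^ (-a) ≤ M * V + ∫ h, u h := by
  set f : Euc n → ℝ := (Metric.ball 0 1).indicator (fun z => ‖z‖ ^ (-a))
  have hf : Integrable f := (integrableOn_ball_norm_rpow hn han).integrable_indicator
    measurableSet_ball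
  have hf0 : ∀ z, 0 ≤ f z := fun z => Set.indicator_nonneg (fun z _ => by positivity) z
  refine ⟨∫ z, f z, integral_nonneg hf0, fun u M hu hu0 huM Y τ hτ => ?_⟩
  have hM : 0 ≤ M := (hu0 0).trans (huM 0)
  have hτ0 : τ ≠ 0 := by rintro rfl; simp at hτ; linarith
  have hg : Integrable (fun h => f (Y + τ • h)) :=
    Integrable.comp_smul (f := fun z => f (Y + z)) (hf.comp_add_left Y) hτ0
  have hgi : ∫ h, f (Y + τ • h) ≤ ∫ z, f z := by
    rw [Measure.integral_comp_smul volume (fun z => f (Y + z)) τ, integral_add_left_eq_self f Y]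
    rw [smul_eq_mul]
    refine mul_le_of_le_one_left (integral_nonneg hf0) ?_
    rw [abs_inv, abs_pow]
    exact inv_le_one_of_one_le₀ (one_le_pow₀ hτ)
  have hpt : ∀ h, u h * ‖Y + τ • h‖ ^ (-a) ≤ M * f (Y + τ • h) + u h := by
    intro h
    by_cases hz : Y + τ • h ∈ Metric.ball (0 : Euc n) 1
    · have : f (Y + τ • h) = ‖Y + τ • h‖ ^ (-a) := Set.indicator_of_mem hz _
      rw [this]
      have : u h * ‖Y + τ • h‖ ^ (-a) ≤ M * ‖Y + τ • h‖ ^ (-a) := by gcongr; exact huM h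
      linarith [hu0 h]
    · have h1 : ‖Y + τ • h‖ ^ (-a) ≤ 1 :=
        Real.rpow_le_one_of_one_le_of_nonpos (by simpa using hz) (by linarith)
      have := mul_le_mul_of_nonneg_left h1 (hu0 h)
      nlinarith [mul_nonneg hM (hf0 (Y + τ • h))]
  have hint : Integrable (fun h => M * f (Y + τ • h) + u h) := (hg.const_mul M).add hu
  have hm : AEStronglyMeasurable (fun h => u h * ‖Y + τ • h‖ ^ (-a)) volume := by
    refine hu.1.mul (Measurable.aestronglyMeasurable ?_)
    fun_prop
  have hI : Integrable (fun h => u h * ‖Y + τ • h‖ ^ (-a)) := by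
    refine hint.mono' hm (.of_forall fun h => ?_)
    rw [Real.norm_of_nonneg (mul_nonneg (hu0 h) (by positivity))]
    exact hpt h
  refine ⟨hI, (integral_mono hI hint hpt).trans ?_⟩
  rw [integral_add (hg.const_mul M) hu, integral_const_mul]
  gcongr

lemma exists_gauss_moment_le {n : ℕ} (hn : 0 < n) {a : ℝ} (ha : 0 ≤ a) (han : a < n) (q : ℕ) :
    ∃ C, 0 ≤ C ∧ ∀ (Y : Euc n) (τ : ℝ), 1 ≤ |τ| →
      Integrable (fun h => ‖h‖ ^ q * gauss h * ‖Y + τ • h‖ ^ (-a)) ∧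
        ∫ h, ‖h‖ ^ q * gauss h * ‖Y + τ • h‖ ^ (-a) ≤ C := by
  obtain ⟨V, hV, h⟩ := exists_integral_mul_shift_rpow_le hn ha han
  obtain ⟨M, hM, hMb⟩ := pow_mul_gauss_bounded (n := n) q
  have h0 : ∀ x : Euc n, 0 ≤ ‖x‖ ^ q * gauss x := fun x =>
    mul_nonneg (by positivity) (gauss_pos x).le
  refine ⟨M * V + ∫ x : Euc n, ‖x‖ ^ q * gauss x, ?_, fun Y τ hτ => ?_⟩
  · have : 0 ≤ ∫ x : Euc n, ‖x‖ ^ q * gauss x := integral_nonneg h0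
    positivity
  · exact h _ M (integrable_pow_mul_gauss q) h0 hMb Y τ hτ

/-! ### Central differences -/

/-- Taking one difference of every `F i` yields a family of the same kind with one derivative fewer
to use, and the mean value inequality on an interval of length one bounds its top member. -/
lemma abs_fwdDiff_iter_le {m : ℕ} : ∀ {F : ℕ → ℝ → ℝ} {a B : ℝ},
    (∀ i < m, ∀ t ∈ Set.Icc a (a + m), HasDerivAt (F i) (F (i + 1) t) t) →
    (∀ t ∈ Set.Icc a (a + m), |F m t| ≤ B) → |(fwdDiff 1)^[m] (F 0) a| ≤ B := by
  induction m with
  | zero => intro F a B _ hB; simpa using hB a (by simp)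
  | succ m ih =>
    intro F a B hd hB
    have hsub : ∀ t ∈ Set.Icc a (a + m), ∀ u ∈ Set.Icc t (t + 1),
        u ∈ Set.Icc a (a + (m + 1 : ℕ)) := by
      intro t ht u hu
      push_cast
      exact ⟨ht.1.trans hu.1, by linarith [hu.2, ht.2]⟩
    rw [Function.iterate_succ_apply]
    refine ih (F := fun i => fwdDiff 1 (F i)) (fun i hi t ht => ?_) (fun t ht => ?_)
    · have h1 := hd i (by omega) t (hsub t ht t ⟨le_rfl, by linarith⟩)
      have h2 := hd i (by omega) (t + 1) (hsub t ht (t + 1) ⟨by linarith, le_rfl⟩)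
      exact (h2.comp_add_const t 1).sub h1
    · have := (convex_Icc t (t + 1)).norm_image_sub_le_of_norm_hasDerivWithin_le (f := F m)
        (f' := F (m + 1)) (C := B) (x := t) (y := t + 1)
        (fun u hu => (hd m (by omega) u (hsub t ht u hu)).hasDerivWithinAt)
        (fun u hu => hB u (hsub t ht u hu)) ⟨le_rfl, by linarith⟩ ⟨by linarith, le_rfl⟩
      simpa [fwdDiff] using this

/-- The coefficients of the normalized central difference of order `2 k`, folded on the
positive side. -/
noncomputable def cdCoeff (k i : ℕ) : ℝ :=
  2 * (-1) ^ (i + 1) * ((2 * k).choose (k + i + 1) / (2 * k).choose k)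

/-- The nodes `k - 1 - i` and `k + 1 + i` carry the same weight and, by evenness, the same value,
which produces the factor `2` in `cdCoeff`. -/
lemma centralDiff_eq (k : ℕ) {F : ℝ → ℝ} (hF : ∀ τ, F (-τ) = F τ) :
    ∑ j ∈ Finset.range (2 * k + 1),
        ((-1 : ℝ) ^ j * (2 * k).choose j) * F ((j : ℝ) - k) =
      (-1) ^ k * (2 * k).choose k *
        (F 0 + ∑ i ∈ Finset.range k, cdCoeff k i * F (i + 1)) := by
  have hpos : ((2 * k).choose k : ℝ) ≠ 0 := by
    exact_mod_cast (Nat.choose_pos (by omega)).ne'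
  have e : 2 * k + 1 = k + (k + 1) := by ring
  rw [e, Finset.sum_range_add, Finset.sum_range_succ', ← Finset.sum_range_reflect]
  simp only [Nat.add_zero, sub_self]
  rw [mul_add, ← add_assoc, ← Finset.sum_add_distrib, add_comm]
  congr 1
  rw [Finset.mul_sum]
  refine Finset.sum_congr rfl fun i hi => ?_
  have hi' : i < k := Finset.mem_range.1 hi
  have h1 : ((k - 1 - i : ℕ) : ℝ) - k = -((i : ℝ) + 1) := by
    rw [Nat.sub_sub, Nat.cast_sub (by omega)]; push_cast; ring
  have h2 : ((k + (i + 1) : ℕ) : ℝ) - k = (i : ℝ) + 1 := by push_cast; ring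
  have h3 : (2 * k).choose (k - 1 - i) = (2 * k).choose (k + i + 1) := by
    rw [← Nat.choose_symm (by omega : k + i + 1 ≤ 2 * k)]; congr 1; omega
  have h4 : (-1 : ℝ) ^ (k - 1 - i) = (-1) ^ (k + (i + 1)) := by
    rw [show k + (i + 1) = (k - 1 - i) + 2 * (i + 1) by omega, pow_add, pow_mul]; simp
  rw [h1, h2, h3, h4, hF, ← add_assoc k i 1]
  simp only [cdCoeff]
  field_simp
  ring

lemma sum_alternating_choose_mul {k : ℕ} (hk : 0 < k) (c : ℝ) :
    ∑ j ∈ Finset.range (2 * k + 1), ((-1 : ℝ) ^ j * (2 * k).choose j) * c = 0 := by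
  rw [← Finset.sum_mul]
  have h := Int.alternating_sum_range_choose_of_ne (n := 2 * k) (by omega)
  have h' : ∑ j ∈ Finset.range (2 * k + 1), ((-1 : ℝ) ^ j * (2 * k).choose j) = 0 := by
    exact_mod_cast h
  rw [h', zero_mul]

/-- A central difference of positive order kills constants. This allows the reference value `b R` to
be subtracted from `G` at no cost. -/
lemma one_add_sum_cdCoeff {k : ℕ} (hk : 0 < k) :
    1 + ∑ i ∈ Finset.range k, cdCoeff k i = 0 := by
  have h := centralDiff_eq k (F := fun _ => 1) (fun _ => rfl)
  rw [sum_alternating_choose_mul hk] at h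
  have hpos : ((2 * k).choose k : ℝ) ≠ 0 := by
    exact_mod_cast (Nat.choose_pos (by omega)).ne'
  have : ((-1 : ℝ) ^ k * (2 * k).choose k) ≠ 0 := mul_ne_zero (by simp) hpos
  simpa [this] using h.symm

lemma alternating_sum_mem {b : ℕ → ℝ} (hb : Antitone b) (h0 : ∀ i, 0 ≤ b i) (m : ℕ) :
    0 ≤ ∑ i ∈ Finset.range m, (-1) ^ i * b i ∧ ∑ i ∈ Finset.range m, (-1) ^ i * b i ≤ b 0 := by
  induction m generalizing b with
  | zero => simpa using h0 0
  | succ m ih =>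
    have := ih (b := fun i => b (i + 1)) (fun i j hij => hb (by omega)) (fun i => h0 _)
    rw [Finset.sum_range_succ']
    have e : ∑ i ∈ Finset.range m, (-1) ^ (i + 1) * b (i + 1) =
        -∑ i ∈ Finset.range m, (-1) ^ i * b (i + 1) := by
      rw [← Finset.sum_neg_distrib]; exact Finset.sum_congr rfl fun i _ => by ring
    rw [e]
    have h1 : b 1 ≤ b 0 := hb (by omega)
    simp only [zero_add] at this
    constructor <;> simp <;> linarith [this.1, this.2]

lemma choose_two_mul_succ_le {k j : ℕ} (hj : k ≤ j) :
    (2 * k).choose (j + 1) * (j + 1) ≤ (2 * k).choose j * k := by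
  rw [Nat.choose_succ_right_eq]
  exact Nat.mul_le_mul_left _ (by omega)

/-- The Fourier multiplier of the Gaussian central differences is bounded below. -/
lemma exists_le_neg_sum_cdCoeff_mul_gauss {n k : ℕ} (hk : 0 < k) :
    ∃ c, 0 < c ∧ ∀ ξ : Euc n, c * gauss ξ ≤
      -∑ i ∈ Finset.range k, cdCoeff k i * gauss (((i : ℝ) + 1) • ξ) := by
  set β : ℕ → ℝ := fun i => ((2 * k).choose (k + i + 1) : ℝ) / (2 * k).choose k
  have hpos : (0 : ℝ) < (2 * k).choose k := by exact_mod_cast Nat.choose_pos (by omega)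
  have hβ0 : ∀ i, 0 ≤ β i := fun i => by positivity
  have hβ : Antitone β := antitone_nat_of_succ_le fun i => by
    refine div_le_div_of_nonneg_right ?_ hpos.le
    have h := choose_two_mul_succ_le (k := k) (j := k + i + 1) (by omega)
    have : (2 * k).choose (k + i + 1 + 1) ≤ (2 * k).choose (k + i + 1) := by
      by_contra hc
      push Not at hc
      nlinarith
    exact_mod_cast this
  have hβ1 : β 1 < β 0 := by
    refine div_lt_div_of_pos_right ?_ hpos
    have h := choose_two_mul_succ_le (k := k) (j := k + 0 + 1) (by omega)
    have hp : 0 < (2 * k).choose (k + 0 + 1) := Nat.choose_pos (by omega)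
    have : (2 * k).choose (k + 1 + 1) < (2 * k).choose (k + 0 + 1) := by
      by_contra hc
      push Not at hc
      simp only [Nat.add_zero] at *
      nlinarith
    exact_mod_cast this
  -- The weights `β i` and the dilated Gaussians both decrease in `i`, so the alternating sum is at
  -- least its first term minus its second; the strict drop from `β 0` to `β 1` leaves a positive
  -- multiple of `gauss ξ`.
  refine ⟨2 * (β 0 - β 1), by linarith, fun ξ => ?_⟩
  set b : ℕ → ℝ := fun i => β i * gauss (((i : ℝ) + 1) • ξ)
  have hg : Antitone fun i : ℕ => gauss (((i : ℝ) + 1) • ξ) := fun i j hij => by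
    refine gauss_mono ?_
    simp only [norm_smul, Real.norm_eq_abs]
    have : (i : ℝ) ≤ j := by exact_mod_cast hij
    gcongr
  have hb : Antitone b := fun i j hij =>
    mul_le_mul (hβ hij) (hg hij) (gauss_pos _).le (hβ0 _)
  have hb0 : ∀ i, 0 ≤ b i := fun i => mul_nonneg (hβ0 i) (gauss_pos _).le
  obtain ⟨m, rfl⟩ : ∃ m, k = m + 1 := ⟨k - 1, by omega⟩
  have h1 := (alternating_sum_mem (b := fun i => b (i + 1)) (fun i j hij => hb (by omega))
    (fun i => hb0 _) m).2
  have e : -∑ i ∈ Finset.range (m + 1), cdCoeff (m + 1) i * gauss (((i : ℝ) + 1) • ξ) =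
      2 * (b 0 - ∑ i ∈ Finset.range m, (-1) ^ i * b (i + 1)) := by
    have : ∀ i, cdCoeff (m + 1) i * gauss (((i : ℝ) + 1) • ξ) = -2 * ((-1) ^ i * b i) := by
      intro i; simp only [cdCoeff, b, β]; ring
    simp only [this]
    rw [← Finset.mul_sum, Finset.sum_range_succ']
    have : ∑ i ∈ Finset.range m, (-1) ^ (i + 1) * b (i + 1) =
        -∑ i ∈ Finset.range m, (-1) ^ i * b (i + 1) := by
      rw [← Finset.sum_neg_distrib]; exact Finset.sum_congr rfl fun i _ => by ring
    rw [this]; ring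
  rw [e]
  have h2 : b 0 = β 0 * gauss ξ := by simp [b]
  have h3 : b 1 ≤ β 1 * gauss ξ := by
    refine mul_le_mul_of_nonneg_left ?_ (hβ0 1)
    simpa using hg (show 0 ≤ 1 by omega)
  simp only [zero_add] at h1
  linarith

/-! ### Gaussian averages of functions controlled at every scale -/

/-- `G` is smooth off the origin, its oscillation at scale `R` around the reference value `b R` is
of order `R⁻ˢ`, its derivative of order `K` has the homogeneity `-s - K`, and it is bounded below
by `b R - C R⁻ˢ` at distance at most `R < ρ` from the origin. -/
structure ScaleControl {n : ℕ} (s a C ρ : ℝ) (K : ℕ) (G : Euc n → ℝ) (b : ℝ → ℝ) : Prop where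
  smooth : ContDiffOn ℝ ∞ G {0}ᶜ
  osc : ∀ R, 0 < R → ∀ X, X ≠ 0 →
    |G X - b R| ≤ C * R ^ (-s) * ((‖X‖ / R) ^ (-a) + ‖X‖ / R)
  deriv : ∀ X, X ≠ 0 → ‖iteratedFDeriv ℝ K G X‖ ≤ C * ‖X‖ ^ (-(s + K))
  lower : ∀ R, 0 < R → R < ρ → ∀ X, X ≠ 0 → ‖X‖ ≤ R → -(C * R ^ (-s)) ≤ G X - b R

/-- The average of `G` around `X` with respect to the Gaussian at scale `t`. -/
noncomputable def smear {n : ℕ} (G : Euc n → ℝ) (t : ℝ) (X : Euc n) : ℝ :=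
  ∫ h, gauss h * G (X + t • h)

lemma smear_zero {n : ℕ} (G : Euc n → ℝ) (X : Euc n) : smear G 0 X = G X := by
  simp [smear, integral_mul_const, integral_gauss]

lemma smear_neg {n : ℕ} (G : Euc n → ℝ) (t : ℝ) (X : Euc n) : smear G (-t) X = smear G t X := by
  unfold smear
  rw [← integral_neg_eq_self]
  simp [gauss_neg]

/-- The difference between `G` and its Gaussian regularization of order `2 k` at scale `R`. -/
noncomputable def smearRem {n : ℕ} (k : ℕ) (G : Euc n → ℝ) (R : ℝ) (X : Euc n) : ℝ :=
  G X + ∑ i ∈ Finset.range k, cdCoeff k i * smear G (((i : ℝ) + 1) * R) X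

lemma ae_add_smul_ne_zero {n : ℕ} (hn : 0 < n) (X : Euc n) {t : ℝ} (ht : t ≠ 0) :
    ∀ᵐ h : Euc n, X + t • h ≠ 0 := by
  have : Nonempty (Fin n) := ⟨⟨0, hn⟩⟩
  have h0 : volume ({(-t⁻¹) • X} : Set (Euc n)) = 0 := measure_singleton _
  filter_upwards [compl_mem_ae_iff.2 h0] with h hh hc
  apply hh
  have : t • h = -X := by rw [eq_neg_iff_add_eq_zero, add_comm]; exact hc
  rw [Set.mem_singleton_iff, neg_smul, ← smul_neg, ← this, smul_smul, inv_mul_cancel₀ ht, one_smul]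

namespace ScaleControl

variable {n : ℕ} {s a C ρ : ℝ} {K : ℕ} {G : Euc n → ℝ} {b : ℝ → ℝ}

lemma measurable (hG : ScaleControl s a C ρ K G b) : Measurable G :=
  measurable_of_continuousOn_compl_singleton 0 hG.smooth.continuousOn

lemma const_nonneg (hn : 0 < n) (hG : ScaleControl s a C ρ K G b) : 0 ≤ C := by
  have h := hG.osc 1 one_pos (EuclideanSpace.single ⟨0, hn⟩ 1) (by simp)
  have := (abs_nonneg _).trans h
  simp at this
  linarith

lemma abs_sub_le (hG : ScaleControl s a C ρ K G b) {R : ℝ} (hR : 0 < R) {X h : Euc n} {τ : ℝ}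
    (hX : X + (τ * R) • h ≠ 0) :
    |G (X + (τ * R) • h) - b R| ≤
      C * R ^ (-s) * (‖R⁻¹ • X + τ • h‖ ^ (-a) + (‖X‖ / R + |τ| * ‖h‖)) := by
  have e : ‖X + (τ * R) • h‖ / R = ‖R⁻¹ • X + τ • h‖ := by
    rw [div_eq_inv_mul, ← abs_of_pos (inv_pos.2 hR), ← Real.norm_eq_abs, ← norm_smul, smul_add,
      smul_smul]
    congr 3
    rw [Real.norm_eq_abs, abs_of_pos (inv_pos.2 hR)]
    field_simp
  have h1 := hG.osc R hR _ hX
  rw [e] at h1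
  -- The sign of the constant is read off from the oscillation bound itself, whose left side is
  -- nonnegative and whose last factor is positive.
  have hC : 0 ≤ C * R ^ (-s) := by
    by_contra hc
    have h2 := (abs_nonneg _).trans h1
    have : 0 < ‖R⁻¹ • X + τ • h‖ := by
      rw [← e]; exact div_pos (norm_pos_iff.2 hX) hR
    have : 0 < ‖R⁻¹ • X + τ • h‖ ^ (-a) + ‖R⁻¹ • X + τ • h‖ := by positivity
    nlinarith
  refine h1.trans (mul_le_mul_of_nonneg_left ?_ hC)
  gcongr
  refine (norm_add_le _ _).trans (le_of_eq ?_)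
  rw [norm_smul, norm_smul, Real.norm_eq_abs, Real.norm_eq_abs, abs_of_pos (inv_pos.2 hR),
    div_eq_inv_mul]

/-- Integrate the oscillation bound against the Gaussian: the singular power is integrable uniformly
in the shift, and the linear growth costs a first moment. The constant depends only on `n` and `a`,
not on `G`. -/
lemma exists_smear_sub_le (hn : 0 < n) (ha : 0 ≤ a) (han : a < n) :
    ∃ D, 0 ≤ D ∧ ∀ {s C ρ : ℝ} {K : ℕ} {G : Euc n → ℝ} {b : ℝ → ℝ}, ScaleControl s a C ρ K G b →
      ∀ R, 0 < R → ∀ τ : ℝ, 1 ≤ |τ| → ∀ X,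
        Integrable (fun h => gauss h * G (X + (τ * R) • h)) ∧
        |smear G (τ * R) X - b R| ≤ C * R ^ (-s) * (D * (1 + ‖X‖ / R + |τ|)) := by
  obtain ⟨D₁, hD₁, h₁⟩ := exists_gauss_moment_le hn ha han 0
  set D₂ := ∫ h : Euc n, ‖h‖ ^ 1 * gauss h
  have hD₂ : 0 ≤ D₂ := integral_nonneg fun h => mul_nonneg (by positivity) (gauss_pos h).le
  refine ⟨D₁ + D₂ + 1, by positivity, fun {s C ρ K G b} hG R hR τ hτ X => ?_⟩
  have hC := hG.const_nonneg hn
  have hτ0 : τ ≠ 0 := by rintro rfl; simp at hτ; linarith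
  obtain ⟨hi, hle⟩ := h₁ (R⁻¹ • X) τ hτ
  simp only [pow_zero, one_mul] at hi hle
  have hi1 := integrable_pow_mul_gauss (n := n) 1
  have hi0 := integrable_gauss (n := n)
  set B : Euc n → ℝ := fun h => C * R ^ (-s) *
    (gauss h * ‖R⁻¹ • X + τ • h‖ ^ (-a) + (‖X‖ / R * gauss h + |τ| * (‖h‖ ^ 1 * gauss h)))
  have hi2 : Integrable (fun h : Euc n => ‖X‖ / R * gauss h + |τ| * (‖h‖ ^ 1 * gauss h)) :=
    (hi0.const_mul _).add (hi1.const_mul _)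
  have hB : Integrable B := (hi.add hi2).const_mul _
  have hpt : ∀ᵐ h : Euc n, ‖gauss h * (G (X + (τ * R) • h) - b R)‖ ≤ B h := by
    filter_upwards [ae_add_smul_ne_zero hn X (mul_ne_zero hτ0 hR.ne')] with h hh
    rw [norm_mul, Real.norm_of_nonneg (gauss_pos h).le, Real.norm_eq_abs]
    refine (mul_le_mul_of_nonneg_left (hG.abs_sub_le hR hh) (gauss_pos h).le).trans (le_of_eq ?_)
    simp only [B]; ring
  have hm : AEStronglyMeasurable (fun h => gauss h * (G (X + (τ * R) • h) - b R)) volume := by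
    refine Measurable.aestronglyMeasurable ?_
    have := hG.measurable
    have := continuous_gauss (n := n)
    fun_prop
  have hI : Integrable (fun h => gauss h * (G (X + (τ * R) • h) - b R)) := hB.mono' hm hpt
  have e : (fun h => gauss h * G (X + (τ * R) • h)) =
      fun h => gauss h * (G (X + (τ * R) • h) - b R) + b R * gauss h := by ext h; ring
  refine ⟨e ▸ hI.add (hi0.const_mul _), ?_⟩
  have e2 : smear G (τ * R) X - b R = ∫ h, gauss h * (G (X + (τ * R) • h) - b R) := by
    rw [smear, e, integral_add hI (hi0.const_mul _), integral_const_mul, integral_gauss]; ring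
  rw [e2, ← Real.norm_eq_abs]
  refine (norm_integral_le_of_norm_le hB hpt).trans ?_
  simp only [B]
  rw [integral_const_mul, integral_add hi hi2,
    integral_add (hi0.const_mul _) (hi1.const_mul _), integral_const_mul, integral_const_mul,
    integral_gauss]
  have hR' : 0 ≤ ‖X‖ / R := by positivity
  gcongr
  change _ + (_ + |τ| * D₂) ≤ _
  nlinarith [mul_nonneg hD₁ hR', mul_nonneg hD₂ hR', abs_nonneg τ, mul_nonneg hD₁ (abs_nonneg τ)]

lemma hasDerivAt_line (hG : ContDiffOn ℝ ∞ G {0}ᶜ) (i : ℕ) {X v : Euc n} {t : ℝ}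
    (h : X + t • v ≠ 0) :
    HasDerivAt (fun t : ℝ => iteratedFDeriv ℝ i G (X + t • v) (fun _ => v))
      (iteratedFDeriv ℝ (i + 1) G (X + t • v) (fun _ => v)) t := by
  have hc : ContDiffAt ℝ ∞ G (X + t • v) :=
    hG.contDiffAt (isOpen_compl_singleton.mem_nhds h)
  have hd : DifferentiableAt ℝ (iteratedFDeriv ℝ i G) (X + t • v) :=
    hc.differentiableAt_iteratedFDeriv (by exact_mod_cast WithTop.coe_lt_top _)
  have hl : HasDerivAt (fun t : ℝ => X + t • v) v t := by
    simpa using ((hasDerivAt_id t).smul_const v).const_add X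
  have := hd.hasFDerivAt.comp_hasDerivAt t hl
  have h2 := ((ContinuousMultilinearMap.apply ℝ (fun _ : Fin i => Euc n) ℝ
    (fun _ => v)).hasFDerivAt (x := iteratedFDeriv ℝ i G (X + t • v))).comp_hasDerivAt t this
  exact h2

/-- Regime of small steps: all nodes lie on a segment that stays at distance at least `‖X‖ / 2` from
the singularity, so the difference is controlled by the derivative of order `2 k`. -/
lemma abs_centralDiff_le {k : ℕ} (hk : 0 < k) (hs : 0 ≤ s)
    (hG : ScaleControl s a C ρ (2 * k) G b) (hC : 0 ≤ C) {X v : Euc n} (hX : X ≠ 0)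
    (hv : k * ‖v‖ ≤ ‖X‖ / 2) :
    |∑ j ∈ Finset.range (2 * k + 1),
        ((-1 : ℝ) ^ j * (2 * k).choose j) * G (X + ((j : ℝ) - k) • v)| ≤
      C * (‖X‖ / 2) ^ (-(s + (2 * k : ℕ))) * ‖v‖ ^ (2 * k) := by
  have hX0 : 0 < ‖X‖ := norm_pos_iff.2 hX
  set F : ℕ → ℝ → ℝ := fun i t => iteratedFDeriv ℝ i G (X + t • v) (fun _ => v)
  have hlow : ∀ t ∈ Set.Icc (-(k : ℝ)) (-(k : ℝ) + (2 * k : ℕ)), ‖X‖ / 2 ≤ ‖X + t • v‖ := by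
    intro t ht
    have ht' : |t| ≤ k := by
      rw [abs_le]; refine ⟨ht.1, ?_⟩
      have := ht.2; push_cast at this; linarith
    have h1 : ‖t • v‖ ≤ ‖X‖ / 2 := by
      rw [norm_smul, Real.norm_eq_abs]
      exact (mul_le_mul_of_nonneg_right ht' (norm_nonneg v)).trans hv
    have h2 := norm_sub_le (X + t • v) (t • v)
    rw [add_sub_cancel_right] at h2
    linarith
  have key := abs_fwdDiff_iter_le (m := 2 * k) (F := F) (a := -(k : ℝ))
    (B := C * (‖X‖ / 2) ^ (-(s + (2 * k : ℕ))) * ‖v‖ ^ (2 * k)) (fun i _ t ht => ?_)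
    (fun t ht => ?_)
  · rw [fwdDiff_iter_eq_sum_shift] at key
    convert key using 3 with j hj
    have hj' : j < 2 * k + 1 := Finset.mem_range.1 hj
    have h1 : (-1 : ℝ) ^ (2 * k - j) = (-1) ^ j := by
      have : (-1 : ℝ) ^ (2 * k - j) * (-1) ^ j = 1 := by
        rw [← pow_add, Nat.sub_add_cancel (by omega), pow_mul]; simp
      have h2 : (-1 : ℝ) ^ j * (-1) ^ j = 1 := by rw [← mul_pow]; simp
      exact mul_right_cancel₀ (by simp) (this.trans h2.symm)
    simp only [F, iteratedFDeriv_zero_apply, zsmul_eq_mul, nsmul_eq_mul, mul_one]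
    push_cast
    rw [h1, neg_add_eq_sub]
  · refine hasDerivAt_line hG.smooth i fun h => ?_
    have := hlow t ht
    rw [h, norm_zero] at this
    linarith
  · have h0 : X + t • v ≠ 0 := fun h => by
      have := hlow t ht
      rw [h, norm_zero] at this
      linarith
    have h1 := (iteratedFDeriv ℝ (2 * k) G (X + t • v)).le_opNorm (fun _ => v)
    rw [Finset.prod_const, Finset.card_univ, Fintype.card_fin] at h1
    rw [← Real.norm_eq_abs]
    refine h1.trans ?_
    gcongr
    refine (hG.deriv _ h0).trans ?_
    refine mul_le_mul_of_nonneg_left ?_ hC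
    exact Real.rpow_le_rpow_of_nonpos (by positivity) (hlow t ht) (by
      have : (0 : ℝ) ≤ (2 * k : ℕ) := by positivity
      linarith)

/-- Regime of large steps: cancellation is used only to subtract `b R`, after which every node is
estimated by the oscillation bound. Decay in `X` is bought by the factor `(2 k ‖h‖ R / ‖X‖) ^ A ≥
1`, whose powers of `‖h‖` the Gaussian absorbs later. The central node does not move with `h` and is
treated apart. -/
lemma abs_centralDiff_far_le {k A : ℕ} (hk : 0 < k)
    (hG : ScaleControl s a C ρ (2 * k) G b) (hC : 0 ≤ C) (ha : 0 ≤ a) {R : ℝ} (hR : 0 < R)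
    {X h : Euc n} (hX : R ≤ ‖X‖) (hh : ‖X‖ / R ≤ 2 * k * ‖h‖)
    (hne : ∀ j : ℕ, j ≠ k → X + (((j : ℝ) - k) * R) • h ≠ 0) :
    |∑ j ∈ Finset.range (2 * k + 1),
        ((-1 : ℝ) ^ j * (2 * k).choose j) * G (X + (((j : ℝ) - k) * R) • h)| ≤
      C * R ^ (-s) * ((‖X‖ / R) ^ A)⁻¹ * ∑ j ∈ Finset.range (2 * k + 1), (2 * k).choose j *
        ((2 * k) ^ A * (‖h‖ ^ A * (if j = k then 1 else ‖R⁻¹ • X + ((j : ℝ) - k) • h‖ ^ (-a)) +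
          3 * k * ‖h‖ ^ (A + 1))) := by
  have hX0 : X ≠ 0 := norm_pos_iff.1 (hR.trans_le hX)
  have hy : 1 ≤ ‖X‖ / R := (one_le_div hR).2 hX
  have e : ∑ j ∈ Finset.range (2 * k + 1),
        ((-1 : ℝ) ^ j * (2 * k).choose j) * G (X + (((j : ℝ) - k) * R) • h) =
      ∑ j ∈ Finset.range (2 * k + 1),
        ((-1 : ℝ) ^ j * (2 * k).choose j) * (G (X + (((j : ℝ) - k) * R) • h) - b R) := by
    simp only [mul_sub, Finset.sum_sub_distrib]
    rw [sum_alternating_choose_mul hk, sub_zero]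
  rw [e, Finset.mul_sum]
  refine (Finset.abs_sum_le_sum_abs _ _).trans (Finset.sum_le_sum fun j hj => ?_)
  have hj' : j < 2 * k + 1 := Finset.mem_range.1 hj
  have hjk : |(j : ℝ) - k| ≤ k := by
    have : (j : ℝ) ≤ 2 * k := by exact_mod_cast (by omega : j ≤ 2 * k)
    rw [abs_le]; constructor <;> linarith [(Nat.cast_nonneg j : (0 : ℝ) ≤ j)]
  rw [abs_mul, abs_mul, abs_pow, abs_neg, abs_one, one_pow, one_mul, Nat.abs_cast]
  have h1 : |G (X + (((j : ℝ) - k) * R) • h) - b R| ≤ C * R ^ (-s) *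
      ((if j = k then 1 else ‖R⁻¹ • X + ((j : ℝ) - k) • h‖ ^ (-a)) + 3 * k * ‖h‖) := by
    by_cases hjeq : j = k
    · subst hjeq
      have := hG.osc R hR X hX0
      simp only [sub_self, zero_mul, zero_smul, add_zero, if_true]
      refine this.trans ?_
      gcongr
      · exact Real.rpow_le_one_of_one_le_of_nonpos hy (by linarith)
      · refine hh.trans ?_
        gcongr; norm_num
    · rw [if_neg hjeq]
      refine (hG.abs_sub_le hR (hne j hjeq)).trans ?_
      gcongr
      have := mul_le_mul_of_nonneg_right hjk (norm_nonneg h)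
      linarith
  have h2 : 1 ≤ ((‖X‖ / R) ^ A)⁻¹ * ((2 * k) ^ A * ‖h‖ ^ A) := by
    rw [inv_mul_eq_div, one_le_div (by positivity), ← mul_pow]
    gcongr
  calc _ ≤ ((2 * k).choose j : ℝ) * (C * R ^ (-s) *
      ((if j = k then 1 else ‖R⁻¹ • X + ((j : ℝ) - k) • h‖ ^ (-a)) + 3 * k * ‖h‖)) := by gcongr
    _ ≤ (((2 * k).choose j : ℝ) * (C * R ^ (-s) *
      ((if j = k then 1 else ‖R⁻¹ • X + ((j : ℝ) - k) • h‖ ^ (-a)) + 3 * k * ‖h‖))) *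
        (((‖X‖ / R) ^ A)⁻¹ * ((2 * k) ^ A * ‖h‖ ^ A)) := by
      refine le_mul_of_one_le_right ?_ h2
      split_ifs <;> positivity
    _ = _ := by ring

/-- The Gaussian central difference of order `2 k` decays at every rate up to `2 k` away from the
origin, and differs from `G` by a bounded quantity near the origin. -/
lemma exists_smearRem_bound (hn : 0 < n) (ha : 0 ≤ a) (han : a < n) (hs : 0 ≤ s) {k A : ℕ}
    (hk : 0 < k) (hA : A ≤ 2 * k) :
    ∃ D, 0 ≤ D ∧ ∀ {C ρ : ℝ} {G : Euc n → ℝ} {b : ℝ → ℝ}, ScaleControl s a C ρ (2 * k) G b →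
      ∀ R, 0 < R → ∀ X, X ≠ 0 →
        (R ≤ ‖X‖ → |smearRem k G R X| ≤ C * D * R ^ (-s) * ((‖X‖ / R) ^ A)⁻¹) ∧
        (‖X‖ ≤ R → |smearRem k G R X - (G X - b R)| ≤ C * D * R ^ (-s)) := by
  obtain ⟨D₀, hD₀, hsm⟩ := exists_smear_sub_le hn ha han
  obtain ⟨D₁, hD₁, hmom⟩ := exists_gauss_moment_le hn ha han A
  have hint := fun q => integrable_pow_mul_gauss (n := n) q
  set m : ℕ → ℝ := fun q => ∫ h : Euc n, ‖h‖ ^ q * gauss h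
  have hm : ∀ q, 0 ≤ m q := fun q =>
    integral_nonneg fun h => mul_nonneg (by positivity) (gauss_pos h).le
  set D₂ : ℝ := 2 ^ (s + (2 * k : ℕ)) * m (2 * k) + ∑ j ∈ Finset.range (2 * k + 1),
    (2 * k).choose j * ((2 * k) ^ A * ((D₁ + m A) + 3 * k * m (A + 1)))
  set D₃ : ℝ := ∑ i ∈ Finset.range k, |cdCoeff k i| * (D₀ * (2 + ((i : ℝ) + 1)))
  have hD₂ : 0 ≤ D₂ := by
    have := hm (2 * k); have := hm A; have := hm (A + 1); positivity
  have hD₃ : 0 ≤ D₃ := by positivity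
  refine ⟨D₂ + D₃, by positivity, fun {C ρ G b} hG R hR X hX => ⟨fun hXR => ?_, fun hXR => ?_⟩⟩
  · have hC := hG.const_nonneg hn
    have hy : 1 ≤ ‖X‖ / R := (one_le_div hR).2 hXR
    have hy0 : 0 < ‖X‖ / R := by linarith
    set c : ℕ → ℝ := fun j => (-1 : ℝ) ^ j * (2 * k).choose j
    set Nj : ℕ → Euc n → ℝ := fun j h =>
      if j = k then 1 else ‖R⁻¹ • X + ((j : ℝ) - k) • h‖ ^ (-a)
    have hjk : ∀ j : ℕ, j ≠ k → 1 ≤ |(j : ℝ) - k| := by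
      intro j hj
      have : (1 : ℤ) ≤ |(j : ℤ) - k| := Int.one_le_abs (by omega)
      exact_mod_cast this
    have hN : ∀ j, Integrable (fun h => ‖h‖ ^ A * gauss h * Nj j h) ∧
        ∫ h, ‖h‖ ^ A * gauss h * Nj j h ≤ D₁ + m A := by
      intro j
      by_cases hj : j = k
      · simp only [Nj, if_pos hj, mul_one]
        exact ⟨hint A, by linarith [hm A]⟩
      · simp only [Nj, if_neg hj]
        have := hmom (R⁻¹ • X) _ (hjk j hj)
        exact ⟨this.1, by linarith [this.2, hm A]⟩
    have hGi : ∀ j : ℕ, Integrable (fun h => gauss h * G (X + (((j : ℝ) - k) * R) • h)) := by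
      intro j
      by_cases hj : j = k
      · subst hj
        simpa using (integrable_gauss (n := n)).mul_const (G X)
      · exact (hsm hG R hR _ (hjk j hj) X).1
    -- Up to a nonzero factor, `smearRem` is the Gaussian average over `h` of the central difference
    -- of `G` at `X` with step `R • h`; the pointwise bounds on differences can then be integrated.
    have e1 : (-1) ^ k * (2 * k).choose k * smearRem k G R X =
        ∫ h, ∑ j ∈ Finset.range (2 * k + 1),
          c j * (gauss h * G (X + (((j : ℝ) - k) * R) • h)) := by
      have := centralDiff_eq k (F := fun τ => smear G (τ * R) X) (fun τ => by
        rw [neg_mul, smear_neg])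
      simp only [zero_mul, smear_zero] at this
      rw [smearRem, ← this, integral_finsetSum _ fun j _ => (hGi j).const_mul _]
      refine Finset.sum_congr rfl fun j _ => ?_
      rw [integral_const_mul]; rfl
    set B : Euc n → ℝ := fun h => C * R ^ (-s) * ((‖X‖ / R) ^ A)⁻¹ *
      (2 ^ (s + (2 * k : ℕ)) * (‖h‖ ^ (2 * k) * gauss h) + ∑ j ∈ Finset.range (2 * k + 1),
        (2 * k).choose j * ((2 * k) ^ A * (‖h‖ ^ A * gauss h * Nj j h +
          3 * k * (‖h‖ ^ (A + 1) * gauss h))))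
    have hBs : ∀ j ∈ Finset.range (2 * k + 1), Integrable (fun h => ((2 * k).choose j : ℝ) *
        ((2 * k) ^ A * (‖h‖ ^ A * gauss h * Nj j h + 3 * k * (‖h‖ ^ (A + 1) * gauss h)))) :=
      fun j _ => ((((hN j).1.add ((hint (A + 1)).const_mul _)).const_mul _).const_mul _)
    have hB : Integrable B :=
      (((hint (2 * k)).const_mul _).add (integrable_finsetSum _ hBs)).const_mul _
    have hpt : ∀ᵐ h : Euc n, ‖∑ j ∈ Finset.range (2 * k + 1),
          c j * (gauss h * G (X + (((j : ℝ) - k) * R) • h))‖ ≤ B h := by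
      have hae : ∀ᵐ h : Euc n, ∀ j : ℕ, j ≠ k → X + (((j : ℝ) - k) * R) • h ≠ 0 := by
        rw [ae_all_iff]
        intro j
        by_cases hj : j = k
        · exact .of_forall fun h h1 => absurd hj h1
        · have : ((j : ℝ) - k) * R ≠ 0 := by
            refine mul_ne_zero (fun h0 => ?_) hR.ne'
            have := hjk j hj
            rw [h0, abs_zero] at this
            linarith
          filter_upwards [ae_add_smul_ne_zero hn X this] with h hh _ using hh
      filter_upwards [hae] with h hh
      have e2 : ∑ j ∈ Finset.range (2 * k + 1),
          c j * (gauss h * G (X + (((j : ℝ) - k) * R) • h)) =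
          gauss h * ∑ j ∈ Finset.range (2 * k + 1),
            ((-1 : ℝ) ^ j * (2 * k).choose j) * G (X + (((j : ℝ) - k) * R) • h) := by
        rw [Finset.mul_sum]; exact Finset.sum_congr rfl fun j _ => by simp only [c]; ring
      rw [e2, norm_mul, Real.norm_of_nonneg (gauss_pos h).le, Real.norm_eq_abs]
      have hg := gauss_pos h
      have hNnn : ∀ j, 0 ≤ Nj j h := fun j => by
        simp only [Nj]; split_ifs <;> positivity
      have hBsum : 0 ≤ ∑ j ∈ Finset.range (2 * k + 1), ((2 * k).choose j : ℝ) *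
          ((2 * k) ^ A * (‖h‖ ^ A * gauss h * Nj j h + 3 * k * (‖h‖ ^ (A + 1) * gauss h))) :=
        Finset.sum_nonneg fun j _ => by have := hNnn j; positivity
      -- Small steps use smoothness away from the origin, large steps use the rapid decay of the
      -- Gaussian weight.
      rcases le_total (k * ‖R • h‖) (‖X‖ / 2) with hc | hc
      · have h1 := hG.abs_centralDiff_le hk hs hC hX hc
        simp only [smul_smul] at h1
        refine (mul_le_mul_of_nonneg_left h1 hg.le).trans ?_
        have h3 : (‖X‖ / 2) ^ (-(s + (2 * k : ℕ))) * ‖R • h‖ ^ (2 * k) ≤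
            R ^ (-s) * ((‖X‖ / R) ^ A)⁻¹ * (2 ^ (s + (2 * k : ℕ)) * ‖h‖ ^ (2 * k)) := by
          have hX2 : ‖X‖ / 2 = R * ((‖X‖ / R) / 2) := by field_simp
          rw [hX2, Real.mul_rpow hR.le (by positivity), Real.div_rpow hy0.le (by norm_num),
            norm_smul, Real.norm_eq_abs, abs_of_pos hR, mul_pow, neg_add,
            Real.rpow_add hR, Real.rpow_neg hR.le ((2 * k : ℕ) : ℝ), Real.rpow_natCast,
            ← neg_add, Real.rpow_neg (by norm_num : (0 : ℝ) ≤ 2), div_inv_eq_mul]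
          have h4 : (‖X‖ / R) ^ (-(s + (2 * k : ℕ))) ≤ ((‖X‖ / R) ^ A)⁻¹ := by
            rw [← Real.rpow_natCast, ← Real.rpow_neg hy0.le]
            refine Real.rpow_le_rpow_of_exponent_le hy ?_
            have : (A : ℝ) ≤ (2 * k : ℕ) := by exact_mod_cast hA
            linarith
          calc _ = R ^ (-s) * (‖X‖ / R) ^ (-(s + (2 * k : ℕ))) *
                (2 ^ (s + (2 * k : ℕ)) * ‖h‖ ^ (2 * k)) := by
                field_simp
            _ ≤ _ := by gcongr
        calc _ = gauss h * C * ((‖X‖ / 2) ^ (-(s + (2 * k : ℕ))) * ‖R • h‖ ^ (2 * k)) := by ring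
          _ ≤ gauss h * C * (R ^ (-s) * ((‖X‖ / R) ^ A)⁻¹ *
              (2 ^ (s + (2 * k : ℕ)) * ‖h‖ ^ (2 * k))) := by gcongr
          _ = C * R ^ (-s) * ((‖X‖ / R) ^ A)⁻¹ *
              (2 ^ (s + (2 * k : ℕ)) * (‖h‖ ^ (2 * k) * gauss h) + 0) := by ring
          _ ≤ _ := by simp only [B]; gcongr
      · have hc' : ‖X‖ / R ≤ 2 * k * ‖h‖ := by
          rw [norm_smul, Real.norm_eq_abs, abs_of_pos hR] at hc
          rw [div_le_iff₀ hR]; linarith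
        have h1 := hG.abs_centralDiff_far_le (A := A) hk hC ha hR hXR hc' hh
        refine (mul_le_mul_of_nonneg_left h1 hg.le).trans ?_
        calc _ = C * R ^ (-s) * ((‖X‖ / R) ^ A)⁻¹ * (0 + ∑ j ∈ Finset.range (2 * k + 1),
              (2 * k).choose j * ((2 * k) ^ A * (‖h‖ ^ A * gauss h * Nj j h +
                3 * k * (‖h‖ ^ (A + 1) * gauss h)))) := by
              rw [mul_left_comm, zero_add]
              congr 1
              rw [Finset.mul_sum]
              exact Finset.sum_congr rfl fun j _ => by simp only [Nj]; ring
          _ ≤ _ := by simp only [B]; gcongr; positivity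
    have hBi : ∫ h, B h ≤ C * R ^ (-s) * ((‖X‖ / R) ^ A)⁻¹ * D₂ := by
      simp only [B]
      rw [integral_const_mul, integral_add ((hint (2 * k)).const_mul _)
        (integrable_finsetSum _ hBs), integral_const_mul, integral_finsetSum _ hBs]
      refine mul_le_mul_of_nonneg_left ?_ (by positivity)
      refine add_le_add le_rfl (Finset.sum_le_sum fun j _ => ?_)
      rw [integral_const_mul, integral_const_mul,
        integral_add (hN j).1 ((hint (A + 1)).const_mul _), integral_const_mul]
      have := (hN j).2
      gcongr
    have h5 : |smearRem k G R X| ≤ |(-1) ^ k * (2 * k).choose k * smearRem k G R X| := by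
      rw [abs_mul, abs_mul, abs_pow, abs_neg, abs_one, one_pow, one_mul, Nat.abs_cast]
      refine le_mul_of_one_le_left (abs_nonneg _) ?_
      exact_mod_cast Nat.choose_pos (by omega)
    refine h5.trans ?_
    rw [e1, ← Real.norm_eq_abs]
    refine (norm_integral_le_of_norm_le hB hpt).trans (hBi.trans ?_)
    have : 0 ≤ C * R ^ (-s) * ((‖X‖ / R) ^ A)⁻¹ * D₃ := by positivity
    linarith
  · have hC := hG.const_nonneg hn
    have hX1 : ‖X‖ / R ≤ 1 := (div_le_one hR).2 hXR
    -- Near the origin only the averages remain to be estimated: their coefficients sum to `-1`, so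
    -- each one can be compared with `b R`.
    have e : smearRem k G R X - (G X - b R) =
        ∑ i ∈ Finset.range k, cdCoeff k i * (smear G (((i : ℝ) + 1) * R) X - b R) := by
      simp only [mul_sub, Finset.sum_sub_distrib]
      rw [← Finset.sum_mul, smearRem]
      linear_combination b R * one_add_sum_cdCoeff hk
    rw [e]
    refine (Finset.abs_sum_le_sum_abs _ _).trans ?_
    have h6 : ∑ i ∈ Finset.range k, |cdCoeff k i * (smear G (((i : ℝ) + 1) * R) X - b R)| ≤
        C * R ^ (-s) * D₃ := by
      rw [Finset.mul_sum]
      refine Finset.sum_le_sum fun i _ => ?_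
      have hi : 1 ≤ |(i : ℝ) + 1| := by rw [abs_of_pos (by positivity)]; simp
      have h7 := (hsm hG R hR _ hi X).2
      rw [abs_of_pos (by positivity : (0 : ℝ) < (i : ℝ) + 1)] at h7
      rw [abs_mul]
      calc _ ≤ |cdCoeff k i| * (C * R ^ (-s) * (D₀ * (1 + ‖X‖ / R + ((i : ℝ) + 1)))) := by
            gcongr
        _ ≤ |cdCoeff k i| * (C * R ^ (-s) * (D₀ * (1 + 1 + ((i : ℝ) + 1)))) := by gcongr
        _ = _ := by ring
    have : 0 ≤ C * R ^ (-s) * D₂ := by positivity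
    linarith

end ScaleControl

/-! ### A positive definite kernel with polynomial tails -/

/-- A mixture of Gaussians at scales larger than one, with tails of order `-(3 n + 2)`. -/
noncomputable def tailKernel {n : ℕ} (X : Euc n) : ℝ :=
  ∫ u in Set.Ioo (0 : ℝ) 1, u ^ (3 * n + 1) * gauss (u • X)

/-- The Fourier transform of `tailKernel`. -/
noncomputable def tailKernelHat {n : ℕ} (ξ : Euc n) : ℝ :=
  ∫ u in Set.Ioo (0 : ℝ) 1, u ^ (2 * n + 1) * gauss (u⁻¹ • ξ)

lemma integrableOn_Ioo_of_mem_Icc {f : ℝ → ℝ} (hm : Measurable f)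
    (hf : ∀ u ∈ Set.Ioo (0 : ℝ) 1, 0 ≤ f u ∧ f u ≤ 1) : IntegrableOn f (Set.Ioo (0 : ℝ) 1) := by
  refine Measure.integrableOn_of_bounded (M := 1) (by simp) hm.aestronglyMeasurable ?_
  filter_upwards [ae_restrict_mem measurableSet_Ioo] with u hu
  rw [Real.norm_of_nonneg (hf u hu).1]; exact (hf u hu).2

lemma integrableOn_tailKernel {n : ℕ} (X : Euc n) :
    IntegrableOn (fun u : ℝ => u ^ (3 * n + 1) * gauss (u • X)) (Set.Ioo (0 : ℝ) 1) := by
  refine integrableOn_Ioo_of_mem_Icc ?_ fun u hu => ⟨?_, ?_⟩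
  · have := continuous_gauss (n := n)
    fun_prop
  · have := gauss_pos (u • X); have := hu.1; positivity
  · exact mul_le_one₀ (pow_le_one₀ hu.1.le hu.2.le) (gauss_pos _).le (gauss_le_one _)

lemma tailKernel_nonneg {n : ℕ} (X : Euc n) : 0 ≤ tailKernel X :=
  setIntegral_nonneg measurableSet_Ioo fun u hu => by
    have := gauss_pos (u • X); have := hu.1; positivity

lemma setIntegral_Ioo_le_const {f : ℝ → ℝ} {c : ℝ} (hc : 0 ≤ c)
    (hf : ∀ u ∈ Set.Ioo (0 : ℝ) 1, f u ≤ c) :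
    ∫ u in Set.Ioo (0 : ℝ) 1, f u ≤ c := by
  by_cases hi : IntegrableOn f (Set.Ioo (0 : ℝ) 1)
  · refine (setIntegral_mono_on hi (integrableOn_const (by simp)) measurableSet_Ioo hf).trans ?_
    simp
  · rw [integral_undef hi]; exact hc

/-- The factor `‖X‖ ^ (n + 1)` is traded for `‖u • X‖ ^ (n + 1)` using `n + 1` of the `3 n + 1`
powers of `u`. This weaker rate suffices, as it is only used for integrability and boundedness. -/
lemma exists_tailKernel_le (n : ℕ) :
    ∃ C, 0 ≤ C ∧ ∀ X : Euc n, tailKernel X ≤ C * ((1 + ‖X‖) ^ (n + 1))⁻¹ := by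
  obtain ⟨M, hM, hMb⟩ := pow_mul_gauss_bounded (n := n) (n + 1)
  refine ⟨2 ^ n * (1 + M), by positivity, fun X => ?_⟩
  refine setIntegral_Ioo_le_const (by positivity) fun u hu => ?_
  rw [← div_eq_mul_inv, le_div_iff₀ (by positivity)]
  have h1 : (1 + ‖X‖) ^ (n + 1) ≤ 2 ^ n * (1 ^ (n + 1) + ‖X‖ ^ (n + 1)) := by
    simpa using add_pow_le (zero_le_one) (norm_nonneg X) (n + 1)
  have hg := gauss_pos (u • X)
  have hu0 := hu.1
  calc _ ≤ u ^ (3 * n + 1) * gauss (u • X) * (2 ^ n * (1 ^ (n + 1) + ‖X‖ ^ (n + 1))) := by gcongr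
    _ = 2 ^ n * (u ^ (3 * n + 1) * gauss (u • X) +
        u ^ (2 * n) * (‖u • X‖ ^ (n + 1) * gauss (u • X))) := by
      rw [norm_smul, Real.norm_of_nonneg hu0.le]; ring
    _ ≤ 2 ^ n * (1 * 1 + 1 * M) := by
      gcongr
      · exact pow_le_one₀ hu0.le hu.2.le
      · exact gauss_le_one _
      · exact pow_le_one₀ hu0.le hu.2.le
      · exact hMb _
    _ = _ := by ring

/-- On the scales `u` between `τ / 2` and `τ = (1 + ‖X‖)⁻¹` the Gaussian is bounded below, and the
weight times the length of this interval is of order `τ ^ (3 n + 2)`. The rate matches the possible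
negative tail of `smearRem`. -/
lemma exists_le_tailKernel (n : ℕ) :
    ∃ c, 0 < c ∧ ∀ X : Euc n, c * ((1 + ‖X‖) ^ (3 * n + 2))⁻¹ ≤ tailKernel X := by
  refine ⟨Real.exp (-Real.pi) * (1 / 2) ^ (3 * n + 2), by positivity, fun X => ?_⟩
  set τ : ℝ := (1 + ‖X‖)⁻¹
  have hτ0 : 0 < τ := by positivity
  have hτ1 : τ ≤ 1 := inv_le_one_of_one_le₀ (by linarith [norm_nonneg X])
  have hsub : Set.Ioo (τ / 2) τ ⊆ Set.Ioo (0 : ℝ) 1 := fun u hu =>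
    ⟨by linarith [hu.1], by linarith [hu.2]⟩
  have h1 : ∫ u in Set.Ioo (τ / 2) τ, (Real.exp (-Real.pi) * (τ / 2) ^ (3 * n + 1)) ≤
      ∫ u in Set.Ioo (τ / 2) τ, u ^ (3 * n + 1) * gauss (u • X) := by
    refine setIntegral_mono_on (integrableOn_const (by simp))
      ((integrableOn_tailKernel X).mono_set hsub) measurableSet_Ioo fun u hu => ?_
    have hu0 : 0 < u := by linarith [hu.1]
    have h2 : Real.exp (-Real.pi) ≤ gauss (u • X) := by
      refine Real.exp_le_exp.2 (neg_le_neg (mul_le_of_le_one_right Real.pi_pos.le ?_))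
      refine pow_le_one₀ (norm_nonneg _) ?_
      rw [norm_smul, Real.norm_of_nonneg hu0.le]
      calc u * ‖X‖ ≤ τ * (1 + ‖X‖) := by gcongr; exacts [hu.2.le, by linarith]
        _ = 1 := inv_mul_cancel₀ (by positivity)
    rw [mul_comm]
    gcongr
    exact hu.1.le
  have h3 : ∫ u in Set.Ioo (τ / 2) τ, u ^ (3 * n + 1) * gauss (u • X) ≤ tailKernel X := by
    refine setIntegral_mono_set (integrableOn_tailKernel X) ?_ (LE.le.eventuallyLE hsub)
    filter_upwards [ae_restrict_mem measurableSet_Ioo] with u hu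
    have := gauss_pos (u • X); have := hu.1
    simp only [Pi.zero_apply]; positivity
  refine le_trans (le_of_eq ?_) (h1.trans h3)
  rw [setIntegral_const]
  simp only [Real.volume_real_Ioo_of_le (by linarith : τ / 2 ≤ τ), smul_eq_mul]
  rw [← inv_pow]
  change Real.exp (-Real.pi) * (1 / 2) ^ (3 * n + 2) * τ ^ (3 * n + 2) = _
  ring

lemma tailKernelHat_nonneg {n : ℕ} (ξ : Euc n) : 0 ≤ tailKernelHat ξ :=
  setIntegral_nonneg measurableSet_Ioo fun u hu => by
    have := gauss_pos (u⁻¹ • ξ); have := hu.1; positivity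

lemma gauss_inv_smul_le {n : ℕ} {u : ℝ} (hu : u ∈ Set.Ioo (0 : ℝ) 1) (ξ : Euc n) :
    gauss (u⁻¹ • ξ) ≤ gauss ξ := by
  refine gauss_mono ?_
  rw [norm_smul, Real.norm_of_nonneg (inv_pos.2 hu.1).le]
  exact le_mul_of_one_le_left (norm_nonneg _) ((one_le_inv₀ hu.1).2 hu.2.le)

/-- Here it matters that only Gaussians wider than the unit one are mixed: their transforms are
narrower. Polynomial tails in space thus cost nothing at high frequency. -/
lemma tailKernelHat_le {n : ℕ} (ξ : Euc n) : tailKernelHat ξ ≤ gauss ξ := by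
  refine setIntegral_Ioo_le_const (gauss_pos _).le fun u hu => ?_
  calc _ ≤ 1 * gauss ξ := by
        refine mul_le_mul (pow_le_one₀ hu.1.le hu.2.le) (gauss_inv_smul_le hu ξ)
          (gauss_pos _).le zero_le_one
    _ = _ := one_mul _

lemma measurable_tailKernelHat {n : ℕ} : Measurable (tailKernelHat : Euc n → ℝ) := by
  have hm : Measurable (fun p : Euc n × ℝ => p.2 ^ (2 * n + 1) * gauss (p.2⁻¹ • p.1)) := by
    have := (continuous_gauss (n := n)).measurable
    fun_prop
  exact (hm.stronglyMeasurable.integral_prod_right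
    (ν := volume.restrict (Set.Ioo (0 : ℝ) 1))).measurable

lemma integrable_tailKernelHat {n : ℕ} : Integrable (tailKernelHat : Euc n → ℝ) :=
  integrable_gauss.mono' measurable_tailKernelHat.aestronglyMeasurable
    (.of_forall fun ξ => by
      rw [Real.norm_of_nonneg (tailKernelHat_nonneg ξ)]; exact tailKernelHat_le ξ)

/-- Fubini, together with the transform of a dilated Gaussian. The Jacobian `u ^ n` turns the weight
`u ^ (2 n + 1)` into `u ^ (3 n + 1)`. -/
lemma integral_tailKernelHat_mul_cos {n : ℕ} (X : Euc n) :
    ∫ ξ : Euc n, tailKernelHat ξ * Real.cos (2 * Real.pi * inner ℝ X ξ) = tailKernel X := by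
  unfold tailKernelHat tailKernel
  simp only [← integral_mul_const]
  rw [integral_integral_swap]
  · refine setIntegral_congr_fun measurableSet_Ioo fun u hu => ?_
    have h := integral_gauss_smul_mul_cos (inv_pos.2 hu.1) X
    simp only [mul_assoc, integral_const_mul]
    simp only [mul_assoc] at h
    rw [h, inv_inv, inv_pow, inv_inv]
    ring
  · have hm : Measurable (fun p : Euc n × ℝ => p.2 ^ (2 * n + 1) * gauss (p.2⁻¹ • p.1) *
        Real.cos (2 * Real.pi * inner ℝ X p.1)) := by
      have := (continuous_gauss (n := n)).measurable
      fun_prop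
    have hg : Integrable (fun p : Euc n × ℝ => gauss p.1 * (1 : ℝ))
        (volume.prod (volume.restrict (Set.Ioo (0 : ℝ) 1))) :=
      integrable_gauss.mul_prod (integrable_const (1 : ℝ))
    refine hg.mono' hm.aestronglyMeasurable ?_
    have : ∀ᵐ p : Euc n × ℝ ∂(volume.prod (volume.restrict (Set.Ioo (0 : ℝ) 1))),
        p.2 ∈ Set.Ioo (0 : ℝ) 1 :=
      Measure.quasiMeasurePreserving_snd.ae (ae_restrict_mem measurableSet_Ioo)
    filter_upwards [this] with p hp
    simp only [Function.uncurry]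
    rw [norm_mul, norm_mul, Real.norm_of_nonneg (gauss_pos _).le, Real.norm_eq_abs,
      Real.norm_eq_abs, abs_of_nonneg (pow_nonneg hp.1.le _)]
    have h1 := pow_le_one₀ (n := 2 * n + 1) hp.1.le hp.2.le
    have h2 := gauss_inv_smul_le hp p.1
    have h3 := Real.abs_cos_le_one (2 * Real.pi * inner ℝ X p.1)
    have hg := gauss_pos (p.2⁻¹ • p.1)
    have hg' := gauss_pos p.1
    calc _ ≤ 1 * gauss p.1 * 1 := by gcongr
      _ = _ := by ring

lemma integral_tailKernelHat_smul_mul_cos {n : ℕ} {r : ℝ} (hr : 0 < r) (X : Euc n) :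
    ∫ ξ : Euc n, r ^ n * tailKernelHat (r • ξ) * Real.cos (2 * Real.pi * inner ℝ X ξ) =
      tailKernel (r⁻¹ • X) := by
  rw [← integral_tailKernelHat_mul_cos]
  have h := Measure.integral_comp_smul volume (fun ξ : Euc n => tailKernelHat ξ *
    Real.cos (2 * Real.pi * inner ℝ (r⁻¹ • X) ξ)) r
  simp only [finrank_euclideanSpace, Fintype.card_fin, smul_eq_mul,
    abs_of_pos (inv_pos.2 (pow_pos hr n))] at h
  rw [eq_inv_mul_iff_mul_eq₀ (pow_pos hr n).ne'] at h
  rw [← h, ← integral_const_mul]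
  congr 1; ext ξ
  rw [inner_smul_left, inner_smul_right]
  simp only [conj_trivial]
  rw [inv_mul_cancel_left₀ hr.ne']
  ring

/-! ### A dyadic sum -/

/-- Half of the Gaussian exponent already gives the factor on the right, because every node is at
least `2 t`. With the other half, each term is dominated by the increment of the bounded increasing
function `x ^ α / (1 + x ^ α)` from `x` to `2 x`, and these increments telescope. The constant must
not depend on `M`, which is the number of corrected scales later on. -/
lemma exists_dyadic_sum_le {α : ℝ} (hα : 0 < α) :
    ∃ C, 0 < C ∧ ∀ (M : ℕ) (t : ℝ), 0 ≤ t →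
      ∑ i ∈ Finset.range M, (2 ^ (i + 1) * t) ^ α * Real.exp (-(Real.pi * (2 ^ (i + 1) * t) ^ 2)) ≤
        C * Real.exp (-(Real.pi * t ^ 2)) := by
  obtain ⟨m, hm⟩ := exists_nat_ge α
  set Φ : ℝ → ℝ := fun x => x ^ α / (1 + x ^ α)
  have h2α : (1 : ℝ) < 2 ^ α := Real.one_lt_rpow (by norm_num) hα
  set D : ℝ := 4 * 2 ^ α * ((2 * m).factorial * Real.exp 2)
  have hD : 0 < D := by positivity
  have hbd : ∀ x : ℝ, 0 ≤ x →
      Real.exp (-(Real.pi / 2 * x ^ 2)) * ((1 + x ^ α) * (1 + 2 ^ α * x ^ α)) ≤ D := by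
    intro x hx
    have h1 : x ^ α ≤ (1 + x) ^ m := by
      calc x ^ α ≤ (1 + x) ^ α := Real.rpow_le_rpow hx (by linarith) hα.le
        _ ≤ (1 + x) ^ (m : ℝ) := Real.rpow_le_rpow_of_exponent_le (by linarith) hm
        _ = _ := Real.rpow_natCast _ _
    have h2 : 1 ≤ (1 + x) ^ m := one_le_pow₀ (by linarith)
    have h3 := Real.pow_div_factorial_le_exp (1 + x) (by linarith) (2 * m)
    rw [div_le_iff₀ (by positivity)] at h3
    calc _ ≤ Real.exp (-(Real.pi / 2 * x ^ 2)) *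
          (((1 + x) ^ m + (1 + x) ^ m) *
            (2 ^ α * (1 + x) ^ m + 2 ^ α * (1 + x) ^ m)) := by
          gcongr
          nlinarith
      _ = 4 * 2 ^ α * ((1 + x) ^ (2 * m) * Real.exp (-(Real.pi / 2 * x ^ 2))) := by ring
      _ ≤ 4 * 2 ^ α * ((Real.exp (1 + x) * (2 * m).factorial) *
          Real.exp (-(Real.pi / 2 * x ^ 2))) := by gcongr
      _ = 4 * 2 ^ α * ((2 * m).factorial * Real.exp (1 + x - Real.pi / 2 * x ^ 2)) := by
          rw [sub_eq_add_neg (1 + x), Real.exp_add (1 + x)]; ring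
      _ ≤ _ := by
          simp only [D]
          gcongr
          nlinarith [Real.pi_gt_three, sq_nonneg (x - 1), sq_nonneg x]
  have hΦ : ∀ x : ℝ, 0 ≤ x →
      x ^ α * Real.exp (-(Real.pi / 2 * x ^ 2)) ≤ D / (2 ^ α - 1) * (Φ (2 * x) - Φ x) := by
    intro x hx
    have hxα : 0 ≤ x ^ α := Real.rpow_nonneg hx α
    have e : Φ (2 * x) - Φ x = (2 ^ α - 1) * x ^ α / ((1 + x ^ α) * (1 + 2 ^ α * x ^ α)) := by
      simp only [Φ]
      rw [Real.mul_rpow (by norm_num) hx]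
      field_simp
      ring
    rw [e, div_mul_div_comm, le_div_iff₀ (mul_pos (by linarith) (by positivity))]
    calc _ = x ^ α * (2 ^ α - 1) * (Real.exp (-(Real.pi / 2 * x ^ 2)) *
          ((1 + x ^ α) * (1 + 2 ^ α * x ^ α))) := by ring
      _ ≤ x ^ α * (2 ^ α - 1) * D := by
          have : 0 ≤ (2 : ℝ) ^ α - 1 := by linarith
          exact mul_le_mul_of_nonneg_left (hbd x hx) (by positivity)
      _ = _ := by ring
  have hΦ1 : ∀ x : ℝ, 0 ≤ x → 0 ≤ Φ x ∧ Φ x ≤ 1 := by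
    intro x hx
    have hxα : 0 ≤ x ^ α := Real.rpow_nonneg hx α
    exact ⟨by positivity, (div_le_one (by positivity)).2 (by linarith)⟩
  have hc : 0 < D / (2 ^ α - 1) := div_pos hD (by linarith)
  refine ⟨D / (2 ^ α - 1), hc, fun M t ht => ?_⟩
  have hterm : ∀ i ∈ Finset.range M,
      (2 ^ (i + 1) * t) ^ α * Real.exp (-(Real.pi * (2 ^ (i + 1) * t) ^ 2)) ≤
      Real.exp (-(Real.pi * t ^ 2)) *
        (D / (2 ^ α - 1) * (Φ (2 ^ (i + 1 + 1) * t) - Φ (2 ^ (i + 1) * t))) := by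
    intro i _
    set x : ℝ := 2 ^ (i + 1) * t
    have hx : 0 ≤ x := by positivity
    have hxt : 2 * t ≤ x := by
      have : (1 : ℝ) ≤ 2 ^ i := one_le_pow₀ (by norm_num)
      simp only [x, pow_succ]; nlinarith
    have e : (2 : ℝ) ^ (i + 1 + 1) * t = 2 * x := by simp only [x]; ring
    have h1 : Real.exp (-(Real.pi * x ^ 2)) ≤
        Real.exp (-(Real.pi * t ^ 2)) * Real.exp (-(Real.pi / 2 * x ^ 2)) := by
      rw [← Real.exp_add]
      refine Real.exp_le_exp.2 ?_
      nlinarith [Real.pi_pos, mul_le_mul hxt hxt (by positivity) hx]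
    rw [e]
    calc _ ≤ x ^ α * (Real.exp (-(Real.pi * t ^ 2)) * Real.exp (-(Real.pi / 2 * x ^ 2))) := by
          gcongr
      _ = Real.exp (-(Real.pi * t ^ 2)) * (x ^ α * Real.exp (-(Real.pi / 2 * x ^ 2))) := by ring
      _ ≤ _ := mul_le_mul_of_nonneg_left (hΦ x hx) (Real.exp_pos _).le
  refine (Finset.sum_le_sum hterm).trans ?_
  rw [← Finset.mul_sum, ← Finset.mul_sum,
    Finset.sum_range_sub (fun i => Φ (2 ^ (i + 1) * t)) M, mul_comm]
  refine mul_le_mul_of_nonneg_right (mul_le_of_le_one_right hc.le ?_) (Real.exp_pos _).le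
  have h1 := (hΦ1 (2 ^ (M + 1) * t) (by positivity)).2
  have h2 := (hΦ1 (2 ^ (0 + 1) * t) (by positivity)).1
  linarith

/-! ### Fourier representation of Gaussian averages -/

lemma fourier_eq_integral_mul_cexp {n : ℕ} (f : Euc n → ℂ) (z : Euc n) :
    𝓕 f z = ∫ ξ, f ξ * Complex.exp (2 * Real.pi * Complex.I * inner ℝ (-z) ξ) := by
  rw [Real.fourier_eq']
  congr 1; ext ξ
  rw [smul_eq_mul, mul_comm, inner_neg_left, real_inner_comm]
  congr 2
  push_cast; ring

lemma cexp_inner_add {n : ℕ} (x y ξ : Euc n) :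
    Complex.exp (2 * Real.pi * Complex.I * inner ℝ (x + y) ξ) =
      Complex.exp (2 * Real.pi * Complex.I * inner ℝ x ξ) *
        Complex.exp (2 * Real.pi * Complex.I * inner ℝ y ξ) := by
  rw [← Complex.exp_add, inner_add_left]; congr 1; push_cast; ring

lemma norm_cexp_inner {n : ℕ} (x ξ : Euc n) :
    ‖Complex.exp (2 * Real.pi * Complex.I * inner ℝ x ξ)‖ = 1 := by
  have : (2 * Real.pi * Complex.I * (inner ℝ x ξ : ℝ) : ℂ) =
    ((2 * Real.pi * inner ℝ x ξ : ℝ) : ℂ) * Complex.I := by push_cast; ring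
  rw [this, Complex.norm_exp_ofReal_mul_I]

/-- Multiplication by a modulated Gaussian becomes a translated Gaussian average of the transform:
write the Gaussian as its own Fourier integral and exchange the integrals. -/
lemma fourier_mul_gauss {n : ℕ} {f : Euc n → ℂ} (hf : Integrable f) (t : ℝ) (X z : Euc n) :
    𝓕 (fun ξ => f ξ * (gauss (t • ξ) * Complex.exp (2 * Real.pi * Complex.I * inner ℝ X ξ))) z =
      ∫ y : Euc n, (gauss y : ℂ) * 𝓕 f (z + t • y - X) := by
  simp only [fourier_eq_integral_mul_cexp, ← integral_const_mul]
  rw [integral_integral_swap]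
  · congr 1; ext ξ
    have h := integral_gauss_smul_mul_cexp (n := n) one_pos (-(t • ξ))
    simp only [one_smul, one_pow, inv_one, one_mul, gauss_neg] at h
    have h2 : ∀ y : Euc n, (gauss y : ℂ) *
        (f ξ * Complex.exp (2 * Real.pi * Complex.I * inner ℝ (-(z + t • y - X)) ξ)) =
        (gauss y * Complex.exp (2 * Real.pi * Complex.I * inner ℝ (-(t • ξ)) y)) *
          (f ξ * (Complex.exp (2 * Real.pi * Complex.I * inner ℝ X ξ) *
            Complex.exp (2 * Real.pi * Complex.I * inner ℝ (-z) ξ))) := by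
      intro y
      have e1 : -(z + t • y - X) = -(t • y) + (X + -z) := by abel
      have e2 : inner ℝ (-(t • ξ)) y = inner ℝ (-(t • y)) ξ := by
        simp only [inner_neg_left, inner_smul_left, real_inner_comm]
      rw [e1, cexp_inner_add, cexp_inner_add, e2]; ring
    simp only [h2]
    rw [integral_mul_const, h]; ring
  · have hp : Integrable (fun p : Euc n × Euc n => (gauss p.1 : ℂ) * f p.2)
        (volume.prod volume) := integrable_gauss.ofReal.mul_prod hf
    have hc : Continuous (fun p : Euc n × Euc n =>
        Complex.exp (2 * Real.pi * Complex.I * inner ℝ (-(z + t • p.1 - X)) p.2)) := by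
      fun_prop
    have := hp.mul_bdd (c := 1) hc.aestronglyMeasurable
      (.of_forall fun p => (norm_cexp_inner _ _).le)
    refine this.congr (.of_forall fun p => ?_)
    simp only [Function.uncurry]; ring

/-- The test function `ξ ↦ gauss (t ξ) (exp (2 π i ⟪X, ξ⟫) - 1)`. -/
lemma exists_schwartz_gauss_mul_cexp_sub_one {n : ℕ} {t : ℝ} (ht : 0 < t) (X : Euc n) :
    ∃ φ : 𝓢(Euc n, ℂ), ∀ ξ, φ ξ =
      gauss (t • ξ) * (Complex.exp (2 * Real.pi * Complex.I * inner ℝ X ξ) - 1) := by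
  set L : Euc n ≃L[ℝ] Euc n := ContinuousLinearEquiv.smulLeft (Units.mk0 t⁻¹ (inv_pos.2 ht).ne')
  set g : 𝓢(Euc n, ℂ) := SchwartzMap.compCLMOfContinuousLinearEquiv ℂ L
    (SchwartzMap.postcompCLM Complex.ofRealCLM (gaussSchwartz n))
  have hg : ∀ z, g z = gauss (t⁻¹ • z) := fun z => rfl
  set f : 𝓢(Euc n, ℂ) := SchwartzMap.compSubConstCLM ℂ (-X) g - g
  have hf : ∀ z, f z = g (z + X) - g z := fun z => by
    simp [f, SchwartzMap.compSubConstCLM_apply]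
  -- The function is obtained as the transform of a difference of two translated Gaussians, so that
  -- no decay of derivatives of the modulated Gaussian has to be checked.
  refine ⟨((t ^ n : ℝ) : ℂ)⁻¹ • 𝓕 f, fun ξ => ?_⟩
  have hgi : ∀ Y : Euc n, Integrable (fun z =>
      g z * Complex.exp (2 * Real.pi * Complex.I * inner ℝ Y z)) := fun Y => by
    simp only [hg]
    exact integrable_ofReal_mul_cexp (integrable_gauss_smul (inv_pos.2 ht)) Y
  have h1 : ∫ z, g z * Complex.exp (2 * Real.pi * Complex.I * inner ℝ (-ξ) z) =
      t ^ n * gauss (t • ξ) := by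
    have := integral_gauss_smul_mul_cexp (inv_pos.2 ht) (-ξ)
    simp only [hg]
    rw [this, inv_inv, smul_neg, gauss_neg, inv_pow, inv_inv]
    push_cast; rfl
  have hshift : (fun z => g (z + X) * Complex.exp (2 * Real.pi * Complex.I * inner ℝ (-ξ) z)) =
      fun z => (fun z => Complex.exp (2 * Real.pi * Complex.I * inner ℝ X ξ) *
        (g z * Complex.exp (2 * Real.pi * Complex.I * inner ℝ (-ξ) z))) (z + X) := by
    ext z
    have e1 : Complex.exp (2 * Real.pi * Complex.I * inner ℝ (-ξ) z) =
        Complex.exp (2 * Real.pi * Complex.I * inner ℝ X ξ) *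
        Complex.exp (2 * Real.pi * Complex.I * inner ℝ (-ξ) (z + X)) := by
      rw [← Complex.exp_add]
      congr 1
      simp only [inner_neg_left, inner_add_right, real_inner_comm]
      push_cast; ring
    simp only
    rw [e1]; ring
  have h2 : ∫ z, g (z + X) * Complex.exp (2 * Real.pi * Complex.I * inner ℝ (-ξ) z) =
      Complex.exp (2 * Real.pi * Complex.I * inner ℝ X ξ) * (t ^ n * gauss (t • ξ)) := by
    rw [hshift, integral_add_right_eq_self (fun z =>
      Complex.exp (2 * Real.pi * Complex.I * inner ℝ X ξ) *
        (g z * Complex.exp (2 * Real.pi * Complex.I * inner ℝ (-ξ) z))) X,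
      integral_const_mul, h1]
  have h2i : Integrable (fun z =>
      g (z + X) * Complex.exp (2 * Real.pi * Complex.I * inner ℝ (-ξ) z)) := by
    rw [hshift]
    exact ((hgi (-ξ)).const_mul _).comp_add_right X
  have h3 : (𝓕 f) ξ = (t ^ n * gauss (t • ξ)) *
      (Complex.exp (2 * Real.pi * Complex.I * inner ℝ X ξ) - 1) := by
    rw [SchwartzMap.fourier_coe, fourier_eq_integral_mul_cexp]
    simp only [hf, sub_mul]
    rw [integral_sub h2i (hgi _), h1, h2]; ring
  rw [smul_apply, h3, smul_eq_mul]
  have : ((t ^ n : ℝ) : ℂ) ≠ 0 := by exact_mod_cast (pow_pos ht n).ne'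
  push_cast at this ⊢
  field_simp

lemma fourier_gauss_mul_cexp_sub_one {n : ℕ} {t : ℝ} (ht : 0 < t) (X z : Euc n) :
    𝓕 (fun ξ : Euc n => (gauss (t • ξ) : ℂ) *
      (Complex.exp (2 * Real.pi * Complex.I * inner ℝ X ξ) - 1)) z =
      (((t ^ n)⁻¹ * (gauss (t⁻¹ • (z - X)) - gauss (t⁻¹ • z)) : ℝ) : ℂ) := by
  rw [fourier_eq_integral_mul_cexp]
  have e : ∀ ξ : Euc n, (gauss (t • ξ) : ℂ) *
      (Complex.exp (2 * Real.pi * Complex.I * inner ℝ X ξ) - 1) *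
      Complex.exp (2 * Real.pi * Complex.I * inner ℝ (-z) ξ) =
      (gauss (t • ξ) : ℂ) * Complex.exp (2 * Real.pi * Complex.I * inner ℝ (X + -z) ξ) -
      (gauss (t • ξ) : ℂ) * Complex.exp (2 * Real.pi * Complex.I * inner ℝ (-z) ξ) := fun ξ => by
    rw [cexp_inner_add]; ring
  simp only [e]
  have hi := fun Y => integrable_ofReal_mul_cexp (integrable_gauss_smul (n := n) ht) Y
  rw [integral_sub (hi _) (hi _), integral_gauss_smul_mul_cexp ht, integral_gauss_smul_mul_cexp ht,
    smul_neg, gauss_neg, show X + -z = -(z - X) by abel, smul_neg, gauss_neg]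
  push_cast; ring

lemma integral_mul_gauss_eq_smear {n : ℕ} {t : ℝ} (ht : 0 < t) (G : Euc n → ℝ) (X : Euc n) :
    ∫ z, G z * ((t ^ n)⁻¹ * gauss (t⁻¹ • (z - X))) = smear G t X := by
  have h := Measure.integral_comp_smul volume (fun z : Euc n => G (z + X) * gauss (t⁻¹ • z)) t
  simp only [finrank_euclideanSpace, Fintype.card_fin, smul_eq_mul,
    abs_of_pos (inv_pos.2 (pow_pos ht n)), smul_smul, inv_mul_cancel₀ ht.ne', one_smul] at h
  have h2 := integral_sub_right_eq_self (μ := volume) (fun z : Euc n => G (z + X) * gauss (t⁻¹ • z)) X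
  simp only [sub_add_cancel] at h2
  rw [smear]
  simp only [mul_comm (gauss _), add_comm X]
  rw [h, ← h2, ← integral_const_mul]
  congr 1; ext z; ring

lemma integrable_mul_gauss_iff {n : ℕ} {t : ℝ} (ht : 0 < t) {G : Euc n → ℝ} {X : Euc n}
    (h : Integrable (fun h => gauss h * G (X + t • h))) :
    Integrable (fun z => G z * ((t ^ n)⁻¹ * gauss (t⁻¹ • (z - X)))) := by
  have h1 : Integrable (fun z => gauss (t⁻¹ • z) * G (X + z)) := by
    refine (integrable_comp_smul_iff volume (fun z => gauss (t⁻¹ • z) * G (X + z)) ht.ne').1 ?_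
    simpa [smul_smul, inv_mul_cancel₀ ht.ne'] using h
  have h2 := (h1.comp_sub_right X).const_mul (t ^ n)⁻¹
  refine h2.congr (.of_forall fun z => ?_)
  simp only [add_sub_cancel]; ring

/-- Mean value inequality along the segment. The decay of the derivative at an intermediate point is
transferred to `w` by Peetre's inequality `1 + ‖w‖ ≤ (1 + ‖w + θ • v‖) (1 + ‖v‖)`. -/
lemma schwartz_sub_le {n : ℕ} (κ : 𝓢(Euc n, ℂ)) (N : ℕ) :
    ∃ D, 0 ≤ D ∧ ∀ w v : Euc n,
      ‖κ (w + v) - κ w‖ ≤ D * ‖v‖ * ((1 + ‖v‖) ^ N * ((1 + ‖w‖) ^ N)⁻¹) := by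
  set D : ℝ := 2 ^ N * (Finset.Iic (N, 1)).sup (fun m => SchwartzMap.seminorm ℝ m.1 m.2) κ
  have hD : ∀ x, (1 + ‖x‖) ^ N * ‖iteratedFDeriv ℝ 1 κ x‖ ≤ D := fun x =>
    SchwartzMap.one_add_le_sup_seminorm_apply (𝕜 := ℝ) (m := (N, 1)) le_rfl le_rfl κ x
  have hD0 : 0 ≤ D := le_trans (by positivity) (hD 0)
  refine ⟨D, hD0, fun w v => ?_⟩
  have hbd : ∀ u ∈ segment ℝ w (w + v),
      ‖fderiv ℝ κ u‖ ≤ D * ((1 + ‖v‖) ^ N * ((1 + ‖w‖) ^ N)⁻¹) := by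
    intro u hu
    obtain ⟨θ, hθ, rfl⟩ := (segment_eq_image' ℝ w (w + v)) ▸ hu
    simp only [add_sub_cancel_left]
    have h1 : 1 + ‖w‖ ≤ (1 + ‖w + θ • v‖) * (1 + ‖v‖) := by
      have h2 : ‖w‖ ≤ ‖w + θ • v‖ + ‖v‖ := by
        have h3 := norm_sub_le (w + θ • v) (θ • v)
        rw [add_sub_cancel_right, norm_smul, Real.norm_of_nonneg hθ.1] at h3
        nlinarith [norm_nonneg v, hθ.2]
      nlinarith [norm_nonneg v, norm_nonneg (w + θ • v)]
    have h4 := hD (w + θ • v)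
    rw [norm_iteratedFDeriv_one] at h4
    rw [← mul_assoc, ← div_eq_mul_inv, le_div_iff₀ (by positivity)]
    calc _ ≤ ‖fderiv ℝ κ (w + θ • v)‖ * ((1 + ‖w + θ • v‖) * (1 + ‖v‖)) ^ N := by gcongr
      _ = ((1 + ‖w + θ • v‖) ^ N * ‖fderiv ℝ κ (w + θ • v)‖) * (1 + ‖v‖) ^ N := by
        rw [mul_pow]; ring
      _ ≤ _ := by gcongr
  have := (convex_segment w (w + v)).norm_image_sub_le_of_norm_fderiv_le (𝕜 := ℝ) (f := κ)
    (fun u _ => κ.differentiableAt) hbd (left_mem_segment ℝ w (w + v))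
    (right_mem_segment ℝ w (w + v))
  rw [add_sub_cancel_left] at this
  refine this.trans (le_of_eq ?_); ring

lemma integrable_inv_one_add_norm_pow {n N : ℕ} (hN : n < N) :
    Integrable (fun x : Euc n => ((1 + ‖x‖) ^ N)⁻¹) := by
  have := integrable_one_add_norm (E := Euc n) (μ := volume) (r := N) (by simpa using hN)
  refine this.congr (.of_forall fun x => ?_)
  simp only
  rw [Real.rpow_neg (by positivity), Real.rpow_natCast]

lemma integrable_one_add_pow_mul_gauss {n : ℕ} {t : ℝ} (ht : 0 ≤ t) (N : ℕ) :
    Integrable (fun y : Euc n => (1 + t * ‖y‖) ^ N * gauss y) := by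
  have h : Integrable (fun y : Euc n => 2 ^ (N - 1) * (gauss y + t ^ N * (‖y‖ ^ N * gauss y))) :=
    (integrable_gauss.add ((integrable_pow_mul_gauss N).const_mul _)).const_mul _
  refine h.mono' (Continuous.aestronglyMeasurable ?_) (.of_forall fun y => ?_)
  · have := continuous_gauss (n := n)
    fun_prop
  · have hg := gauss_pos y
    rw [Real.norm_of_nonneg (by positivity)]
    calc _ ≤ 2 ^ (N - 1) * (1 ^ N + (t * ‖y‖) ^ N) * gauss y := by
          gcongr; exact add_pow_le zero_le_one (by positivity) N
      _ = _ := by rw [mul_pow, one_pow]; ring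

lemma integral_fourier_schwartz {n : ℕ} (ψ : 𝓢(Euc n, ℂ)) : ∫ z, 𝓕 (ψ : Euc n → ℂ) z = ψ 0 := by
  have h : 𝓕⁻ (𝓕 ψ) = ψ := FourierTransform.fourierInv_fourier_eq ψ
  have h2 : (𝓕⁻ (𝓕 ψ)) 0 = ∫ z, 𝓕 (ψ : Euc n → ℂ) z := by
    rw [SchwartzMap.fourierInv_coe, Real.fourierInv_eq']
    simp [SchwartzMap.fourier_coe]
  rw [← h2, h]

lemma integrable_fourier_schwartz {n : ℕ} (ψ : 𝓢(Euc n, ℂ)) :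
    Integrable (𝓕 (ψ : Euc n → ℂ)) := by
  rw [← SchwartzMap.fourier_coe]; exact (𝓕 ψ).integrable

lemma fourier_comp_inv_smul {n : ℕ} {δ : ℝ} (hδ : 0 < δ) (f : Euc n → ℂ) (z : Euc n) :
    𝓕 (fun ξ => f (δ⁻¹ • ξ)) z = δ ^ n * 𝓕 f (δ • z) := by
  simp only [fourier_eq_integral_mul_cexp]
  have h := Measure.integral_comp_smul volume (fun ξ : Euc n =>
    f ξ * Complex.exp (2 * Real.pi * Complex.I * inner ℝ (-(δ • z)) ξ)) δ⁻¹
  simp only [finrank_euclideanSpace, Fintype.card_fin, inv_pow, inv_inv,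
    abs_of_pos (pow_pos hδ n)] at h
  rw [Complex.real_smul] at h
  push_cast at h
  rw [← h]
  congr 1; ext ξ
  have : inner ℝ (-z) ξ = inner ℝ (-(δ • z)) (δ⁻¹ • ξ) := by
    rw [← smul_neg, inner_smul_left, inner_smul_right]
    simp only [conj_trivial]
    rw [mul_inv_cancel_left₀ hδ.ne']
  rw [this]

/-- The low frequency part of the test function `gauss (t ξ) (exp (2 π i ⟪X, ξ⟫) - 1)`. -/
lemma exists_low_frequency_bound {n : ℕ} {t : ℝ} (ht : 0 < t) (X : Euc n)
    (χ : ContDiffBump (0 : Euc n)) {φ : 𝓢(Euc n, ℂ)} (hφ : ∀ ξ, φ ξ =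
      gauss (t • ξ) * (Complex.exp (2 * Real.pi * Complex.I * inner ℝ X ξ) - 1)) (N : ℕ) :
    ∃ E, 0 ≤ E ∧ ∀ δ, 0 < δ → δ ≤ 1 → ∃ ψ : 𝓢(Euc n, ℂ), (∀ ξ, ψ ξ = χ (δ⁻¹ • ξ) * φ ξ) ∧
      ∀ z, ‖𝓕 (ψ : Euc n → ℂ) z‖ ≤ δ * E * (δ ^ n * ((1 + ‖δ • z‖) ^ N)⁻¹) := by
  have hχc : ContDiff ℝ ∞ (fun ξ => (χ ξ : ℂ)) := Complex.ofRealCLM.contDiff.comp χ.contDiff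
  have hχs : HasCompactSupport (fun ξ => (χ ξ : ℂ)) :=
    χ.hasCompactSupport.comp_left Complex.ofReal_zero
  set κ : 𝓢(Euc n, ℂ) := 𝓕 (hχs.toSchwartzMap hχc)
  have hκ : ∀ z, κ z = 𝓕 (fun ξ => (χ ξ : ℂ)) z := fun z => rfl
  obtain ⟨D, hD, hDb⟩ := schwartz_sub_le κ N
  set m : ℝ := ∫ y : Euc n, (1 + t * ‖y‖) ^ N * gauss y
  have hmi := integrable_one_add_pow_mul_gauss (n := n) ht.le N
  have hm : 0 ≤ m := integral_nonneg fun y => mul_nonneg (by positivity) (gauss_pos y).le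
  refine ⟨D * ‖X‖ * (1 + ‖X‖) ^ N * m, by positivity, fun δ hδ hδ1 => ?_⟩
  set f : Euc n → ℂ := fun ξ => χ (δ⁻¹ • ξ)
  have hfs : HasCompactSupport f :=
    hχs.comp_homeomorph (Homeomorph.smulOfNeZero δ⁻¹ (inv_pos.2 hδ).ne')
  have hfc : ContDiff ℝ ∞ f := hχc.comp (contDiff_id.const_smul δ⁻¹)
  have hfi : Integrable f := hfc.continuous.integrable_of_hasCompactSupport hfs
  set ψ : 𝓢(Euc n, ℂ) := HasCompactSupport.toSchwartzMap (f := fun ξ => f ξ * φ ξ)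
    hfs.mul_right (hfc.mul (φ.smooth ⊤))
  have hψ : ∀ ξ, ψ ξ = f ξ * φ ξ := fun ξ => rfl
  refine ⟨ψ, hψ, fun z => ?_⟩
  have hgi : ∀ Y, Integrable (fun ξ => f ξ * (gauss (t • ξ) *
      Complex.exp (2 * Real.pi * Complex.I * inner ℝ Y ξ))) := fun Y => by
    refine hfi.mul_bdd (c := 1) (Continuous.aestronglyMeasurable ?_) (.of_forall fun ξ => ?_)
    · have := continuous_gauss (n := n)
      fun_prop
    · rw [norm_mul, norm_cexp_inner, mul_one, Complex.norm_real,
        Real.norm_of_nonneg (gauss_pos _).le]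
      exact gauss_le_one _
  have hF : ∀ z, 𝓕 f z = δ ^ n * κ (δ • z) := fun z => by
    rw [hκ]; exact fourier_comp_inv_smul hδ (fun ξ => (χ ξ : ℂ)) z
  have hκi : ∀ Y, Integrable (fun y : Euc n => (gauss y : ℂ) * 𝓕 f (z + t • y - Y)) := fun Y => by
    simp only [hF]
    have hb : Continuous (fun y : Euc n => (δ : ℂ) ^ n * κ (δ • (z + t • y - Y))) := by
      have := κ.continuous
      fun_prop
    obtain ⟨B, hB⟩ : ∃ B, ∀ x, ‖κ x‖ ≤ B := ⟨_, κ.norm_le_seminorm ℝ⟩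
    refine integrable_gauss.ofReal.mul_bdd (c := ‖(δ : ℂ) ^ n‖ * B) hb.aestronglyMeasurable
      (.of_forall fun y => ?_)
    rw [norm_mul]
    gcongr
    exact hB _
  -- The factor `exp - 1` becomes a difference of two values of the transform of the cutoff at
  -- points `X` apart. After the dilation by `δ` they are only `δ • X` apart, which is where the
  -- gain of a factor `δ` comes from.
  have e1 : 𝓕 (ψ : Euc n → ℂ) z =
      ∫ y : Euc n, (gauss y : ℂ) * (𝓕 f (z + t • y - X) - 𝓕 f (z + t • y - 0)) := by
    simp only [mul_sub]
    rw [integral_sub (hκi X) (hκi 0), ← fourier_mul_gauss hfi t X z, ← fourier_mul_gauss hfi t 0 z,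
      fourier_eq_integral_mul_cexp, fourier_eq_integral_mul_cexp, fourier_eq_integral_mul_cexp,
      ← integral_sub]
    · congr 1; ext ξ
      simp only [hψ, hφ, inner_zero_left, Complex.ofReal_zero, mul_zero, Complex.exp_zero]
      ring
    · exact (hgi X).mul_bdd (c := 1) (Continuous.aestronglyMeasurable (by fun_prop))
        (.of_forall fun ξ => (norm_cexp_inner _ _).le)
    · exact (hgi 0).mul_bdd (c := 1) (Continuous.aestronglyMeasurable (by fun_prop))
        (.of_forall fun ξ => (norm_cexp_inner _ _).le)
  rw [e1]
  have hpt : ∀ y : Euc n, ‖(gauss y : ℂ) * (𝓕 f (z + t • y - X) - 𝓕 f (z + t • y - 0))‖ ≤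
      (δ ^ n * (D * (δ * ‖X‖) * ((1 + ‖X‖) ^ N * ((1 + ‖δ • z‖) ^ N)⁻¹))) *
        ((1 + t * ‖y‖) ^ N * gauss y) := by
    intro y
    have hg := gauss_pos y
    rw [hF, hF, ← mul_sub, norm_mul, norm_mul, Complex.norm_real, Real.norm_of_nonneg hg.le,
      norm_pow, Complex.norm_real, Real.norm_of_nonneg hδ.le, sub_zero]
    have h1 := hDb (δ • (z + t • y)) (-(δ • X))
    rw [← sub_eq_add_neg, ← smul_sub, norm_neg, norm_smul δ X, Real.norm_of_nonneg hδ.le] at h1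
    have h2 : ((1 + ‖δ • (z + t • y)‖) ^ N)⁻¹ ≤ (1 + t * ‖y‖) ^ N * ((1 + ‖δ • z‖) ^ N)⁻¹ := by
      rw [← div_eq_mul_inv, le_div_iff₀ (by positivity), inv_mul_le_iff₀ (by positivity),
        ← mul_pow]
      gcongr
      have h3 : ‖δ • z‖ ≤ ‖δ • (z + t • y)‖ + t * ‖y‖ := by
        have h4 := norm_sub_le (δ • (z + t • y)) (δ • t • y)
        rw [← smul_sub, add_sub_cancel_right, norm_smul δ (t • y), norm_smul t y,
          Real.norm_of_nonneg hδ.le, Real.norm_of_nonneg ht.le] at h4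
        have : δ * (t * ‖y‖) ≤ t * ‖y‖ := mul_le_of_le_one_left (by positivity) hδ1
        linarith
      have : 0 ≤ ‖δ • (z + t • y)‖ * (t * ‖y‖) := by positivity
      nlinarith
    calc _ ≤ gauss y * (δ ^ n * (D * (δ * ‖X‖) * ((1 + δ * ‖X‖) ^ N *
          ((1 + ‖δ • (z + t • y)‖) ^ N)⁻¹))) := by gcongr
      _ ≤ gauss y * (δ ^ n * (D * (δ * ‖X‖) * ((1 + 1 * ‖X‖) ^ N *
          ((1 + t * ‖y‖) ^ N * ((1 + ‖δ • z‖) ^ N)⁻¹)))) := by gcongr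
      _ = _ := by ring
  refine (norm_integral_le_of_norm_le (hmi.const_mul _) (.of_forall hpt)).trans (le_of_eq ?_)
  rw [integral_const_mul]
  change _ * m = _
  ring

namespace ScaleControl

variable {n : ℕ} {s a C ρ : ℝ} {K : ℕ} {G : Euc n → ℝ} {b : ℝ → ℝ}

/-- The transform of the low frequency piece lives at spatial scale `δ⁻¹`, where `G` differs from
the constant `b δ⁻¹` by order `δ ^ s`. The constant drops out since `ψ 0 = 0` forces the transform
to have zero mean, and the piece itself carries a factor `δ`. -/
lemma exists_integral_low_frequency_le (hn : 0 < n) (ha : 0 ≤ a) (han : a < n) (hs : 0 ≤ s)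
    (hG : ScaleControl s a C ρ K G b) {t : ℝ} (ht : 0 < t) (X : Euc n)
    (χ : ContDiffBump (0 : Euc n)) {φ : 𝓢(Euc n, ℂ)} (hφ : ∀ ξ, φ ξ =
      gauss (t • ξ) * (Complex.exp (2 * Real.pi * Complex.I * inner ℝ X ξ) - 1)) :
    ∃ E, 0 ≤ E ∧ ∀ δ, 0 < δ → δ ≤ 1 → ∃ ψ : 𝓢(Euc n, ℂ), (∀ ξ, ψ ξ = χ (δ⁻¹ • ξ) * φ ξ) ∧
      Integrable (fun z => (G z : ℂ) * 𝓕 (ψ : Euc n → ℂ) z) ∧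
      ‖∫ z, (G z : ℂ) * 𝓕 (ψ : Euc n → ℂ) z‖ ≤ E * δ := by
  have hC := hG.const_nonneg hn
  -- Order `n + 1` would make the weight integrable; the extra order absorbs the linear growth in
  -- the oscillation bound.
  obtain ⟨E, hE, hEb⟩ := exists_low_frequency_bound ht X χ hφ (n + 2)
  set P : Euc n → ℝ := fun w => ((1 + ‖w‖) ^ (n + 2))⁻¹ * (‖w‖ ^ (-a) + ‖w‖)
  have hP0 : ∀ w, 0 ≤ P w := fun w => by positivity
  have hP : Integrable P := by
    obtain ⟨V, -, hV⟩ := exists_integral_mul_shift_rpow_le hn ha han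
    have h1 := (hV (fun w => ((1 + ‖w‖) ^ (n + 2))⁻¹) 1
      (integrable_inv_one_add_norm_pow (by omega)) (fun w => by positivity)
      (fun w => inv_le_one_of_one_le₀ (one_le_pow₀ (by linarith [norm_nonneg w]))) 0 1
      (by simp)).1
    simp only [zero_add, one_smul] at h1
    have h2 : Integrable (fun w : Euc n => ((1 + ‖w‖) ^ (n + 2))⁻¹ * ‖w‖) := by
      refine (integrable_inv_one_add_norm_pow (n := n) (N := n + 1) (by omega)).mono'
        (Measurable.aestronglyMeasurable (by fun_prop)) (.of_forall fun w => ?_)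
      rw [Real.norm_of_nonneg (by positivity), inv_mul_le_iff₀ (by positivity), pow_succ,
        mul_right_comm, mul_inv_cancel₀ (by positivity), one_mul]
      linarith [norm_nonneg w]
    refine (h1.add h2).congr (.of_forall fun w => ?_)
    simp only [P, Pi.add_apply]; ring
  refine ⟨E * (C * ∫ w, P w), by have := integral_nonneg (μ := volume) (f := P) hP0; positivity,
    fun δ hδ hδ1 => ?_⟩
  obtain ⟨ψ, hψ, hψb⟩ := hEb δ hδ hδ1
  have hFi := integrable_fourier_schwartz ψ
  set B : Euc n → ℝ := fun z => C * δ ^ s * (δ * E * (δ ^ n * P (δ • z)))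
  have hBi : Integrable B :=
    (((hP.comp_smul hδ.ne').const_mul _).const_mul _).const_mul _
  have hne : ∀ᵐ z : Euc n, z ≠ 0 := by
    simpa using ae_add_smul_ne_zero hn (0 : Euc n) one_ne_zero
  have hpt : ∀ᵐ z, ‖((G z - b δ⁻¹ : ℝ) : ℂ) * 𝓕 (ψ : Euc n → ℂ) z‖ ≤ B z := by
    filter_upwards [hne] with z hz
    have h1 := hG.osc δ⁻¹ (inv_pos.2 hδ) z hz
    have h2 : ‖z‖ / δ⁻¹ = ‖δ • z‖ := by
      rw [norm_smul, Real.norm_of_nonneg hδ.le, div_inv_eq_mul, mul_comm]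
    have h3 : δ⁻¹ ^ (-s) = δ ^ s := by
      rw [Real.inv_rpow hδ.le, Real.rpow_neg hδ.le, inv_inv]
    rw [h2, h3] at h1
    rw [norm_mul, Complex.norm_real, Real.norm_eq_abs]
    refine (mul_le_mul h1 (hψb z) (norm_nonneg _) (by positivity)).trans (le_of_eq ?_)
    simp only [B, P]; ring
  have hm : AEStronglyMeasurable
      (fun z => ((G z - b δ⁻¹ : ℝ) : ℂ) * 𝓕 (ψ : Euc n → ℂ) z) volume := by
    refine AEStronglyMeasurable.mul ?_ hFi.1
    exact (Complex.measurable_ofReal.comp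
      (hG.measurable.sub_const _)).aestronglyMeasurable
  have hI : Integrable (fun z => ((G z - b δ⁻¹ : ℝ) : ℂ) * 𝓕 (ψ : Euc n → ℂ) z) :=
    hBi.mono' hm hpt
  have e : (fun z => (G z : ℂ) * 𝓕 (ψ : Euc n → ℂ) z) = fun z =>
      ((G z - b δ⁻¹ : ℝ) : ℂ) * 𝓕 (ψ : Euc n → ℂ) z + (b δ⁻¹ : ℂ) * 𝓕 (ψ : Euc n → ℂ) z := by
    ext z; push_cast; ring
  refine ⟨ψ, hψ, e ▸ hI.add (hFi.const_mul _), ?_⟩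
  have h0 : ψ 0 = 0 := by simp [hψ, hφ]
  rw [e, integral_add hI (hFi.const_mul _), integral_const_mul, integral_fourier_schwartz, h0,
    mul_zero, add_zero]
  refine (norm_integral_le_of_norm_le hBi hpt).trans ?_
  simp only [B]
  rw [integral_const_mul, integral_const_mul, integral_const_mul,
    Measure.integral_comp_smul volume P δ]
  simp only [finrank_euclideanSpace, Fintype.card_fin, smul_eq_mul,
    abs_of_pos (inv_pos.2 (pow_pos hδ n))]
  rw [mul_inv_cancel_left₀ (pow_pos hδ n).ne']
  have h4 : δ ^ s ≤ 1 := Real.rpow_le_one hδ.le hδ1 hs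
  have h5 : 0 ≤ ∫ w, P w := integral_nonneg hP0
  calc _ ≤ C * 1 * (δ * E * ∫ w, P w) := by gcongr
    _ = _ := by ring

end ScaleControl

lemma aestronglyMeasurable_of_locallyIntegrableOn_compl {n : ℕ} (hn : 0 < n) {F : Euc n → ℝ}
    (h : LocallyIntegrableOn F {0}ᶜ volume) : AEStronglyMeasurable F volume := by
  have : Nonempty (Fin n) := ⟨⟨0, hn⟩⟩
  have h1 := h.aestronglyMeasurable
  rwa [Measure.restrict_eq_self_of_ae_mem] at h1
  exact compl_mem_ae_iff.2 (measure_singleton _)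

lemma norm_cexp_sub_one_le {n : ℕ} (X ξ : Euc n) :
    ‖Complex.exp (2 * Real.pi * Complex.I * inner ℝ X ξ) - 1‖ ≤ 2 * Real.pi * ‖X‖ * ‖ξ‖ := by
  have : (2 * Real.pi * Complex.I * (inner ℝ X ξ : ℝ) : ℂ) =
    Complex.I * ((2 * Real.pi * inner ℝ X ξ : ℝ) : ℂ) := by push_cast; ring
  rw [this]
  refine (Real.norm_exp_I_mul_ofReal_sub_one_le).trans ?_
  rw [Real.norm_eq_abs, abs_mul, abs_of_pos Real.two_pi_pos, mul_assoc (2 * Real.pi)]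
  gcongr
  exact abs_real_inner_le_norm X ξ

/-- The vanishing of `exp - 1` at the origin gains one power of `‖ξ‖`, which makes the singularity
of order `n - s` integrable even for `s = 0`. -/
lemma integrable_mul_gauss_mul_cexp_sub_one {n : ℕ} (hn : 0 < n) {s : ℝ} (hs : 0 ≤ s) (hsn : s ≤ n)
    {F : Euc n → ℝ} (hm : AEStronglyMeasurable F volume) {B : ℝ}
    (hF : ∀ ξ, ξ ≠ 0 → |F ξ| ≤ B / ‖ξ‖ ^ ((n : ℝ) - s)) {t : ℝ} (ht : 0 < t) (X : Euc n) :
    Integrable (fun ξ => (F ξ : ℂ) * (gauss (t • ξ) *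
      (Complex.exp (2 * Real.pi * Complex.I * inner ℝ X ξ) - 1))) := by
  -- Any nonnegative exponent `p` with `n - s - 1 ≤ p < n` would do; subtracting only one half of
  -- the gained power keeps both inequalities.
  set p : ℝ := max 0 (n - s - 1 / 2)
  have hp0 : 0 ≤ p := le_max_left _ _
  have hn1 : (1 : ℝ) ≤ n := by exact_mod_cast hn
  have hpn : p < n := max_lt (by linarith) (by linarith)
  obtain ⟨V, -, hV⟩ := exists_integral_mul_shift_rpow_le hn hp0 hpn
  have h1 := (hV (fun ξ => gauss (t • ξ)) 1 (integrable_gauss_smul ht)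
    (fun ξ => (gauss_pos _).le) (fun ξ => gauss_le_one _) 0 1 (by simp)).1
  simp only [zero_add, one_smul] at h1
  have h2 : Integrable (fun ξ : Euc n => gauss (t • ξ) * ‖ξ‖) := by
    have h3 := ((integrable_pow_mul_gauss (n := n) 1).comp_smul ht.ne').const_mul t⁻¹
    refine h3.congr (.of_forall fun ξ => ?_)
    simp only [pow_one, norm_smul, Real.norm_of_nonneg ht.le]
    field_simp
  set D : Euc n → ℝ := fun ξ => |B| * (2 * Real.pi * ‖X‖) *
    (gauss (t • ξ) * ‖ξ‖ ^ (-p) + gauss (t • ξ) * ‖ξ‖)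
  have hD : Integrable D := (h1.add h2).const_mul _
  refine hD.mono' ?_ ?_
  · refine AEStronglyMeasurable.mul
      (Complex.continuous_ofReal.comp_aestronglyMeasurable hm)
      (Continuous.aestronglyMeasurable ?_)
    have := continuous_gauss (n := n)
    fun_prop
  · have hne : ∀ᵐ z : Euc n, z ≠ 0 := by
      simpa using ae_add_smul_ne_zero hn (0 : Euc n) one_ne_zero
    filter_upwards [hne] with ξ hξ
    have hξ0 : 0 < ‖ξ‖ := norm_pos_iff.2 hξ
    have hg := gauss_pos (t • ξ)
    rw [norm_mul, norm_mul, Complex.norm_real, Complex.norm_real, Real.norm_of_nonneg hg.le,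
      Real.norm_eq_abs]
    have h4 : |F ξ| ≤ |B| * ‖ξ‖ ^ (-((n : ℝ) - s)) := by
      rw [Real.rpow_neg hξ0.le, ← div_eq_mul_inv]
      exact (hF ξ hξ).trans (by gcongr; exact le_abs_self B)
    have h5 : ‖ξ‖ ^ (-((n : ℝ) - s)) * ‖ξ‖ ≤ ‖ξ‖ ^ (-p) + ‖ξ‖ := by
      rw [← Real.rpow_add_one hξ0.ne']
      rcases le_total ‖ξ‖ 1 with h | h
      · have : ‖ξ‖ ^ (-((n : ℝ) - s) + 1) ≤ ‖ξ‖ ^ (-p) := by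
          refine Real.rpow_le_rpow_of_exponent_ge hξ0 h ?_
          have : (n : ℝ) - s - 1 / 2 ≤ p := le_max_right _ _
          rcases max_choice (0 : ℝ) (n - s - 1 / 2) with hc | hc
          · have hp : p = 0 := hc
            have := le_max_right (0 : ℝ) (n - s - 1 / 2)
            rw [hc] at this
            linarith
          · have hp : p = n - s - 1 / 2 := hc
            linarith
        linarith
      · have : ‖ξ‖ ^ (-((n : ℝ) - s) + 1) ≤ ‖ξ‖ := by
          calc _ ≤ ‖ξ‖ ^ (1 : ℝ) := Real.rpow_le_rpow_of_exponent_le h (by linarith)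
            _ = _ := Real.rpow_one _
        linarith [Real.rpow_nonneg hξ0.le (-p)]
    calc _ ≤ (|B| * ‖ξ‖ ^ (-((n : ℝ) - s))) * (gauss (t • ξ) * (2 * Real.pi * ‖X‖ * ‖ξ‖)) := by
          gcongr; exact norm_cexp_sub_one_le X ξ
      _ = |B| * (2 * Real.pi * ‖X‖) * (gauss (t • ξ) * (‖ξ‖ ^ (-((n : ℝ) - s)) * ‖ξ‖)) := by ring
      _ ≤ |B| * (2 * Real.pi * ‖X‖) * (gauss (t • ξ) * (‖ξ‖ ^ (-p) + ‖ξ‖)) := by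
          have := Real.pi_pos
          gcongr
      _ = _ := by simp only [D]; ring

namespace ScaleControl

variable {n : ℕ} {s a C ρ : ℝ} {K : ℕ} {G : Euc n → ℝ} {b : ℝ → ℝ}

/-- The Fourier assumption only admits test functions supported away from the origin. Frequencies
below `δ` are therefore cut off, and `δ → 0`: on the side of `G` the removed piece is `O(δ)`, on the
side of `Ghat` dominated convergence applies. -/
lemma integral_mul_gauss_mul_cexp_sub_one (hn : 0 < n) (ha : 0 ≤ a) (han : a < n) (hs : 0 ≤ s)
    (hsn : s ≤ n) (hG : ScaleControl s a C ρ K G b) {Ghat : Euc n → ℝ} (hF : HasFourierTransformOffZero G Ghat)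
    {B : ℝ} (hB : ∀ ξ, ξ ≠ 0 → |Ghat ξ| ≤ B / ‖ξ‖ ^ ((n : ℝ) - s)) {t : ℝ} (ht : 0 < t)
    (X : Euc n) :
    ∫ ξ, (Ghat ξ : ℂ) * (gauss (t • ξ) *
      (Complex.exp (2 * Real.pi * Complex.I * inner ℝ X ξ) - 1)) =
      ((smear G t X - smear G t 0 : ℝ) : ℂ) := by
  obtain ⟨φ, hφ⟩ := exists_schwartz_gauss_mul_cexp_sub_one ht X
  set χ : ContDiffBump (0 : Euc n) := ⟨1, 2, one_pos, one_lt_two⟩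
  obtain ⟨E, hE, hEb⟩ := hG.exists_integral_low_frequency_le hn ha han hs ht X χ hφ
  have hGh := aestronglyMeasurable_of_locallyIntegrableOn_compl hn hF.1
  have hφI := integrable_mul_gauss_mul_cexp_sub_one hn hs hsn hGh hB ht X
  simp only [← hφ] at hφI ⊢
  set δ : ℕ → ℝ := fun k => 1 / ((k : ℝ) + 1)
  have hδ0 : ∀ k, 0 < δ k := fun k => Nat.one_div_pos_of_nat
  have hδ1 : ∀ k, δ k ≤ 1 := fun k => by
    rw [div_le_one (by positivity)]; linarith [(Nat.cast_nonneg k : (0 : ℝ) ≤ k)]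
  have hδt : Tendsto δ atTop (𝓝 0) := tendsto_one_div_add_atTop_nhds_zero_nat
  choose ψ hψ hψI hψb using fun k => hEb (δ k) (hδ0 k) (hδ1 k)
  have hsm : ∀ Y, Integrable (fun h => gauss h * G (Y + t • h)) := fun Y => by
    obtain ⟨D, -, h⟩ := exists_smear_sub_le hn ha han
    have := (h hG t ht 1 (by simp) Y).1
    simpa using this
  have hFφ : ∀ z, (G z : ℂ) * 𝓕 (φ : Euc n → ℂ) z =
      ((G z * ((t ^ n)⁻¹ * gauss (t⁻¹ • (z - X))) -
        G z * ((t ^ n)⁻¹ * gauss (t⁻¹ • (z - 0))) : ℝ) : ℂ) := fun z => by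
    have : (φ : Euc n → ℂ) = fun ξ => (gauss (t • ξ) : ℂ) *
      (Complex.exp (2 * Real.pi * Complex.I * inner ℝ X ξ) - 1) := funext hφ
    rw [this, fourier_gauss_mul_cexp_sub_one ht, sub_zero]
    push_cast; ring
  have hI1 := integrable_mul_gauss_iff ht (hsm X)
  have hI0 := integrable_mul_gauss_iff ht (hsm 0)
  have hGφI : Integrable (fun z => (G z : ℂ) * 𝓕 (φ : Euc n → ℂ) z) := by
    simp only [hFφ]; exact (hI1.sub hI0).ofReal
  have hGφ : ∫ z, (G z : ℂ) * 𝓕 (φ : Euc n → ℂ) z = ((smear G t X - smear G t 0 : ℝ) : ℂ) := by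
    simp only [hFφ]
    rw [integral_complex_ofReal, integral_sub hI1 hI0, integral_mul_gauss_eq_smear ht,
      integral_mul_gauss_eq_smear ht]
  set Iφ : ℂ := ∫ z, (G z : ℂ) * 𝓕 (φ : Euc n → ℂ) z
  have htest : ∀ k, Iφ - (∫ z, (G z : ℂ) * 𝓕 (ψ k : Euc n → ℂ) z) =
      ∫ ξ, (Ghat ξ : ℂ) * ((1 - χ ((δ k)⁻¹ • ξ) : ℝ) * φ ξ) := by
    intro k
    have h0 : (0 : Euc n) ∉ tsupport (φ - ψ k : 𝓢(Euc n, ℂ)) := by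
      rw [notMem_tsupport_iff_eventuallyEq]
      filter_upwards [Metric.ball_mem_nhds (0 : Euc n) (hδ0 k)] with ξ hξ
      have : χ ((δ k)⁻¹ • ξ) = 1 := by
        refine χ.one_of_mem_closedBall ?_
        rw [mem_closedBall_zero_iff, norm_smul, Real.norm_of_nonneg (inv_pos.2 (hδ0 k)).le]
        rw [mem_ball_zero_iff] at hξ
        rw [inv_mul_le_iff₀ (hδ0 k)]
        change ‖ξ‖ ≤ δ k * 1
        simpa using hξ.le
      simp [hψ, this]
    have h1 := hF.2 _ h0
    have h2 : ∀ z, 𝓕 (((φ - ψ k : 𝓢(Euc n, ℂ))) : Euc n → ℂ) z =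
        𝓕 (φ : Euc n → ℂ) z - 𝓕 (ψ k : Euc n → ℂ) z := fun z => by
      simp only [fourier_eq_integral_mul_cexp, sub_apply, sub_mul]
      have hi : ∀ f : 𝓢(Euc n, ℂ), Integrable (fun ξ =>
          f ξ * Complex.exp (2 * Real.pi * Complex.I * inner ℝ (-z) ξ)) := fun f =>
        f.integrable.mul_bdd (c := 1) (Continuous.aestronglyMeasurable (by fun_prop))
          (.of_forall fun ξ => (norm_cexp_inner _ _).le)
      exact integral_sub (hi φ) (hi (ψ k))
    simp only [h2, mul_sub] at h1
    rw [integral_sub hGφI (hψI k)] at h1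
    rw [h1]
    congr 1; ext ξ
    rw [sub_apply, hψ]
    push_cast; ring
  have hlim1 : Tendsto (fun k => Iφ - (∫ z, (G z : ℂ) * 𝓕 (ψ k : Euc n → ℂ) z)) atTop
      (𝓝 (Iφ - 0)) := by
    refine tendsto_const_nhds.sub (squeeze_zero_norm hψb ?_)
    simpa using hδt.const_mul E
  have hlim2 : Tendsto (fun k => ∫ ξ, (Ghat ξ : ℂ) * ((1 - χ ((δ k)⁻¹ • ξ) : ℝ) * φ ξ)) atTop
      (𝓝 (∫ ξ, (Ghat ξ : ℂ) * φ ξ)) := by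
    refine tendsto_integral_of_dominated_convergence (fun ξ => ‖(Ghat ξ : ℂ) * φ ξ‖)
      (fun k => ?_) hφI.norm (fun k => .of_forall fun ξ => ?_) ?_
    · refine AEStronglyMeasurable.mul
        (Complex.continuous_ofReal.comp_aestronglyMeasurable hGh)
        (Continuous.aestronglyMeasurable ?_)
      have := χ.continuous
      have := φ.continuous
      fun_prop
    · rw [norm_mul, norm_mul, norm_mul, Complex.norm_real (1 - _)]
      have : ‖1 - χ ((δ k)⁻¹ • ξ)‖ ≤ 1 := by
        rw [Real.norm_of_nonneg (sub_nonneg.2 χ.le_one)]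
        linarith [χ.nonneg (x := (δ k)⁻¹ • ξ)]
      refine mul_le_mul_of_nonneg_left ?_ (norm_nonneg _)
      exact mul_le_of_le_one_left (norm_nonneg _) this
    · have hne : ∀ᵐ z : Euc n, z ≠ 0 := by
        simpa using ae_add_smul_ne_zero hn (0 : Euc n) one_ne_zero
      filter_upwards [hne] with ξ hξ
      refine tendsto_const_nhds.congr' ?_
      have hev : ∀ᶠ k in atTop, δ k < ‖ξ‖ / 2 :=
        hδt.eventually_lt_const (by have := norm_pos_iff.2 hξ; positivity)
      filter_upwards [hev] with k hk
      have : χ ((δ k)⁻¹ • ξ) = 0 := by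
        refine χ.zero_of_le_dist ?_
        rw [dist_zero_right, norm_smul, Real.norm_of_nonneg (inv_pos.2 (hδ0 k)).le,
          ← div_eq_inv_mul, le_div_iff₀ (hδ0 k)]
        change 2 * δ k ≤ ‖ξ‖
        linarith
      rw [this]; simp
  simp only [← htest] at hlim2
  rw [sub_zero] at hlim1
  rw [tendsto_nhds_unique hlim2 hlim1, ← hGφ]

/-- Fourier representation of the increments of a Gaussian average. -/
lemma smear_zero_sub_smear (hn : 0 < n) (ha : 0 ≤ a) (han : a < n) (hs : 0 ≤ s)
    (hsn : s ≤ n) (hG : ScaleControl s a C ρ K G b) {Ghat : Euc n → ℝ}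
    (hF : HasFourierTransformOffZero G Ghat)
    {B : ℝ} (hB : ∀ ξ, ξ ≠ 0 → |Ghat ξ| ≤ B / ‖ξ‖ ^ ((n : ℝ) - s)) {t : ℝ} (ht : 0 < t)
    (X : Euc n) :
    Integrable (fun ξ => Ghat ξ * (gauss (t • ξ) *
      (1 - Real.cos (2 * Real.pi * inner ℝ X ξ)))) ∧
    smear G t 0 - smear G t X =
      ∫ ξ, Ghat ξ * (gauss (t • ξ) * (1 - Real.cos (2 * Real.pi * inner ℝ X ξ))) := by
  have h := hG.integral_mul_gauss_mul_cexp_sub_one hn ha han hs hsn hF hB ht X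
  have hI := integrable_mul_gauss_mul_cexp_sub_one hn hs hsn
    (aestronglyMeasurable_of_locallyIntegrableOn_compl hn hF.1) hB ht X
  have e : ∀ ξ, ((Ghat ξ : ℂ) * (gauss (t • ξ) *
      (Complex.exp (2 * Real.pi * Complex.I * inner ℝ X ξ) - 1))).re =
      -(Ghat ξ * (gauss (t • ξ) * (1 - Real.cos (2 * Real.pi * inner ℝ X ξ)))) := fun ξ => by
    have : (2 * Real.pi * Complex.I * (inner ℝ X ξ : ℝ) : ℂ) =
      ((2 * Real.pi * inner ℝ X ξ : ℝ) : ℂ) * Complex.I := by push_cast; ring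
    rw [this, Complex.re_ofReal_mul, Complex.re_ofReal_mul, Complex.sub_re,
      Complex.exp_ofReal_mul_I_re, Complex.one_re]
    ring
  have hre := hI.re
  simp only [RCLike.re_eq_complex_re, e] at hre
  refine ⟨by simpa using hre.neg, ?_⟩
  have h2 := congrArg Complex.re h
  rw [Complex.ofReal_re, ← RCLike.re_eq_complex_re, ← integral_re hI] at h2
  simp only [RCLike.re_eq_complex_re, e] at h2
  rw [integral_neg] at h2
  linarith

end ScaleControl

/-! ### Consequences of the assumptions of Riesz type -/

section Oscillation

variable {n : ℕ} {G : Euc n → ℝ} {D : ℝ}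

/-- Along the ray parametrized by `exp u` the gradient bound becomes a uniform bound on the
derivative in `u`. -/
lemma abs_sub_le_log_of_smul (hG : ContDiffOn ℝ ∞ G {0}ᶜ)
    (hD : ∀ Z, Z ≠ 0 → ‖fderiv ℝ G Z‖ ≤ D / ‖Z‖) {X : Euc n} (hX : X ≠ 0) {r : ℝ} (hr : 0 < r) :
    |G (r • X) - G X| ≤ D * |Real.log r| := by
  have hd : ∀ u : ℝ, HasDerivAt (fun u : ℝ => G (Real.exp u • X))
      (fderiv ℝ G (Real.exp u • X) (Real.exp u • X)) u := fun u => by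
    have hne : Real.exp u • X ≠ 0 := smul_ne_zero (Real.exp_pos u).ne' hX
    have h1 : DifferentiableAt ℝ G (Real.exp u • X) :=
      (hG.contDiffAt (isOpen_compl_singleton.mem_nhds hne)).differentiableAt (by simp)
    exact h1.hasFDerivAt.comp_hasDerivAt u ((Real.hasDerivAt_exp u).smul_const X)
  have h := convex_univ.norm_image_sub_le_of_norm_hasDerivWithin_le (C := D)
    (f := fun u : ℝ => G (Real.exp u • X)) (x := 0) (y := Real.log r)
    (fun u _ => (hd u).hasDerivWithinAt) (fun u _ => ?_) (Set.mem_univ _) (Set.mem_univ _)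
  · simpa [Real.exp_log hr] using h
  · have hne : Real.exp u • X ≠ 0 := smul_ne_zero (Real.exp_pos u).ne' hX
    refine (ContinuousLinearMap.le_opNorm _ _).trans ?_
    have := mul_le_mul_of_nonneg_right (hD _ hne) (norm_nonneg (Real.exp u • X))
    rwa [div_mul_cancel₀ _ (norm_pos_iff.2 hne).ne'] at this

lemma abs_sub_le_of_norm_eq_of_inner_nonneg (hG : ContDiffOn ℝ ∞ G {0}ᶜ)
    (hD : ∀ Z, Z ≠ 0 → ‖fderiv ℝ G Z‖ ≤ D / ‖Z‖) {X Y : Euc n} (hX : X ≠ 0) (hXY : ‖X‖ = ‖Y‖)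
    (hin : 0 ≤ inner ℝ X Y) : |G X - G Y| ≤ 4 * D := by
  have hX0 := norm_pos_iff.2 hX
  have hD0 : 0 ≤ D := by
    have := (norm_nonneg _).trans (hD X hX)
    rwa [le_div_iff₀ hX0, zero_mul] at this
  have hseg : ∀ Z ∈ segment ℝ Y X, ‖X‖ / 2 ≤ ‖Z‖ := by
    rintro Z ⟨p, q, hp, hq, hpq, rfl⟩
    have h1 : ‖p • Y + q • X‖ ^ 2 = p ^ 2 * ‖X‖ ^ 2 + 2 * (p * q * inner ℝ X Y) +
        q ^ 2 * ‖X‖ ^ 2 := by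
      rw [norm_add_sq_real, norm_smul, norm_smul, mul_pow, mul_pow, inner_smul_left,
        inner_smul_right, real_inner_comm, hXY, Real.norm_eq_abs, Real.norm_eq_abs, sq_abs, sq_abs]
      simp only [conj_trivial]
      ring
    have h2 : (‖X‖ / 2) ^ 2 ≤ ‖p • Y + q • X‖ ^ 2 := by
      have : q = 1 - p := by linarith
      subst this
      rw [h1]
      nlinarith [mul_nonneg (mul_nonneg hp hq) hin, mul_nonneg (sq_nonneg (p - 1 / 2))
        (sq_nonneg ‖X‖)]
    exact le_of_sq_le_sq h2 (norm_nonneg _)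
  have h := (convex_segment Y X).norm_image_sub_le_of_norm_fderiv_le (𝕜 := ℝ) (f := G)
    (C := 2 * D / ‖X‖) (fun Z hZ => ?_) (fun Z hZ => ?_) (left_mem_segment ℝ Y X)
    (right_mem_segment ℝ Y X)
  · refine h.trans ?_
    have h3 : ‖X - Y‖ ≤ 2 * ‖X‖ := (norm_sub_le X Y).trans (by rw [← hXY]; linarith)
    calc _ ≤ 2 * D / ‖X‖ * (2 * ‖X‖) := by gcongr
      _ = 4 * D := by field_simp; ring
  · have hZ0 : Z ≠ 0 := norm_pos_iff.1 ((half_pos hX0).trans_le (hseg Z hZ))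
    exact (hG.contDiffAt (isOpen_compl_singleton.mem_nhds hZ0)).differentiableAt (by simp)
  · have hZ0 : 0 < ‖Z‖ := (half_pos hX0).trans_le (hseg Z hZ)
    refine (hD Z (norm_pos_iff.1 hZ0)).trans ?_
    rw [div_le_div_iff₀ hZ0 hX0]
    nlinarith [hseg Z hZ]

/-- Move `Y` radially to the sphere of `X`, then along a chord. If the chord could come close to the
origin, evenness replaces the endpoint by its opposite; this also covers dimension one, where the
sphere is disconnected. -/
lemma abs_sub_le_log (hG : ContDiffOn ℝ ∞ G {0}ᶜ) (heven : ∀ X, X ≠ 0 → G X = G (-X))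
    (hD : ∀ Z, Z ≠ 0 → ‖fderiv ℝ G Z‖ ≤ D / ‖Z‖) {X Y : Euc n} (hX : X ≠ 0) (hY : Y ≠ 0) :
    |G X - G Y| ≤ D * (4 + |Real.log (‖X‖ / ‖Y‖)|) := by
  have hX0 := norm_pos_iff.2 hX
  have hY0 := norm_pos_iff.2 hY
  set r : ℝ := ‖X‖ / ‖Y‖
  have hr : 0 < r := div_pos hX0 hY0
  have h1 := abs_sub_le_log_of_smul hG hD hY hr
  have hrY : ‖X‖ = ‖r • Y‖ := by
    rw [norm_smul, Real.norm_of_nonneg hr.le, div_mul_cancel₀ _ hY0.ne']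
  have h2 : |G X - G (r • Y)| ≤ 4 * D := by
    rcases le_total 0 (inner ℝ X (r • Y)) with hin | hin
    · exact abs_sub_le_of_norm_eq_of_inner_nonneg hG hD hX hrY hin
    · rw [heven (r • Y) (smul_ne_zero hr.ne' hY)]
      refine abs_sub_le_of_norm_eq_of_inner_nonneg hG hD hX (by rw [norm_neg, hrY]) ?_
      rw [inner_neg_right]; linarith
  have h3 := abs_sub_le (G X) (G (r • Y)) (G Y)
  linarith

end Oscillation

namespace IsRieszType

variable {n : ℕ} {s : ℝ} {P : PotentialConstants} {G : Euc n → ℝ}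

lemma pos_of_norm_small (h : IsRieszType n s P G) :
    ∃ δ, 0 < δ ∧ ∀ X : Euc n, X ≠ 0 → ‖X‖ < δ → 1 < G X := by
  have h1 := h.tendsto_atTop.eventually_gt_atTop 1
  rw [eventually_nhdsWithin_iff, Metric.eventually_nhds_iff] at h1
  obtain ⟨δ, hδ, hb⟩ := h1
  exact ⟨δ, hδ, fun X hX hXδ => hb (by simpa using hXδ) hX⟩

/-- Otherwise the gradient would vanish near the origin, where `G > 1`, and `G` would be constant
along a ray into the origin instead of diverging. Positivity of this constant is what turns the
local derivative bound into `0 ≤ G`. -/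
lemma Cloc_pos (hn : 0 < n) (h : IsRieszType n s P G) : 0 < P.Cloc := by
  obtain ⟨δ, hδ, hb⟩ := h.pos_of_norm_small
  set e : Euc n := EuclideanSpace.single ⟨0, hn⟩ 1
  have he : ‖e‖ = 1 := by simp [e]
  set r : ℝ := min (δ / 2) (P.r₀ / 2)
  have hr : 0 < r := lt_min (half_pos hδ) (half_pos P.r₀_pos)
  have hX : r • e ≠ 0 := smul_ne_zero hr.ne' (norm_pos_iff.1 (by rw [he]; exact one_pos))
  have hXn : ‖r • e‖ = r := by rw [norm_smul, he, mul_one, Real.norm_of_nonneg hr.le]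
  have hrr : r < P.r₀ := (min_le_right _ _).trans_lt (half_lt_self P.r₀_pos)
  by_contra hc
  push Not at hc
  have hzero : ∀ X : Euc n, X ≠ 0 → ‖X‖ ≤ r → fderiv ℝ G X = 0 := by
    intro X hX0 hXr
    have h1 := h.deriv_local X (by simpa using hXr.trans_lt hrr) hX0
    have h2 : 1 < G X := hb X hX0 (by
      have : r ≤ δ / 2 := min_le_left _ _
      linarith)
    have h3 : P.Cloc * G X ≤ 0 := mul_nonpos_of_nonpos_of_nonneg hc (by linarith)
    have h4 : 0 ≤ ‖X‖ ^ 2 * ‖iteratedFDeriv ℝ 2 G X‖ := by positivity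
    have h5 : ‖X‖ * ‖fderiv ℝ G X‖ ≤ 0 := by linarith
    have h6 := norm_pos_iff.2 hX0
    have h7 : ‖fderiv ℝ G X‖ ≤ 0 := by
      by_contra h8
      push Not at h8
      have := mul_pos h6 h8
      linarith
    exact norm_le_zero_iff.1 h7
  have hconst : ∀ t ∈ Set.Ioc (0 : ℝ) 1, G (t • r • e) = G (r • e) := by
    intro t ht
    have hd : ∀ u ∈ Set.Ioc (0 : ℝ) 1, HasDerivWithinAt (fun u : ℝ => G (u • r • e)) 0
        (Set.Ioc (0 : ℝ) 1) u := by
      intro u hu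
      have hne : u • r • e ≠ 0 := smul_ne_zero hu.1.ne' hX
      have h1 : DifferentiableAt ℝ G (u • r • e) :=
        (h.smooth.contDiffAt (isOpen_compl_singleton.mem_nhds hne)).differentiableAt (by simp)
      have h2 := h1.hasFDerivAt.comp_hasDerivAt u ((hasDerivAt_id u).smul_const (r • e))
      rw [hzero _ hne (by
        rw [norm_smul, hXn, Real.norm_of_nonneg hu.1.le]
        exact mul_le_of_le_one_left hr.le hu.2)] at h2
      exact h2.hasDerivWithinAt
    have := (convex_Ioc (0 : ℝ) 1).norm_image_sub_le_of_norm_hasDerivWithin_le (C := 0) hd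
      (fun u _ => by simp) ht (⟨one_pos, le_rfl⟩ : (1 : ℝ) ∈ Set.Ioc (0 : ℝ) 1)
    simp only [one_smul, zero_mul, norm_le_zero_iff] at this
    linarith
  have hev := h.tendsto_atTop.eventually_gt_atTop (G (r • e))
  rw [eventually_nhdsWithin_iff, Metric.eventually_nhds_iff] at hev
  obtain ⟨δ', hδ', hb'⟩ := hev
  set t : ℝ := min 1 (δ' / (2 * r))
  have ht : t ∈ Set.Ioc (0 : ℝ) 1 := ⟨lt_min one_pos (by positivity), min_le_left _ _⟩
  have h1 := hb' (y := t • r • e) (by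
    rw [dist_zero_right, norm_smul, hXn, Real.norm_of_nonneg ht.1.le]
    calc t * r ≤ δ' / (2 * r) * r := by gcongr; exact min_le_right _ _
      _ = δ' / 2 := by field_simp
      _ < δ' := half_lt_self hδ') (smul_ne_zero ht.1.ne' hX)
  rw [hconst t ht] at h1
  exact lt_irrefl _ h1

lemma nonneg (hn : 0 < n) (h : IsRieszType n s P G) {X : Euc n} (hX : X ≠ 0)
    (hXr : ‖X‖ < P.r₀) : 0 ≤ G X := by
  have h1 := h.deriv_local X (by simpa using hXr) hX
  have h2 : 0 ≤ P.Cloc * G X := le_trans (by positivity) h1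
  exact nonneg_of_mul_nonneg_right h2 (h.Cloc_pos hn)

lemma fderiv_le (h : IsRieszType n 0 P G) (X : Euc n) (hX : X ≠ 0) :
    ‖fderiv ℝ G X‖ ≤ P.Cder 1 / ‖X‖ := by
  have := h.deriv_bound 1 X hX
  rw [norm_iteratedFDeriv_one] at this
  simpa [div_eq_mul_inv] using this

lemma abs_le_of_pos (hs : 0 < s) (h : IsRieszType n s P G) {X : Euc n} (hX : X ≠ 0) :
    |G X| ≤ P.Cder 0 * ‖X‖ ^ (-s) := by
  have := h.deriv_bound 0 X hX
  rw [norm_iteratedFDeriv_zero] at this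
  simpa [hs.ne', Real.rpow_neg (norm_nonneg X)] using this

lemma abs_le_of_zero (h : IsRieszType n 0 P G) {X : Euc n} (hX : X ≠ 0) :
    |G X| ≤ P.Cder 0 * (1 + |Real.log ‖X‖|) := by
  have := h.deriv_bound 0 X hX
  rw [norm_iteratedFDeriv_zero] at this
  simpa using this

end IsRieszType

/-- The exponent of the local singularity used for potentials of order `s`. -/
noncomputable def singExp (s : ℝ) : ℝ := if s = 0 then 1 / 2 else s

lemma one_le_rpow_neg_add {y p : ℝ} (hy : 0 < y) (hp : 0 ≤ p) : 1 ≤ y ^ (-p) + y := by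
  rcases le_total y 1 with h | h
  · have := Real.one_le_rpow_of_pos_of_le_one_of_nonpos hy h (by linarith : -p ≤ 0)
    linarith
  · have := Real.rpow_nonneg hy.le (-p); linarith

lemma abs_log_le_rpow {y : ℝ} (hy : 0 < y) : |Real.log y| ≤ 2 * (y ^ (-(1 / 2) : ℝ) + y) := by
  have h0 := Real.rpow_nonneg hy.le (-(1 / 2) : ℝ)
  rw [abs_le]
  constructor
  · have h1 := Real.log_le_sub_one_of_pos (Real.rpow_pos_of_pos hy (-(1 / 2) : ℝ))
    rw [Real.log_rpow hy] at h1
    linarith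
  · have := Real.log_le_sub_one_of_pos hy
    linarith

/-- For `s > 0` the reference value is `0` and the size of `G` itself is scale invariant. For `s =
0` it is a value of `G` at distance `2 R`: the logarithmic oscillation is absorbed by the power
`-1/2` and a linear term. -/
lemma exists_scaleControl {n : ℕ} (hn : 0 < n) {s : ℝ} (hs : 0 ≤ s) (P : PotentialConstants)
    {K : ℕ} (hK : 0 < K) :
    ∃ C, 0 < C ∧ ∀ G : Euc n → ℝ, IsRieszType n s P G → ∃ b : ℝ → ℝ,
      ScaleControl s (singExp s) C (P.r₀ / 8) K G b ∧ (0 < s → ∀ R, b R = 0) ∧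
      (s = 0 → ∀ R, 0 < R → |b R| ≤ C * (1 + |Real.log R|)) := by
  set C : ℝ := |P.Cder K| + 2 * |P.Cder 0| + 7 * |P.Cder 1| + 1
  have hC0 : |P.Cder 0| ≤ C := by
    have := abs_nonneg (P.Cder K); have := abs_nonneg (P.Cder 0); have := abs_nonneg (P.Cder 1)
    simp only [C]; linarith
  have hCK : |P.Cder K| ≤ C := by
    have := abs_nonneg (P.Cder K); have := abs_nonneg (P.Cder 0); have := abs_nonneg (P.Cder 1)
    simp only [C]; linarith
  have hC1 : 7 * |P.Cder 1| ≤ C := by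
    have := abs_nonneg (P.Cder K); have := abs_nonneg (P.Cder 0); have := abs_nonneg (P.Cder 1)
    simp only [C]; linarith
  have hC2 : 2 * |P.Cder 0| ≤ C := by
    have := abs_nonneg (P.Cder K); have := abs_nonneg (P.Cder 0); have := abs_nonneg (P.Cder 1)
    simp only [C]; linarith
  have hC : 0 < C := by positivity
  have hder : ∀ G : Euc n → ℝ, IsRieszType n s P G → ∀ X, X ≠ 0 →
      ‖iteratedFDeriv ℝ K G X‖ ≤ C * ‖X‖ ^ (-(s + K)) := by
    intro G h X hX
    have h1 := h.deriv_bound K X hX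
    rw [if_neg (fun hc => hK.ne' hc.2), add_zero, one_div, ← Real.rpow_neg (norm_nonneg X)] at h1
    refine h1.trans ?_
    gcongr
    exact (le_abs_self _).trans hCK
  refine ⟨C, hC, fun G h => ?_⟩
  rcases hs.eq_or_lt with rfl | hs0
  · set e : Euc n := EuclideanSpace.single ⟨0, hn⟩ 1
    have he : ‖e‖ = 1 := by simp [e]
    have he0 : e ≠ 0 := norm_pos_iff.1 (by rw [he]; exact one_pos)
    have hen : ∀ R : ℝ, 0 < R → ‖(2 * R) • e‖ = 2 * R := fun R hR => by
      rw [norm_smul, he, mul_one, Real.norm_of_nonneg (by positivity)]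
    refine ⟨fun R => G ((2 * R) • e), ⟨h.smooth, fun R hR X hX => ?_, hder G h,
      fun R hR hRρ X hX hXR => ?_⟩, fun h0 => absurd h0 (lt_irrefl _), fun _ R hR => ?_⟩
    · have h1 := abs_sub_le_log h.smooth h.even h.fderiv_le hX
        (smul_ne_zero (by positivity : (2 * R) ≠ 0) he0)
      rw [hen R hR] at h1
      have hX0 := norm_pos_iff.2 hX
      have hy : 0 < ‖X‖ / R := div_pos hX0 hR
      have e1 : ‖X‖ / (2 * R) = (‖X‖ / R) / 2 := by field_simp
      rw [e1, Real.log_div hy.ne' two_ne_zero] at h1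
      have h2 : |Real.log (‖X‖ / R) - Real.log 2| ≤ |Real.log (‖X‖ / R)| + 1 := by
        refine (abs_sub _ _).trans (by
          gcongr
          rw [abs_of_pos (Real.log_pos one_lt_two)]
          linarith [Real.log_two_lt_d9])
      have h3 := abs_log_le_rpow hy
      have h4 := one_le_rpow_neg_add hy (by norm_num : (0 : ℝ) ≤ 1 / 2)
      simp only [singExp, if_true, neg_zero, Real.rpow_zero, mul_one]
      calc _ ≤ P.Cder 1 * (4 + |Real.log (‖X‖ / R) - Real.log 2|) := h1
        _ ≤ |P.Cder 1| * (7 * ((‖X‖ / R) ^ (-(1 / 2) : ℝ) + ‖X‖ / R)) := by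
            gcongr
            · exact le_abs_self _
            · linarith
        _ = 7 * |P.Cder 1| * ((‖X‖ / R) ^ (-(1 / 2) : ℝ) + ‖X‖ / R) := by ring
        _ ≤ _ := by gcongr
    -- The reference point lies at distance `2 R` precisely so that doubling applies to every `X`
    -- with `‖X‖ ≤ R`; it stays in the ball of radius `r₀` because `R < r₀ / 8`.
    · have h1 := h.doubling_log rfl X (by
          rw [mem_ball_zero_iff]; linarith [P.r₀_pos])
        ((2 * R) • e) (by rw [mem_ball_zero_iff, hen R hR]; linarith [P.r₀_pos]) hX
        (smul_ne_zero (by positivity : (2 * R) ≠ 0) he0) (by rw [hen R hR]; linarith)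
      have h2 : 0 ≤ C * R ^ (-(0 : ℝ)) := by positivity
      linarith [P.c₀_pos]
    · have h1 := h.abs_le_of_zero (smul_ne_zero (by positivity : (2 * R) ≠ 0) he0)
      rw [hen R hR, Real.log_mul two_ne_zero hR.ne'] at h1
      have h2 : |Real.log 2 + Real.log R| ≤ 1 + |Real.log R| := by
        refine (abs_add_le _ _).trans (by
          gcongr
          rw [abs_of_pos (Real.log_pos one_lt_two)]
          linarith [Real.log_two_lt_d9])
      calc _ ≤ _ := h1
        _ ≤ |P.Cder 0| * (2 * (1 + |Real.log R|)) := by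
            gcongr
            · exact le_abs_self _
            · linarith [abs_nonneg (Real.log R)]
        _ = 2 * |P.Cder 0| * (1 + |Real.log R|) := by ring
        _ ≤ _ := by gcongr
  · refine ⟨fun _ => 0, ⟨h.smooth, fun R hR X hX => ?_, hder G h, fun R hR hRρ X hX hXR => ?_⟩,
      fun _ _ => rfl, fun h0 => absurd h0 hs0.ne'⟩
    · have hX0 := norm_pos_iff.2 hX
      have h1 := h.abs_le_of_pos hs0 hX
      simp only [singExp, if_neg hs0.ne', sub_zero]
      have e1 : ‖X‖ ^ (-s) = R ^ (-s) * (‖X‖ / R) ^ (-s) := by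
        rw [← Real.mul_rpow hR.le (by positivity), mul_div_cancel₀ _ hR.ne']
      calc _ ≤ _ := h1
        _ ≤ C * (R ^ (-s) * (‖X‖ / R) ^ (-s)) := by
            rw [e1]; gcongr; exact (le_abs_self _).trans hC0
        _ ≤ C * (R ^ (-s) * ((‖X‖ / R) ^ (-s) + ‖X‖ / R)) := by
            gcongr; exact le_add_of_nonneg_right (by positivity)
        _ = _ := by ring
    · have h1 := h.nonneg hn hX (by linarith [P.r₀_pos])
      have h2 : 0 ≤ C * R ^ (-s) := by positivity
      simp only [sub_zero]
      linarith

/-! ### Lower bound for the potential near the origin -/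

/-- Scaled annular test functions detect the size of the potential at every scale. -/
lemma exists_scaled_test_lower_bound {n : ℕ} (hn : 0 < n) {s : ℝ} (hsn : s < n)
    (P : PotentialConstants) :
    ∃ κ, 0 < κ ∧ ∃ φ : 𝓢(Euc n, ℂ), ∀ G : Euc n → ℝ, IsRieszType n s P G → ∀ ρ : ℝ, 0 < ρ →
      κ * ρ ^ (-s) ≤ ‖∫ w, (G (ρ • w) : ℂ) * 𝓕 (φ : Euc n → ℂ) w‖ := by
  set e : Euc n := EuclideanSpace.single ⟨0, hn⟩ 1
  have he : ‖(2 : ℝ) • e‖ = 2 := by simp [e, norm_smul]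
  -- A bump around a point of norm `2` lives where `1 ≤ ‖ξ‖ ≤ 3`. Dilated by `ρ`, it sees a
  -- transform of size at least `C₁ (ρ / 3) ^ (n - s)` on a set of volume of order `ρ ^ (-n)`.
  set χ : ContDiffBump ((2 : ℝ) • e) := ⟨1 / 2, 1, by norm_num, by norm_num⟩
  have hχ1 : ∀ ξ, χ ξ ≠ 0 → 1 ≤ ‖ξ‖ ∧ ‖ξ‖ ≤ 3 := by
    intro ξ hξ
    have h1 : ξ ∈ Function.support χ := hξ
    rw [χ.support_eq, Metric.mem_ball, dist_eq_norm] at h1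
    change _ < (1 : ℝ) at h1
    have h2 := norm_sub_norm_le ξ ((2 : ℝ) • e)
    have h3 := norm_sub_norm_le ((2 : ℝ) • e) ξ
    rw [norm_sub_rev] at h3
    rw [he] at h2 h3
    constructor <;> linarith
  have hχint : 0 < ∫ ξ, χ ξ := χ.integral_pos
  have hχs : HasCompactSupport (fun ξ => (χ ξ : ℂ)) :=
    χ.hasCompactSupport.comp_left (g := fun x : ℝ => (x : ℂ)) Complex.ofReal_zero
  have hχc : ContDiff ℝ ∞ (fun ξ => (χ ξ : ℂ)) :=
    Complex.ofRealCLM.contDiff.comp χ.contDiff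
  have hns : 0 < (n : ℝ) - s := sub_pos.2 hsn
  set κ : ℝ := P.C₁ / 3 ^ ((n : ℝ) - s) * ∫ ξ, χ ξ
  have hκ : 0 < κ := mul_pos (div_pos P.C₁_pos (by positivity)) hχint
  refine ⟨κ, hκ, hχs.toSchwartzMap hχc, fun G hG ρ hρ => ?_⟩
  obtain ⟨Ghat, hF, hGb⟩ := hG.fourier
  have hρs : HasCompactSupport (fun ξ : Euc n => (χ (ρ⁻¹⁻¹ • ξ) : ℂ)) := by
    rw [inv_inv]
    exact hχs.comp_smul hρ.ne'
  have hρc : ContDiff ℝ ∞ (fun ξ : Euc n => (χ (ρ⁻¹⁻¹ • ξ) : ℂ)) :=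
    hχc.comp (contDiff_const_smul _)
  have h0 : (0 : Euc n) ∉ tsupport (hρs.toSchwartzMap hρc) := by
    rw [notMem_tsupport_iff_eventuallyEq]
    filter_upwards [Metric.ball_mem_nhds (0 : Euc n) (inv_pos.2 hρ)] with ξ hξ
    by_contra hc
    have h1 : χ (ρ⁻¹⁻¹ • ξ) ≠ 0 := fun h => hc (by
      change ((χ (ρ⁻¹⁻¹ • ξ) : ℝ) : ℂ) = 0
      rw [h, Complex.ofReal_zero])
    have h2 := (hχ1 _ h1).1
    rw [inv_inv, norm_smul, Real.norm_of_nonneg hρ.le] at h2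
    rw [mem_ball_zero_iff] at hξ
    have : ρ * ‖ξ‖ < ρ * ρ⁻¹ := by gcongr
    rw [mul_inv_cancel₀ hρ.ne'] at this
    linarith
  have key := hF.2 _ h0
  have hfour : ∀ X, 𝓕 ((hρs.toSchwartzMap hρc : 𝓢(Euc n, ℂ)) : Euc n → ℂ) X =
      ((ρ⁻¹ : ℝ) : ℂ) ^ n * 𝓕 ((hχs.toSchwartzMap hχc : 𝓢(Euc n, ℂ)) : Euc n → ℂ) (ρ⁻¹ • X) :=
    fun X => fourier_comp_inv_smul (inv_pos.2 hρ) (fun ξ => (χ ξ : ℂ)) X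
  have hleft : ∫ X, (G X : ℂ) * 𝓕 ((hρs.toSchwartzMap hρc : 𝓢(Euc n, ℂ)) : Euc n → ℂ) X =
      ∫ w, (G (ρ • w) : ℂ) * 𝓕 ((hχs.toSchwartzMap hχc : 𝓢(Euc n, ℂ)) : Euc n → ℂ) w := by
    have h := Measure.integral_comp_inv_smul volume (fun w : Euc n =>
      (G (ρ • w) : ℂ) * 𝓕 ((hχs.toSchwartzMap hχc : 𝓢(Euc n, ℂ)) : Euc n → ℂ) w) ρ
    simp only [finrank_euclideanSpace, Fintype.card_fin, abs_of_pos (pow_pos hρ n),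
      smul_inv_smul₀ hρ.ne', Complex.real_smul] at h
    simp only [hfour, ← mul_assoc, mul_comm _ (((ρ⁻¹ : ℝ) : ℂ) ^ n)]
    simp only [mul_assoc]
    rw [integral_const_mul, h, ← mul_assoc]
    push_cast
    rw [← mul_pow, inv_mul_cancel₀ (by exact_mod_cast hρ.ne'), one_pow, one_mul]
  have hright : ∫ Ξ, (Ghat Ξ : ℂ) * (hρs.toSchwartzMap hρc) Ξ =
      ((∫ Ξ, Ghat Ξ * χ (ρ • Ξ) : ℝ) : ℂ) := by
    rw [← integral_complex_ofReal]
    refine integral_congr_ae (Eventually.of_forall fun Ξ => ?_)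
    change (Ghat Ξ : ℂ) * (χ (ρ⁻¹⁻¹ • Ξ) : ℂ) = _
    rw [inv_inv]; push_cast; rfl
  have hsup : ∀ Ξ : Euc n, χ (ρ • Ξ) ≠ 0 → 1 ≤ ρ * ‖Ξ‖ ∧ ρ * ‖Ξ‖ ≤ 3 := fun Ξ hΞ => by
    have := hχ1 _ hΞ
    rwa [norm_smul, Real.norm_of_nonneg hρ.le] at this
  have hχi : Integrable (fun Ξ : Euc n => χ (ρ • Ξ)) := χ.integrable.comp_smul hρ.ne'
  have hpow : ∀ Ξ : Euc n, Ξ ≠ 0 → (1 / ‖Ξ‖ ^ ((n : ℝ) - s)) =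
      ρ ^ ((n : ℝ) - s) / (ρ * ‖Ξ‖) ^ ((n : ℝ) - s) := fun Ξ hΞ => by
    have := Real.rpow_pos_of_pos hρ ((n : ℝ) - s)
    rw [Real.mul_rpow hρ.le (norm_nonneg _)]
    field_simp
  have hne : ∀ Ξ : Euc n, χ (ρ • Ξ) ≠ 0 → Ξ ≠ 0 := fun Ξ hΞ h => by
    have := (hsup Ξ hΞ).1
    rw [h, norm_zero, mul_zero] at this
    linarith
  have hlow : ∀ Ξ : Euc n, P.C₁ / 3 ^ ((n : ℝ) - s) * ρ ^ ((n : ℝ) - s) * χ (ρ • Ξ) ≤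
      Ghat Ξ * χ (ρ • Ξ) := fun Ξ => by
    by_cases h : χ (ρ • Ξ) = 0
    · simp [h]
    have h1 := (hGb Ξ (hne Ξ h)).1
    have h2 := (hsup Ξ h)
    refine mul_le_mul_of_nonneg_right (le_trans ?_ h1) χ.nonneg
    rw [div_eq_mul_one_div P.C₁ (‖Ξ‖ ^ _), hpow Ξ (hne Ξ h), mul_div_assoc', div_mul_eq_mul_div]
    have := P.C₁_pos
    have : 0 < ρ * ‖Ξ‖ := by linarith
    gcongr
    exact h2.2
  have hint : Integrable (fun Ξ => Ghat Ξ * χ (ρ • Ξ)) := by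
    refine (hχi.const_mul (|P.C₂| * ρ ^ ((n : ℝ) - s))).mono'
      ((aestronglyMeasurable_of_locallyIntegrableOn_compl hn hF.1).mul hχi.1)
      (Eventually.of_forall fun Ξ => ?_)
    by_cases h : χ (ρ • Ξ) = 0
    · simp [h]
    have h1 := hGb Ξ (hne Ξ h)
    have h2 := (hsup Ξ h)
    have h3 : 0 ≤ Ghat Ξ := le_trans (div_nonneg P.C₁_pos.le (by positivity)) h1.1
    rw [norm_mul, Real.norm_of_nonneg h3, Real.norm_of_nonneg χ.nonneg]
    have h4 : 0 ≤ χ (ρ • Ξ) := χ.nonneg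
    gcongr
    refine h1.2.trans ?_
    rw [div_eq_mul_one_div P.C₂ (‖Ξ‖ ^ _), hpow Ξ (hne Ξ h)]
    have h5 : 0 ≤ ρ ^ ((n : ℝ) - s) := by positivity
    have h6 := Real.one_le_rpow h2.1 hns.le
    calc _ ≤ |P.C₂| * (ρ ^ ((n : ℝ) - s) / (ρ * ‖Ξ‖) ^ ((n : ℝ) - s)) := by
          gcongr; exact le_abs_self _
      _ ≤ _ := by gcongr; exact div_le_self h5 h6
  rw [← hleft, key, hright, Complex.norm_real]
  refine le_trans ?_ (le_abs_self _)
  refine le_trans (le_of_eq ?_) (integral_mono (hχi.const_mul _) hint hlow)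
  rw [integral_const_mul, Measure.integral_comp_smul]
  simp only [finrank_euclideanSpace, Fintype.card_fin, abs_of_pos (inv_pos.2 (pow_pos hρ n)),
    smul_eq_mul, κ]
  have : ρ ^ (-s) = ρ ^ ((n : ℝ) - s) * (ρ ^ n)⁻¹ := by
    rw [← Real.rpow_natCast, ← Real.rpow_neg hρ.le, ← Real.rpow_add hρ]
    congr 1; ring
  rw [this]; ring

/-- A nonvanishing lower bound over scales forces the potential to be large somewhere in an
annulus. -/
lemma exists_annulus_lower_bound {n : ℕ} (hn : 0 < n) {s : ℝ} (hs : 0 < s) (hsn : s < n)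
    (P : PotentialConstants) :
    ∃ q : ℝ, 1 ≤ q ∧ ∀ G : Euc n → ℝ, IsRieszType n s P G → ∀ ρ : ℝ, 0 < ρ →
      ∃ w : Euc n, 1 / q ≤ ‖w‖ ∧ ‖w‖ ≤ q ∧ ρ ^ (-s) / q ≤ |G (ρ • w)| := by
  obtain ⟨κ, hκ, φ, hφ⟩ := exists_scaled_test_lower_bound hn hsn P
  set u : Euc n → ℝ := fun w => ‖𝓕 (φ : Euc n → ℂ) w‖
  have hu : Integrable u := (integrable_fourier_schwartz φ).norm
  have hu0 : ∀ w, 0 ≤ u w := fun w => norm_nonneg _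
  have huM : ∃ M, ∀ w, u w ≤ M := by
    refine ⟨∫ v, ‖φ v‖, fun w => ?_⟩
    exact VectorFourier.norm_fourierIntegral_le_integral_norm _ _ _ _ _
  obtain ⟨M, hM⟩ := huM
  obtain ⟨V, -, hV⟩ := exists_integral_mul_shift_rpow_le hn hs.le hsn
  have hui : Integrable (fun w => u w * ‖w‖ ^ (-s)) := by
    have := (hV u M hu hu0 hM 0 1 (by simp)).1
    simpa using this
  set q : ℕ → ℝ := fun j => (j : ℝ) + 1
  have hq : ∀ j, 1 ≤ q j := fun j => by simp [q]
  set A : ℕ → Set (Euc n) := fun j => {w | 1 / q j ≤ ‖w‖ ∧ ‖w‖ ≤ q j}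
  have hAm : ∀ j, MeasurableSet (A j) := fun j =>
    (measurableSet_le measurable_const measurable_norm).inter
      (measurableSet_le measurable_norm measurable_const)
  classical
  -- If the claim failed with the constant `q j`, this would bound `ρ ^ s |G (ρ • w)|` for almost
  -- every `w`. It depends on neither `G` nor `ρ`, and its weighted integral tends to zero, so for
  -- some `j` it falls below `κ`.
  set h : ℕ → Euc n → ℝ := fun j w => if w ∈ A j then 1 / q j else |P.Cder 0| * ‖w‖ ^ (-s)
  have hh0 : ∀ j w, 0 ≤ h j w := fun j w => by
    have := hq j
    simp only [h]; split_ifs <;> positivity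
  have hhb : ∀ j w, h j w ≤ 1 + |P.Cder 0| * ‖w‖ ^ (-s) := fun j w => by
    have h1 : 0 ≤ |P.Cder 0| * ‖w‖ ^ (-s) := by positivity
    simp only [h]; split_ifs
    · have : 1 / q j ≤ 1 := by
        rw [div_le_one (by linarith [hq j])]; exact hq j
      linarith
    · linarith
  have hdom : Integrable (fun w => u w + |P.Cder 0| * (u w * ‖w‖ ^ (-s))) :=
    hu.add (hui.const_mul _)
  have hhm : ∀ j, AEStronglyMeasurable (fun w => h j w * u w) := fun j => by
    refine AEStronglyMeasurable.mul (Measurable.aestronglyMeasurable ?_) hu.1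
    exact Measurable.ite (hAm j) measurable_const
      (measurable_const.mul (measurable_norm.pow_const _))
  have hhd : ∀ j w, ‖h j w * u w‖ ≤ u w + |P.Cder 0| * (u w * ‖w‖ ^ (-s)) := fun j w => by
    rw [norm_mul, Real.norm_of_nonneg (hh0 j w), Real.norm_of_nonneg (hu0 w)]
    nlinarith [hhb j w, hu0 w]
  have hlim : Tendsto (fun j => ∫ w, h j w * u w) atTop (𝓝 (∫ _ : Euc n, (0 : ℝ))) := by
    refine tendsto_integral_of_dominated_convergence _ hhm hdom
      (fun j => Eventually.of_forall (hhd j)) ?_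
    have hne : ∀ᵐ z : Euc n, z ≠ 0 := by
      simpa using ae_add_smul_ne_zero hn (0 : Euc n) one_ne_zero
    filter_upwards [hne] with w hw
    have hqt : Tendsto q atTop atTop :=
      tendsto_atTop_add_const_right _ _ tendsto_natCast_atTop_atTop
    have hqi : Tendsto (fun j => 1 / q j) atTop (𝓝 0) := by
      simp only [one_div]
      exact hqt.inv_tendsto_atTop
    have h1 : Tendsto (fun j => 1 / q j * u w) atTop (𝓝 0) := by
      simpa using hqi.mul_const (u w)
    refine h1.congr' ?_
    filter_upwards [hqt.eventually_ge_atTop ‖w‖,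
      hqi.eventually_le_const (norm_pos_iff.2 hw)] with j hj1 hj2
    have : w ∈ A j := ⟨hj2, hj1⟩
    simp only [h, if_pos this]
  rw [integral_zero] at hlim
  obtain ⟨j, hj⟩ := (hlim.eventually_lt_const hκ).exists
  refine ⟨q j, hq j, fun G hG ρ hρ => ?_⟩
  by_contra hcon
  push Not at hcon
  have hρs := Real.rpow_pos_of_pos hρ (-s)
  have hne : ∀ᵐ z : Euc n, z ≠ 0 := by
    simpa using ae_add_smul_ne_zero hn (0 : Euc n) one_ne_zero
  have hint : Integrable (fun w => h j w * u w) := hdom.mono' (hhm j)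
    (Eventually.of_forall (hhd j))
  have hle : ‖∫ w, (G (ρ • w) : ℂ) * 𝓕 (φ : Euc n → ℂ) w‖ ≤
      ∫ w, ρ ^ (-s) * (h j w * u w) := by
    refine norm_integral_le_of_norm_le (hint.const_mul _) ?_
    filter_upwards [hne] with w hw
    rw [norm_mul, Complex.norm_real, ← mul_assoc]
    refine mul_le_mul_of_nonneg_right ?_ (hu0 w)
    by_cases hA : w ∈ A j
    · have := hcon w hA.1 hA.2
      simp only [h, if_pos hA, mul_one_div]
      exact this.le
    · have := hG.abs_le_of_pos hs (smul_ne_zero hρ.ne' hw)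
      simp only [h, if_neg hA]
      rw [norm_smul, Real.norm_of_nonneg hρ.le, Real.mul_rpow hρ.le (norm_nonneg _)] at this
      refine this.trans ?_
      calc P.Cder 0 * (ρ ^ (-s) * ‖w‖ ^ (-s)) ≤ |P.Cder 0| * (ρ ^ (-s) * ‖w‖ ^ (-s)) := by
            gcongr; exact le_abs_self _
        _ = _ := by ring
  have h1 := (hφ G hG ρ hρ).trans hle
  rw [integral_const_mul] at h1
  nlinarith

/-- For `s > 0`, a Riesz-type potential is bounded below by a multiple of `‖X‖ ^ (-s)` near the
origin. -/
lemma exists_riesz_lower_bound {n : ℕ} (hn : 0 < n) {s : ℝ} (hs : 0 < s) (hsn : s < n)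
    (P : PotentialConstants) :
    ∃ c, 0 < c ∧ ∃ θ, 0 < θ ∧ θ ≤ 1 ∧ ∀ G : Euc n → ℝ, IsRieszType n s P G → ∀ X, X ≠ 0 →
      ‖X‖ ≤ θ * P.r₀ → c * ‖X‖ ^ (-s) ≤ G X := by
  obtain ⟨q, hq, hw⟩ := exists_annulus_lower_bound hn hs hsn P
  have hq0 : 0 < q := by linarith
  refine ⟨(2 * q) ^ (-s) / q, by positivity, 1 / (4 * q ^ 2), by positivity, ?_,
    fun G hG X hX hXr => ?_⟩
  · rw [div_le_one (by positivity)]; nlinarith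
  have hX0 := norm_pos_iff.2 hX
  -- This scale puts the point `Y` at distance between `2 ‖X‖` and `2 q ^ 2 ‖X‖ ≤ r₀ / 2`, so that
  -- doubling transfers the lower bound from `Y` to `X`.
  obtain ⟨w, hw1, hw2, hw3⟩ := hw G hG (2 * q * ‖X‖) (by positivity)
  set Y := (2 * q * ‖X‖) • w
  have hYn : ‖Y‖ = 2 * q * ‖X‖ * ‖w‖ := by
    rw [norm_smul, Real.norm_of_nonneg (by positivity)]
  have hr0 := P.r₀_pos
  have hY1 : 2 * ‖X‖ ≤ ‖Y‖ := by
    rw [hYn]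
    calc 2 * ‖X‖ = 2 * q * ‖X‖ * (1 / q) := by field_simp
      _ ≤ _ := by gcongr
  have hY2 : ‖Y‖ < P.r₀ := by
    rw [hYn]
    calc 2 * q * ‖X‖ * ‖w‖ ≤ 2 * q * (1 / (4 * q ^ 2) * P.r₀) * q := by gcongr
      _ = P.r₀ / 2 := by field_simp; ring
      _ < P.r₀ := by linarith
  have hXb : ‖X‖ < P.r₀ := by linarith
  have hY0 : Y ≠ 0 := norm_pos_iff.1 (by linarith)
  have h1 := hG.doubling_pos hs X (by simpa using hXb) Y (by simpa using hY2) hX hY0 hY1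
  have h2 := hG.nonneg hn hX hXb
  rw [abs_of_nonneg (hG.nonneg hn hY0 hY2), Real.mul_rpow (by positivity) hX0.le] at hw3
  have h3 : P.cs * G X ≤ G X := mul_le_of_le_one_left h2 P.cs_lt_one.le
  calc _ = (2 * q) ^ (-s) * ‖X‖ ^ (-s) / q := by ring
    _ ≤ G Y := hw3
    _ ≤ _ := by linarith

/-! ### Regular and local parts at a single scale -/

lemma one_le_two_pow_mul_inv {y : ℝ} (A : ℕ) (hy0 : 0 ≤ y) (hy : y ≤ 1) :
    1 ≤ 2 ^ A * ((1 + y) ^ A)⁻¹ := by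
  rw [← div_eq_mul_inv, one_le_div (by positivity)]
  gcongr; linarith

lemma inv_pow_le_two_pow_mul_inv {y : ℝ} (A : ℕ) (hy : 1 ≤ y) :
    (y ^ A)⁻¹ ≤ 2 ^ A * ((1 + y) ^ A)⁻¹ := by
  rw [← div_eq_mul_inv, inv_eq_one_div, div_le_div_iff₀ (by positivity) (by positivity), one_mul,
    ← mul_pow]
  gcongr; linarith

lemma inv_one_add_pow_anti {y : ℝ} {p q : ℕ} (hy : 0 ≤ y) (hpq : p ≤ q) :
    ((1 + y) ^ q)⁻¹ ≤ ((1 + y) ^ p)⁻¹ :=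
  inv_anti₀ (by positivity) (pow_le_pow_right₀ (by linarith) hpq)

lemma singExp_nonneg {s : ℝ} (hs : 0 ≤ s) : 0 ≤ singExp s := by
  unfold singExp; split_ifs <;> linarith

lemma singExp_lt {s : ℝ} {n : ℕ} (hn : 0 < n) (hsn : s < n) : singExp s < n := by
  unfold singExp; split_ifs
  · have : (1 : ℝ) ≤ n := by exact_mod_cast hn
    linarith
  · exact hsn

/-- The part of `G` that is regularized at scale `r`. -/
noncomputable def smoothPart {n : ℕ} (k : ℕ) (G : Euc n → ℝ) (r : ℝ) (X : Euc n) : ℝ :=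
  -∑ i ∈ Finset.range k, cdCoeff k i * smear G (((i : ℝ) + 1) * r) X

lemma smearRem_add_smoothPart {n : ℕ} (k : ℕ) (G : Euc n → ℝ) (r : ℝ) (X : Euc n) :
    smearRem k G r X + smoothPart k G r X = G X := by
  unfold smearRem smoothPart; ring

lemma exists_abs_smoothPart_sub_le {n : ℕ} (hn : 0 < n) {a : ℝ} (ha : 0 ≤ a) (han : a < n)
    {k : ℕ} (hk : 0 < k) :
    ∃ D, 0 ≤ D ∧ ∀ {s C ρ : ℝ} {K : ℕ} {G : Euc n → ℝ} {b : ℝ → ℝ}, ScaleControl s a C ρ K G b →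
      ∀ r, 0 < r → ∀ X, |smoothPart k G r X - b r| ≤ C * D * r ^ (-s) * (1 + ‖X‖ / r) := by
  obtain ⟨D, hD, h⟩ := ScaleControl.exists_smear_sub_le hn ha han
  refine ⟨D * (2 + k) * ∑ i ∈ Finset.range k, |cdCoeff k i|, by positivity,
    fun {s C ρ K G b} hG r hr X => ?_⟩
  have hC := hG.const_nonneg hn
  have h0 := one_add_sum_cdCoeff hk
  have e : smoothPart k G r X - b r = -∑ i ∈ Finset.range k,
      cdCoeff k i * (smear G (((i : ℝ) + 1) * r) X - b r) := by
    simp only [smoothPart, mul_sub, Finset.sum_sub_distrib, ← Finset.sum_mul]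
    have : ∑ i ∈ Finset.range k, cdCoeff k i = -1 := by linarith
    rw [this]; ring
  rw [e, abs_neg]
  refine (Finset.abs_sum_le_sum_abs _ _).trans ?_
  have hX : 0 ≤ ‖X‖ / r := by positivity
  calc _ ≤ ∑ i ∈ Finset.range k, |cdCoeff k i| *
        (C * r ^ (-s) * (D * ((2 + k) * (1 + ‖X‖ / r)))) := by
        refine Finset.sum_le_sum fun i hi => ?_
        rw [abs_mul]
        have hi' : (i : ℝ) + 1 ≤ k := by exact_mod_cast Finset.mem_range.1 hi
        have habs : |(i : ℝ) + 1| = i + 1 := abs_of_pos (by positivity)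
        have h1 := (h hG r hr ((i : ℝ) + 1) (by rw [habs]; linarith [Nat.cast_nonneg (α := ℝ) i])
          X).2
        rw [habs] at h1
        refine mul_le_mul_of_nonneg_left (h1.trans ?_) (abs_nonneg _)
        gcongr
        have : 0 ≤ (1 + (k : ℝ)) * (‖X‖ / r) := by positivity
        nlinarith
    _ = _ := by rw [← Finset.sum_mul]; ring

/-- Bounds for the local part of a Riesz-type potential at a given scale. -/
lemma exists_smearRem_estimates {n : ℕ} (hn : 0 < n) {s : ℝ} (hs : 0 ≤ s) (hsn : s < n)
    (P : PotentialConstants) :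
    ∃ C, 0 < C ∧ ∀ G : Euc n → ℝ, IsRieszType n s P G → ∀ r, 0 < r → r < P.r₀ / 8 →
      (∀ X, X ≠ 0 → -(C * r ^ (-s) * ((1 + ‖X‖ / r) ^ (3 * n + 2))⁻¹) ≤
        smearRem (2 * n + 1) G r X) ∧
      (0 < s → ∀ X, X ≠ 0 → ‖X‖ ≤ r → G X - C * r ^ (-s) * ((1 + ‖X‖ / r) ^ (3 * n + 2))⁻¹ ≤
        smearRem (2 * n + 1) G r X) ∧
      (∀ X, X ≠ 0 → |smearRem (2 * n + 1) G r X| ≤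
        C * r ^ (-s) * (((‖X‖ / r) ^ (-singExp s) + 1) * ((1 + ‖X‖ / r) ^ (n + 1))⁻¹)) ∧
      |smoothPart (2 * n + 1) G r 0| ≤ C * (r ^ (-s) + if s = 0 then |Real.log r| else 0) ∧
      ∃ B, ∀ X, |smoothPart (2 * n + 1) G r X| ≤ B * (1 + ‖X‖) := by
  have ha := singExp_nonneg hs
  have han := singExp_lt hn hsn
  obtain ⟨C, hC, hsc⟩ := exists_scaleControl hn hs P (K := 2 * (2 * n + 1)) (by omega)
  -- Differences of order `2 k = 4 n + 2` allow the decay rate `3 n + 2`, the rate of the lower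
  -- bound for `tailKernel`.
  obtain ⟨D, hD, hrem⟩ := ScaleControl.exists_smearRem_bound hn ha han hs (k := 2 * n + 1)
    (A := 3 * n + 2) (by omega) (by omega)
  obtain ⟨D', hD', hsm⟩ := exists_abs_smoothPart_sub_le hn ha han (k := 2 * n + 1) (by omega)
  set A := 3 * n + 2
  refine ⟨2 ^ A * (C + C * D) + C * D' + C, by positivity, fun G hG r hr hrρ => ?_⟩
  obtain ⟨b, hb, hb0, hbl⟩ := hsc G hG
  have hrs := Real.rpow_pos_of_pos hr (-s)
  have hCC : 2 ^ A * (C + C * D) ≤ 2 ^ A * (C + C * D) + C * D' + C := by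
    have : 0 ≤ C * D' := by positivity
    linarith
  have hinner : ∀ X : Euc n, ‖X‖ ≤ r → (C + C * D) * r ^ (-s) ≤
      (2 ^ A * (C + C * D) + C * D' + C) * r ^ (-s) * ((1 + ‖X‖ / r) ^ A)⁻¹ := fun X hX => by
    have h1 := one_le_two_pow_mul_inv A (by positivity) ((div_le_one hr).2 hX)
    calc (C + C * D) * r ^ (-s) ≤
          (C + C * D) * r ^ (-s) * (2 ^ A * ((1 + ‖X‖ / r) ^ A)⁻¹) :=
          le_mul_of_one_le_right (by positivity) h1
      _ = 2 ^ A * (C + C * D) * r ^ (-s) * ((1 + ‖X‖ / r) ^ A)⁻¹ := by ring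
      _ ≤ _ := by gcongr
  have houter : ∀ X : Euc n, X ≠ 0 → r ≤ ‖X‖ → |smearRem (2 * n + 1) G r X| ≤
      (2 ^ A * (C + C * D) + C * D' + C) * r ^ (-s) * ((1 + ‖X‖ / r) ^ A)⁻¹ := fun X hX hXr => by
    have h1 := inv_pow_le_two_pow_mul_inv A ((one_le_div hr).2 hXr)
    calc _ ≤ C * D * r ^ (-s) * ((‖X‖ / r) ^ A)⁻¹ := (hrem hb r hr X hX).1 hXr
      _ ≤ (C + C * D) * r ^ (-s) * (2 ^ A * ((1 + ‖X‖ / r) ^ A)⁻¹) := by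
        gcongr; linarith
      _ = 2 ^ A * (C + C * D) * r ^ (-s) * ((1 + ‖X‖ / r) ^ A)⁻¹ := by ring
      _ ≤ _ := by gcongr
  refine ⟨fun X hX => ?_, fun hs0 X hX hXr => ?_, fun X hX => ?_, ?_, ?_⟩
  · rcases le_total ‖X‖ r with h | h
    · have h1 := abs_le.1 ((hrem hb r hr X hX).2 h)
      have h2 := hb.lower r hr hrρ X hX h
      have h3 := hinner X h
      linarith
    · exact (abs_le.1 (houter X hX h)).1
  · have h1 := abs_le.1 ((hrem hb r hr X hX).2 hXr)
    have h3 := hinner X hXr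
    rw [hb0 hs0] at h1
    have : 0 ≤ C * r ^ (-s) := by positivity
    linarith
  · have hy : 0 < ‖X‖ / r := div_pos (norm_pos_iff.2 hX) hr
    have hya := Real.rpow_nonneg hy.le (-singExp s)
    have hmono := inv_one_add_pow_anti hy.le (show n + 1 ≤ A by omega)
    rcases le_total ‖X‖ r with h | h
    · have h1 := (hrem hb r hr X hX).2 h
      have h2 := hb.osc r hr X hX
      have h3 := hinner X h
      have hy1 : ‖X‖ / r ≤ 1 := (div_le_one hr).2 h
      have h4 : |smearRem (2 * n + 1) G r X| ≤
          (C + C * D) * r ^ (-s) * ((‖X‖ / r) ^ (-singExp s) + 1) := by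
        have h5 := abs_sub_abs_le_abs_sub (smearRem (2 * n + 1) G r X) (G X - b r)
        have h6 : C * r ^ (-s) * ((‖X‖ / r) ^ (-singExp s) + ‖X‖ / r) ≤
            C * r ^ (-s) * ((‖X‖ / r) ^ (-singExp s) + 1) := by gcongr
        have h7 : C * D * r ^ (-s) ≤ C * D * r ^ (-s) * ((‖X‖ / r) ^ (-singExp s) + 1) :=
          le_mul_of_one_le_right (by positivity) (by linarith)
        linarith
      calc _ ≤ _ := h4
        _ ≤ (2 ^ A * (C + C * D) + C * D' + C) * r ^ (-s) * ((1 + ‖X‖ / r) ^ A)⁻¹ *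
            ((‖X‖ / r) ^ (-singExp s) + 1) := by gcongr
        _ ≤ (2 ^ A * (C + C * D) + C * D' + C) * r ^ (-s) * ((1 + ‖X‖ / r) ^ (n + 1))⁻¹ *
            ((‖X‖ / r) ^ (-singExp s) + 1) := by gcongr
        _ = _ := by ring
    · refine (houter X hX h).trans ?_
      have : ((1 + ‖X‖ / r) ^ A)⁻¹ ≤
          ((‖X‖ / r) ^ (-singExp s) + 1) * ((1 + ‖X‖ / r) ^ (n + 1))⁻¹ :=
        hmono.trans (le_mul_of_one_le_left (by positivity) (by linarith))
      gcongr
  · have h1 := hsm hb r hr 0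
    rw [norm_zero, zero_div, add_zero, mul_one] at h1
    have h2 := abs_sub_abs_le_abs_sub (smoothPart (2 * n + 1) G r 0) (b r)
    have h3 : |b r| ≤ C * (r ^ (-s) + if s = 0 then |Real.log r| else 0) := by
      rcases hs.eq_or_lt with rfl | hs0
      · simpa using hbl rfl r hr
      · rw [hb0 hs0, abs_zero, if_neg hs0.ne']; positivity
    have h4 : 0 ≤ (if s = 0 then |Real.log r| else 0) := by split_ifs <;> positivity
    have h5 : C * D' * r ^ (-s) ≤ C * D' * (r ^ (-s) + if s = 0 then |Real.log r| else 0) := by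
      gcongr; linarith
    have h6 : 0 ≤ 2 ^ A * (C + C * D) * (r ^ (-s) + if s = 0 then |Real.log r| else 0) := by
      positivity
    linarith
  · refine ⟨|b r| + C * D' * r ^ (-s) * (1 + 1 / r), fun X => ?_⟩
    have h1 := hsm hb r hr X
    have h2 := abs_sub_abs_le_abs_sub (smoothPart (2 * n + 1) G r X) (b r)
    have hX := norm_nonneg X
    have h3 : 1 + ‖X‖ / r ≤ (1 + 1 / r) * (1 + ‖X‖) := by
      have : 0 < 1 / r := by positivity
      rw [div_eq_mul_one_div]; nlinarith
    have h4 : C * D' * r ^ (-s) * (1 + ‖X‖ / r) ≤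
      C * D' * r ^ (-s) * ((1 + 1 / r) * (1 + ‖X‖)) := by gcongr
    nlinarith [mul_nonneg (abs_nonneg (b r)) hX]

/-- The Fourier multiplier of `smoothPart`. -/
noncomputable def smoothMult {n : ℕ} (k : ℕ) (ξ : Euc n) : ℝ :=
  -∑ i ∈ Finset.range k, cdCoeff k i * gauss (((i : ℝ) + 1) • ξ)

lemma continuous_smoothMult {n : ℕ} (k : ℕ) : Continuous (smoothMult k : Euc n → ℝ) := by
  unfold smoothMult
  have := continuous_gauss (n := n)
  fun_prop

/-! ### Averaging over dyadic scales, and positivity in Fourier space -/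

/-- The part of `G` that is localized below scale `ε`, averaged over dyadic scales and corrected
by a positive definite kernel. -/
noncomputable def shortPart {n : ℕ} (s c ε : ℝ) (L I : ℕ) (G : Euc n → ℝ) (X : Euc n) : ℝ :=
  ((L + I : ℕ) : ℝ)⁻¹ * (∑ j ∈ Finset.range (L + I), smearRem (2 * n + 1) G (ε / 2 ^ j) X +
    c * ∑ j ∈ Finset.range L, (ε / 2 ^ j) ^ (-s) * tailKernel ((ε / 2 ^ j)⁻¹ • X))

/-- The remainder `G - shortPart`, which is regular at the origin. -/
noncomputable def longPart {n : ℕ} (s c ε : ℝ) (L I : ℕ) (G : Euc n → ℝ) (X : Euc n) : ℝ :=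
  ((L + I : ℕ) : ℝ)⁻¹ * (∑ j ∈ Finset.range (L + I), smoothPart (2 * n + 1) G (ε / 2 ^ j) X -
    c * ∑ j ∈ Finset.range L, (ε / 2 ^ j) ^ (-s) * tailKernel ((ε / 2 ^ j)⁻¹ • X))

/-- The Fourier transform of `longPart` away from the origin. -/
noncomputable def longHat {n : ℕ} (s c ε : ℝ) (L I : ℕ) (Ghat : Euc n → ℝ) (ξ : Euc n) : ℝ :=
  ((L + I : ℕ) : ℝ)⁻¹ *
    (∑ j ∈ Finset.range (L + I), Ghat ξ * smoothMult (2 * n + 1) ((ε / 2 ^ j) • ξ) -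
    c * ∑ j ∈ Finset.range L, (ε / 2 ^ j) ^ (-s) *
      ((ε / 2 ^ j) ^ n * tailKernelHat ((ε / 2 ^ j) • ξ)))

lemma longPart_add_shortPart {n : ℕ} {s c ε : ℝ} {L I : ℕ} (hI : 0 < I) (G : Euc n → ℝ)
    (X : Euc n) : longPart s c ε L I G X + shortPart s c ε L I G X = G X := by
  have hJ : ((L + I : ℕ) : ℝ) ≠ 0 := by positivity
  unfold longPart shortPart
  rw [← mul_add, inv_mul_eq_iff_eq_mul₀ hJ]
  have h : ∑ j ∈ Finset.range (L + I), smoothPart (2 * n + 1) G (ε / 2 ^ j) X +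
      ∑ j ∈ Finset.range (L + I), smearRem (2 * n + 1) G (ε / 2 ^ j) X = (L + I : ℕ) * G X := by
    rw [← Finset.sum_add_distrib]
    simp only [add_comm (smoothPart _ _ _ _), smearRem_add_smoothPart, Finset.sum_const,
      Finset.card_range, nsmul_eq_mul]
  linarith

lemma measurable_smear {n : ℕ} {G : Euc n → ℝ} (hG : Measurable G) (t : ℝ) :
    Measurable (smear G t) := by
  have hm : Measurable (fun p : Euc n × Euc n => gauss p.2 * G (p.1 + t • p.2)) := by
    have := (continuous_gauss (n := n)).measurable
    fun_prop
  exact (hm.stronglyMeasurable.integral_prod_right (ν := volume)).measurable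

lemma measurable_tailKernel {n : ℕ} : Measurable (tailKernel : Euc n → ℝ) := by
  have hm : Measurable (fun p : Euc n × ℝ => p.2 ^ (3 * n + 1) * gauss (p.2 • p.1)) := by
    have := (continuous_gauss (n := n)).measurable
    fun_prop
  exact (hm.stronglyMeasurable.integral_prod_right
    (ν := volume.restrict (Set.Ioo (0 : ℝ) 1))).measurable

lemma measurable_smoothPart {n : ℕ} {G : Euc n → ℝ} (hG : Measurable G) (k : ℕ) (r : ℝ) :
    Measurable (smoothPart k G r) := by
  unfold smoothPart
  exact (Finset.measurable_sum _ fun i _ => (measurable_smear hG _).const_mul _).neg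

lemma measurable_longPart {n : ℕ} {s c ε : ℝ} {L I : ℕ} {G : Euc n → ℝ} (hG : Measurable G) :
    Measurable (longPart s c ε L I G) := by
  unfold longPart
  refine Measurable.const_mul (Measurable.sub ?_ (Measurable.const_mul ?_ _)) _
  · exact Finset.measurable_sum _ fun i _ => measurable_smoothPart hG _ _
  · exact Finset.measurable_sum _ fun i _ =>
      (measurable_tailKernel.comp (measurable_const_smul _)).const_mul _

lemma measurable_shortPart {n : ℕ} {s c ε : ℝ} {L I : ℕ} {G : Euc n → ℝ} (hI : 0 < I)
    (hG : Measurable G) : Measurable (shortPart s c ε L I G) := by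
  have : shortPart s c ε L I G = fun X => G X - longPart s c ε L I G X :=
    funext fun X => by
      rw [← longPart_add_shortPart (s := s) (c := c) (ε := ε) (L := L) hI G X]; ring
  rw [this]
  exact hG.sub (measurable_longPart hG)

lemma tailKernel_zero_sub {n : ℕ} {r : ℝ} (hr : 0 < r) (X : Euc n) :
    Integrable (fun ξ : Euc n => r ^ n * tailKernelHat (r • ξ) *
      (1 - Real.cos (2 * Real.pi * inner ℝ X ξ))) ∧
    tailKernel (0 : Euc n) - tailKernel (r⁻¹ • X) =
      ∫ ξ : Euc n, r ^ n * tailKernelHat (r • ξ) *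
        (1 - Real.cos (2 * Real.pi * inner ℝ X ξ)) := by
  have hi : Integrable (fun ξ : Euc n => r ^ n * tailKernelHat (r • ξ)) :=
    (integrable_tailKernelHat.comp_smul hr.ne').const_mul _
  have hic : Integrable (fun ξ : Euc n => r ^ n * tailKernelHat (r • ξ) *
      Real.cos (2 * Real.pi * inner ℝ X ξ)) := by
    refine hi.mul_bdd (c := 1) (Continuous.aestronglyMeasurable (by fun_prop))
      (Eventually.of_forall fun ξ => ?_)
    exact Real.abs_cos_le_one _
  have h1 := integral_tailKernelHat_smul_mul_cos hr X
  have h0 := integral_tailKernelHat_smul_mul_cos hr (0 : Euc n)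
  simp only [inner_zero_left, mul_zero, Real.cos_zero, mul_one, smul_zero] at h0
  simp only [mul_sub, mul_one]
  exact ⟨hi.sub hic, by rw [integral_sub hi hic, h0, h1]⟩

lemma ScaleControl.smoothPart_zero_sub {n : ℕ} {s a C ρ : ℝ} {K : ℕ} {G : Euc n → ℝ} {b : ℝ → ℝ}
    (hn : 0 < n) (ha : 0 ≤ a) (han : a < n) (hs : 0 ≤ s)
    (hsn : s ≤ n) (hG : ScaleControl s a C ρ K G b) {Ghat : Euc n → ℝ}
    (hF : HasFourierTransformOffZero G Ghat)
    {B : ℝ} (hB : ∀ ξ, ξ ≠ 0 → |Ghat ξ| ≤ B / ‖ξ‖ ^ ((n : ℝ) - s)) (k : ℕ) {r : ℝ} (hr : 0 < r)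
    (X : Euc n) :
    Integrable (fun ξ => Ghat ξ * smoothMult k (r • ξ) *
      (1 - Real.cos (2 * Real.pi * inner ℝ X ξ))) ∧
    smoothPart k G r 0 - smoothPart k G r X =
      ∫ ξ, Ghat ξ * smoothMult k (r • ξ) * (1 - Real.cos (2 * Real.pi * inner ℝ X ξ)) := by
  have h := fun i : ℕ => hG.smear_zero_sub_smear hn ha han hs hsn hF hB
    (t := ((i : ℝ) + 1) * r) (by positivity) X
  have e : ∀ ξ, Ghat ξ * smoothMult k (r • ξ) * (1 - Real.cos (2 * Real.pi * inner ℝ X ξ)) =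
      -∑ i ∈ Finset.range k, cdCoeff k i * (Ghat ξ * (gauss ((((i : ℝ) + 1) * r) • ξ) *
        (1 - Real.cos (2 * Real.pi * inner ℝ X ξ)))) := fun ξ => by
    simp only [smoothMult, smul_smul, mul_neg, neg_mul, Finset.mul_sum, Finset.sum_mul]
    congr 1
    refine Finset.sum_congr rfl fun i _ => by ring
  have hi : ∀ i ∈ Finset.range k, Integrable (fun ξ => cdCoeff k i *
      (Ghat ξ * (gauss ((((i : ℝ) + 1) * r) • ξ) *
        (1 - Real.cos (2 * Real.pi * inner ℝ X ξ))))) := fun i _ => (h i).1.const_mul _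
  simp only [e]
  refine ⟨(integrable_finsetSum _ hi).neg, ?_⟩
  rw [integral_neg, integral_finsetSum _ hi]
  have h2 : ∀ i : ℕ, ∫ ξ, cdCoeff k i * (Ghat ξ * (gauss ((((i : ℝ) + 1) * r) • ξ) *
      (1 - Real.cos (2 * Real.pi * inner ℝ X ξ)))) = cdCoeff k i *
      smear G (((i : ℝ) + 1) * r) 0 - cdCoeff k i * smear G (((i : ℝ) + 1) * r) X := fun i => by
    rw [integral_const_mul, ← (h i).2, mul_sub]
  simp only [h2, smoothPart, Finset.sum_sub_distrib]
  ring

/-- By linearity from the representations of `smoothPart` and `tailKernel` at each scale. It is the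
representation needed for conditional positive definiteness once `longHat` is known to be
nonnegative. -/
lemma ScaleControl.longPart_zero_sub {n : ℕ} {s a C ρ : ℝ} {K : ℕ} {G : Euc n → ℝ} {b : ℝ → ℝ}
    (hn : 0 < n) (ha : 0 ≤ a) (han : a < n) (hs : 0 ≤ s)
    (hsn : s ≤ n) (hG : ScaleControl s a C ρ K G b) {Ghat : Euc n → ℝ}
    (hF : HasFourierTransformOffZero G Ghat)
    {B : ℝ} (hB : ∀ ξ, ξ ≠ 0 → |Ghat ξ| ≤ B / ‖ξ‖ ^ ((n : ℝ) - s)) (c : ℝ) {ε : ℝ} (hε : 0 < ε)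
    (L I : ℕ) (X : Euc n) :
    Integrable (fun ξ => longHat s c ε L I Ghat ξ *
      (1 - Real.cos (2 * Real.pi * inner ℝ X ξ))) ∧
    longPart s c ε L I G 0 - longPart s c ε L I G X =
      ∫ ξ, longHat s c ε L I Ghat ξ * (1 - Real.cos (2 * Real.pi * inner ℝ X ξ)) := by
  have hr : ∀ j : ℕ, 0 < ε / 2 ^ j := fun j => by positivity
  have h1 := fun j : ℕ => hG.smoothPart_zero_sub hn ha han hs hsn hF hB (2 * n + 1) (hr j) X
  have h2 := fun j : ℕ => tailKernel_zero_sub (n := n) (hr j) X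
  have e : ∀ ξ, longHat s c ε L I Ghat ξ * (1 - Real.cos (2 * Real.pi * inner ℝ X ξ)) =
      ((L + I : ℕ) : ℝ)⁻¹ * (∑ j ∈ Finset.range (L + I), Ghat ξ *
        smoothMult (2 * n + 1) ((ε / 2 ^ j) • ξ) * (1 - Real.cos (2 * Real.pi * inner ℝ X ξ)) -
      c * ∑ j ∈ Finset.range L, (ε / 2 ^ j) ^ (-s) *
        ((ε / 2 ^ j) ^ n * tailKernelHat ((ε / 2 ^ j) • ξ) *
          (1 - Real.cos (2 * Real.pi * inner ℝ X ξ)))) := fun ξ => by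
    simp only [longHat, mul_assoc, sub_mul, Finset.sum_mul]
  simp only [e]
  have hi1 := integrable_finsetSum (Finset.range (L + I)) fun j _ => (h1 j).1
  have hi2 := (integrable_finsetSum (Finset.range L) fun j _ =>
    (h2 j).1.const_mul ((ε / 2 ^ j) ^ (-s))).const_mul c
  refine ⟨(hi1.sub hi2).const_mul _, ?_⟩
  rw [integral_const_mul, integral_sub hi1 hi2, integral_const_mul,
    integral_finsetSum _ fun j _ => (h1 j).1,
    integral_finsetSum _ fun j _ => (h2 j).1.const_mul ((ε / 2 ^ j) ^ (-s))]
  have e1 : ∀ j : ℕ, ∫ ξ, Ghat ξ * smoothMult (2 * n + 1) ((ε / 2 ^ j) • ξ) *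
      (1 - Real.cos (2 * Real.pi * inner ℝ X ξ)) = smoothPart (2 * n + 1) G (ε / 2 ^ j) 0 -
      smoothPart (2 * n + 1) G (ε / 2 ^ j) X := fun j => (h1 j).2.symm
  have e2 : ∀ j : ℕ, ∫ ξ : Euc n, (ε / 2 ^ j) ^ (-s) * ((ε / 2 ^ j) ^ n *
      tailKernelHat ((ε / 2 ^ j) • ξ) * (1 - Real.cos (2 * Real.pi * inner ℝ X ξ))) =
      (ε / 2 ^ j) ^ (-s) * tailKernel (0 : Euc n) -
      (ε / 2 ^ j) ^ (-s) * tailKernel ((ε / 2 ^ j)⁻¹ • X) := fun j => by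
    rw [integral_const_mul, ← (h2 j).2, mul_sub]
  simp only [e1, e2, longPart, Finset.sum_sub_distrib, smul_zero]
  ring

/-- With enough additional scales, `longHat` is nonnegative. -/
lemma exists_longHat_nonneg {n : ℕ} {s : ℝ} (hsn : s < n) {c C₁ : ℝ} (hc : 0 < c) (hC₁ : 0 < C₁) :
    ∃ I : ℕ, 0 < I ∧ ∀ (L : ℕ) (ε : ℝ), 0 < ε → ∀ (Ghat : Euc n → ℝ) (ξ : Euc n), ξ ≠ 0 →
      C₁ / ‖ξ‖ ^ ((n : ℝ) - s) ≤ Ghat ξ → 0 ≤ longHat s c ε L I Ghat ξ := by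
  obtain ⟨cψ, hcψ, hψ⟩ := exists_le_neg_sum_cdCoeff_mul_gauss (n := n) (k := 2 * n + 1) (by omega)
  have hns : 0 < (n : ℝ) - s := sub_pos.2 hsn
  obtain ⟨Cd, hCd, hdy⟩ := exists_dyadic_sum_le hns
  -- The total correction costs at most `c Cd` and each extra scale supplies at least `C₁ cψ`, in
  -- units of the Gaussian at scale `ε / 2 ^ L`. Hence `I` is independent of `L`.
  obtain ⟨I, hI⟩ := exists_nat_gt (c * Cd / (C₁ * cψ))
  have hI0 : (0 : ℝ) < I := lt_of_le_of_lt (by positivity) hI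
  refine ⟨I, by exact_mod_cast hI0, fun L ε hε Ghat ξ hξ hG => ?_⟩
  have hξ0 := norm_pos_iff.2 hξ
  have hpow : 0 < ‖ξ‖ ^ ((n : ℝ) - s) := by positivity
  refine mul_nonneg (by positivity) (sub_nonneg.2 ?_)
  have hr : ∀ j : ℕ, 0 < ε / 2 ^ j := fun j => by positivity
  set γ : ℕ → ℝ := fun j => gauss ((ε / 2 ^ j) • ξ)
  have hγ0 : ∀ j, 0 < γ j := fun j => gauss_pos _
  have hlow : ∀ j, C₁ * cψ / ‖ξ‖ ^ ((n : ℝ) - s) * γ j ≤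
      Ghat ξ * smoothMult (2 * n + 1) ((ε / 2 ^ j) • ξ) := fun j => by
    have h1 : cψ * γ j ≤ smoothMult (2 * n + 1) ((ε / 2 ^ j) • ξ) := hψ _
    have h2 : 0 < cψ * γ j := mul_pos hcψ (hγ0 j)
    calc _ = C₁ / ‖ξ‖ ^ ((n : ℝ) - s) * (cψ * γ j) := by ring
      _ ≤ _ := mul_le_mul hG h1 h2.le (le_trans (by positivity) hG)
  have hup : ∀ j, (ε / 2 ^ j) ^ (-s) * ((ε / 2 ^ j) ^ n * tailKernelHat ((ε / 2 ^ j) • ξ)) ≤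
      (‖ξ‖ ^ ((n : ℝ) - s))⁻¹ * ((ε / 2 ^ j * ‖ξ‖) ^ ((n : ℝ) - s) * γ j) := fun j => by
    have e : (ε / 2 ^ j) ^ (-s) * (ε / 2 ^ j) ^ n =
        (‖ξ‖ ^ ((n : ℝ) - s))⁻¹ * (ε / 2 ^ j * ‖ξ‖) ^ ((n : ℝ) - s) := by
      rw [Real.mul_rpow (hr j).le hξ0.le, mul_comm _ (‖ξ‖ ^ _), inv_mul_cancel_left₀ hpow.ne',
        ← Real.rpow_natCast (ε / 2 ^ j) n, ← Real.rpow_add (hr j)]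
      congr 1; ring
    rw [← mul_assoc, ← mul_assoc, e]
    gcongr
    exact tailKernelHat_le _
  have hgauss : ∀ j, γ j = Real.exp (-(Real.pi * (ε / 2 ^ j * ‖ξ‖) ^ 2)) := fun j => by
    simp only [γ, gauss, norm_smul, Real.norm_of_nonneg (hr j).le]
  -- Read from the finest scale upwards: the corrected scales are `2 ^ (i + 1)` times `ε / 2 ^ L`,
  -- so they start one step above the first uncorrected scale.
  have hsum : ∑ j ∈ Finset.range L, (ε / 2 ^ j * ‖ξ‖) ^ ((n : ℝ) - s) * γ j ≤ Cd * γ L := by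
    rw [← Finset.sum_range_reflect, hgauss L]
    refine le_trans (le_of_eq (Finset.sum_congr rfl fun i hi => ?_))
      (hdy L (ε / 2 ^ L * ‖ξ‖) (by positivity))
    have hi' := Finset.mem_range.1 hi
    have e : ε / 2 ^ (L - 1 - i) * ‖ξ‖ = 2 ^ (i + 1) * (ε / 2 ^ L * ‖ξ‖) := by
      have : (2 : ℝ) ^ L = 2 ^ (i + 1) * 2 ^ (L - 1 - i) := by
        rw [← pow_add]; congr 1; omega
      rw [this]; field_simp
    rw [hgauss, e]
  -- Finer scales have wider Gaussians in frequency, so each of the `I` extra scales contributes at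
  -- least as much as scale `L`.
  have hγL : ∀ i, γ L ≤ γ (L + i) := fun i => by
    refine gauss_mono ?_
    rw [norm_smul, norm_smul, Real.norm_of_nonneg (hr _).le, Real.norm_of_nonneg (hr _).le]
    gcongr
    · norm_num
    · omega
  have hsum2 : I * γ L ≤ ∑ j ∈ Finset.range (L + I), γ j := by
    rw [Finset.sum_range_add]
    have h1 : 0 ≤ ∑ j ∈ Finset.range L, γ j := Finset.sum_nonneg fun j _ => (hγ0 j).le
    have h2 : ∑ i ∈ Finset.range I, γ L ≤ ∑ i ∈ Finset.range I, γ (L + i) :=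
      Finset.sum_le_sum fun i _ => hγL i
    simp only [Finset.sum_const, Finset.card_range, nsmul_eq_mul] at h2
    linarith
  calc _ ≤ c * ∑ j ∈ Finset.range L,
        (‖ξ‖ ^ ((n : ℝ) - s))⁻¹ * ((ε / 2 ^ j * ‖ξ‖) ^ ((n : ℝ) - s) * γ j) := by
        exact mul_le_mul_of_nonneg_left (Finset.sum_le_sum fun j _ => hup j) hc.le
    _ ≤ c * ((‖ξ‖ ^ ((n : ℝ) - s))⁻¹ * (Cd * γ L)) := by
        rw [← Finset.mul_sum]; gcongr
    _ = (‖ξ‖ ^ ((n : ℝ) - s))⁻¹ * γ L * (c * Cd) := by ring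
    _ ≤ (‖ξ‖ ^ ((n : ℝ) - s))⁻¹ * γ L * (C₁ * cψ * I) := by
        have := hγ0 L
        rw [div_lt_iff₀ (by positivity)] at hI
        refine mul_le_mul_of_nonneg_left ?_ (by positivity)
        linarith
    _ = C₁ * cψ / ‖ξ‖ ^ ((n : ℝ) - s) * (I * γ L) := by ring
    _ ≤ C₁ * cψ / ‖ξ‖ ^ ((n : ℝ) - s) * ∑ j ∈ Finset.range (L + I), γ j := by gcongr
    _ ≤ _ := by
        rw [Finset.mul_sum]
        exact Finset.sum_le_sum fun j _ => hlow j

/-! ### Positivity of the short-range part -/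

/-- The bound for the possible negative part of `smearRem` at scale `r`. -/
noncomputable def scaleProfile {n : ℕ} (s : ℝ) (r : ℝ) (X : Euc n) : ℝ :=
  r ^ (-s) * ((1 + ‖X‖ / r) ^ (3 * n + 2))⁻¹

lemma scaleProfile_pos {n : ℕ} {s r : ℝ} (hr : 0 < r) (X : Euc n) : 0 < scaleProfile s r X := by
  unfold scaleProfile; positivity

/-- The decay exponent `3 n + 2` exceeds `s`, so after rescaling by `r` the profile lies below the
homogeneous singularity. The bound does not depend on `r`. -/
lemma scaleProfile_le_rpow {n : ℕ} {s r : ℝ} (hs : 0 ≤ s) (hsn : s ≤ n) (hr : 0 < r) {X : Euc n}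
    (hX : X ≠ 0) : scaleProfile s r X ≤ ‖X‖ ^ (-s) := by
  have hX0 := norm_pos_iff.2 hX
  have hy : 0 < ‖X‖ / r := div_pos hX0 hr
  have e : ‖X‖ ^ (-s) = r ^ (-s) * (‖X‖ / r) ^ (-s) := by
    rw [← Real.mul_rpow hr.le hy.le, mul_div_cancel₀ _ hr.ne']
  rw [e]
  unfold scaleProfile
  gcongr
  rw [← Real.rpow_natCast, ← Real.rpow_neg (by positivity)]
  calc (1 + ‖X‖ / r) ^ (-((3 * n + 2 : ℕ) : ℝ)) ≤ (1 + ‖X‖ / r) ^ (-s) := by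
        apply Real.rpow_le_rpow_of_exponent_le (by linarith)
        push_cast
        have : (0 : ℝ) ≤ n := Nat.cast_nonneg n
        linarith
    _ ≤ (‖X‖ / r) ^ (-s) :=
        Real.rpow_le_rpow_of_nonpos hy (by linarith) (by linarith)

/-- Far from the origin, small scales contribute much less than the unit scale. -/
lemma scaleProfile_small_le {n : ℕ} {s ε θ : ℝ} {l j : ℕ} (hsn : s ≤ n) (hε : 0 < ε)
    (hθ : 0 < θ) (hθ1 : θ ≤ 1) (hj : 2 * l ≤ j) {X : Euc n} (hX : θ * (ε / 2 ^ l) ≤ ‖X‖) :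
    scaleProfile s (ε / 2 ^ j) X ≤ (2 / θ) ^ (3 * n + 2) / 2 ^ l * scaleProfile s ε X := by
  set y := ‖X‖ / ε
  have h2l : (0 : ℝ) < 2 ^ l := by positivity
  have hyl : θ / 2 ^ l ≤ y := by
    rw [le_div_iff₀ hε]
    calc θ / 2 ^ l * ε = θ * (ε / 2 ^ l) := by ring
      _ ≤ _ := hX
  have hy : 0 < y := lt_of_lt_of_le (by positivity) hyl
  have h1 : 1 + y ≤ 2 * 2 ^ l / θ * y := by
    have h3 : 1 ≤ 2 ^ l / θ * y := by
      calc (1 : ℝ) = 2 ^ l / θ * (θ / 2 ^ l) := by field_simp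
        _ ≤ _ := by gcongr
    have h4 : y ≤ 2 ^ l / θ * y := by
      refine le_mul_of_one_le_left hy.le ?_
      rw [one_le_div hθ]
      exact hθ1.trans (one_le_pow₀ one_le_two)
    calc 1 + y ≤ 2 ^ l / θ * y + 2 ^ l / θ * y := add_le_add h3 h4
      _ = _ := by ring
  have e1 : ‖X‖ / (ε / 2 ^ j) = 2 ^ j * y := by simp only [y]; field_simp
  have e2 : (ε / 2 ^ j) ^ (-s) ≤ ε ^ (-s) * (2 ^ j) ^ n := by
    rw [Real.div_rpow hε.le (by positivity), div_eq_mul_inv, ← Real.rpow_neg (by positivity),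
      neg_neg, ← Real.rpow_natCast _ n]
    gcongr
    exact one_le_pow₀ one_le_two
  unfold scaleProfile
  rw [e1]
  have h5 : ((1 + 2 ^ j * y) ^ (3 * n + 2))⁻¹ ≤ ((2 ^ j * y) ^ (3 * n + 2))⁻¹ := by
    gcongr; linarith
  have h6 : ((2 : ℝ) ^ j) ^ n * ((2 ^ j * y) ^ (3 * n + 2))⁻¹ =
      ((2 ^ j) ^ (2 * n + 2))⁻¹ * (y ^ (3 * n + 2))⁻¹ := by
    have : (3 * n + 2) = n + (2 * n + 2) := by ring
    rw [mul_pow, mul_inv, ← mul_assoc]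
    congr 1
    rw [this, pow_add]
    field_simp
  have h7 : (y ^ (3 * n + 2))⁻¹ ≤ (2 * 2 ^ l / θ) ^ (3 * n + 2) * ((1 + y) ^ (3 * n + 2))⁻¹ := by
    rw [← div_eq_mul_inv, inv_eq_one_div, div_le_div_iff₀ (by positivity) (by positivity), one_mul,
      ← mul_pow]
    gcongr
  -- Since `j ≥ 2 l`, the small scale gains `2 ^ (-(4 n + 4) l)`, while the comparison of `y` with
  -- `1 + y` loses `2 ^ ((3 n + 2) l)`. The net gain `2 ^ (-(n + 2) l)` is more than required.
  have h8 : (((2 : ℝ) ^ j) ^ (2 * n + 2))⁻¹ ≤ (((2 ^ l) ^ (4 * n + 4)))⁻¹ := by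
    gcongr
    rw [← pow_mul, ← pow_mul]
    refine pow_le_pow_right₀ one_le_two ?_
    calc l * (4 * n + 4) = 2 * l * (2 * n + 2) := by ring
      _ ≤ _ := Nat.mul_le_mul_right _ hj
  calc _ ≤ ε ^ (-s) * (2 ^ j) ^ n * ((2 ^ j * y) ^ (3 * n + 2))⁻¹ := by gcongr
    _ = ε ^ (-s) * (((2 ^ j) ^ (2 * n + 2))⁻¹ * (y ^ (3 * n + 2))⁻¹) := by rw [mul_assoc, h6]
    _ ≤ ε ^ (-s) * (((2 ^ l) ^ (4 * n + 4))⁻¹ *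
        ((2 * 2 ^ l / θ) ^ (3 * n + 2) * ((1 + y) ^ (3 * n + 2))⁻¹)) := by gcongr
    _ = (2 / θ) ^ (3 * n + 2) / (2 ^ l) ^ (n + 2) *
        (ε ^ (-s) * ((1 + y) ^ (3 * n + 2))⁻¹) := by
        have : (4 * n + 4) = (3 * n + 2) + (n + 2) := by ring
        rw [this, pow_add, mul_div_right_comm, mul_pow]
        field_simp
    _ ≤ _ := by
        gcongr
        exact le_self_pow₀ (one_le_pow₀ one_le_two) (by omega)

lemma scaleProfile_zero_anti {n : ℕ} {r r' : ℝ} (hr : 0 < r) (hrr : r ≤ r') (X : Euc n) :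
    scaleProfile 0 r X ≤ scaleProfile 0 r' X := by
  have hr' := hr.trans_le hrr
  unfold scaleProfile
  simp only [neg_zero, Real.rpow_zero, one_mul]
  gcongr

section LowerBounds

variable {n : ℕ} {s c C ε : ℝ} {L I : ℕ} {G : Euc n → ℝ} {X : Euc n}

/-- The correction kernel compensates the negative part of `smearRem` at the scales `j < L`. -/
lemma le_mul_shortPart (hI : 0 < I) (hε : 0 < ε)
    (hW : ∀ r : ℝ, 0 < r → 2 * C * scaleProfile s r X ≤ c * (r ^ (-s) * tailKernel (r⁻¹ • X)))
    (hK : ∀ j : ℕ, -(C * scaleProfile s (ε / 2 ^ j) X) ≤ smearRem (2 * n + 1) G (ε / 2 ^ j) X) :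
    ∑ j ∈ Finset.range L, (smearRem (2 * n + 1) G (ε / 2 ^ j) X +
        2 * C * scaleProfile s (ε / 2 ^ j) X) -
      ∑ i ∈ Finset.range I, C * scaleProfile s (ε / 2 ^ (L + i)) X ≤
      (L + I : ℕ) * shortPart s c ε L I G X := by
  have hJ : ((L + I : ℕ) : ℝ) ≠ 0 := by positivity
  rw [shortPart, mul_inv_cancel_left₀ hJ, Finset.sum_range_add, Finset.mul_sum,
    Finset.sum_add_distrib]
  have h1 : ∑ j ∈ Finset.range L, 2 * C * scaleProfile s (ε / 2 ^ j) X ≤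
      ∑ j ∈ Finset.range L, c * ((ε / 2 ^ j) ^ (-s) * tailKernel ((ε / 2 ^ j)⁻¹ • X)) :=
    Finset.sum_le_sum fun j _ => hW _ (by positivity)
  have h2 : -∑ i ∈ Finset.range I, C * scaleProfile s (ε / 2 ^ (L + i)) X ≤
      ∑ i ∈ Finset.range I, smearRem (2 * n + 1) G (ε / 2 ^ (L + i)) X := by
    rw [← Finset.sum_neg_distrib]
    exact Finset.sum_le_sum fun i _ => hK _
  linarith

/-- The correction is worth twice the negative part, so each of the scales `0, …, I` keeps a surplus
of one profile. For `s = 0` the profile increases with the scale, so the surplus of the scales `1,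
…, I` covers the `I` uncompensated scales below them, and the surplus at scale `ε` remains. -/
lemma le_mul_shortPart_of_zero (hC : 0 ≤ C) (hI : 0 < I) (hε : 0 < ε)
    (hW : ∀ r : ℝ, 0 < r → 2 * C * scaleProfile 0 r X ≤ c * (r ^ (-(0 : ℝ)) * tailKernel (r⁻¹ • X)))
    (hK : ∀ j : ℕ, -(C * scaleProfile 0 (ε / 2 ^ j) X) ≤ smearRem (2 * n + 1) G (ε / 2 ^ j) X) :
    C * scaleProfile 0 ε X ≤ (I + 1 + I : ℕ) * shortPart 0 c ε (I + 1) I G X := by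
  refine le_trans ?_ (le_mul_shortPart hI hε hW hK)
  have h1 : ∑ j ∈ Finset.range (I + 1), C * scaleProfile 0 (ε / 2 ^ j) X ≤
      ∑ j ∈ Finset.range (I + 1), (smearRem (2 * n + 1) G (ε / 2 ^ j) X +
        2 * C * scaleProfile 0 (ε / 2 ^ j) X) :=
    Finset.sum_le_sum fun j _ => by linarith [hK j]
  rw [Finset.sum_range_succ'] at h1
  have h2 : ∑ i ∈ Finset.range I, C * scaleProfile 0 (ε / 2 ^ (I + 1 + i)) X ≤
      ∑ i ∈ Finset.range I, C * scaleProfile 0 (ε / 2 ^ (i + 1)) X := by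
    refine Finset.sum_le_sum fun i _ => mul_le_mul_of_nonneg_left
      (scaleProfile_zero_anti (by positivity) ?_ X) hC
    exact div_le_div_of_nonneg_left hε.le (by positivity)
      (pow_le_pow_right₀ one_le_two (by omega))
  simp only [pow_zero, div_one] at h1
  linarith

/-- Two regimes. If `‖X‖ ≤ θ ε / 2 ^ l`, at least `l` corrected scales see the full singularity of
`G`; all but one copy of `G X` pay for the `I` uncompensated scales, whose profiles are at most `‖X‖
^ (-s)`. Farther out, these scales are finer than `ε / 2 ^ l` by another factor `2 ^ l`, so their
profiles are negligible against the surplus at scale `ε`. -/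
lemma le_mul_shortPart_of_pos {θ c' r₀ : ℝ} {l : ℕ} (hX : X ≠ 0) (hs : 0 ≤ s) (hsn : s ≤ n)
    (hC : 0 ≤ C) (hI : 0 < I) (hε : 0 < ε) (hεr : ε < r₀)
    (hW : ∀ r : ℝ, 0 < r → 2 * C * scaleProfile s r X ≤ c * (r ^ (-s) * tailKernel (r⁻¹ • X)))
    (hK : ∀ j : ℕ, -(C * scaleProfile s (ε / 2 ^ j) X) ≤ smearRem (2 * n + 1) G (ε / 2 ^ j) X)
    (hKG : ∀ j : ℕ, ‖X‖ ≤ ε / 2 ^ j →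
      G X - C * scaleProfile s (ε / 2 ^ j) X ≤ smearRem (2 * n + 1) G (ε / 2 ^ j) X)
    (hθ : 0 < θ) (hθ1 : θ ≤ 1) (hc' : 0 < c') (hG : ‖X‖ ≤ θ * r₀ → c' * ‖X‖ ^ (-s) ≤ G X)
    (hl1 : I * C ≤ (l - 1) * c') (hl2 : I * (2 / θ) ^ (3 * n + 2) ≤ 2 ^ l) :
    0 ≤ (2 * l + I : ℕ) * shortPart s c ε (2 * l) I G X ∧
      (‖X‖ ≤ ε → G X ≤ (2 * l + I : ℕ) * shortPart s c ε (2 * l) I G X) := by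
  have hmain := le_mul_shortPart (L := 2 * l) hI hε hW hK
  have hr : ∀ j : ℕ, 0 < ε / 2 ^ j := fun j => by positivity
  have hF : ∀ j : ℕ, 0 ≤ C * scaleProfile s (ε / 2 ^ j) X := fun j =>
    mul_nonneg hC (scaleProfile_pos (hr j) X).le
  have hT : ∀ j : ℕ, 0 ≤ smearRem (2 * n + 1) G (ε / 2 ^ j) X +
      2 * C * scaleProfile s (ε / 2 ^ j) X := fun j => by linarith [hK j, hF j]
  have hl0 : 0 < l := by
    rcases Nat.eq_zero_or_pos l with rfl | h
    · have : 0 ≤ (I : ℝ) * C := by positivity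
      simp only [Nat.cast_zero] at hl1
      linarith
    · exact h
  rcases le_total ‖X‖ (θ * (ε / 2 ^ l)) with h | h
  · have h2 : ‖X‖ ≤ ε / 2 ^ l := h.trans (mul_le_of_le_one_left (hr l).le hθ1)
    have hεl : ε / 2 ^ l ≤ ε := div_le_self hε.le (one_le_pow₀ one_le_two)
    have hGX := hG (h.trans (by gcongr; linarith))
    have hXs : 0 < ‖X‖ ^ (-s) := Real.rpow_pos_of_pos (norm_pos_iff.2 hX) _
    have hG0 : 0 ≤ G X := le_trans (by positivity) hGX
    have h3 : l * G X ≤ ∑ j ∈ Finset.range (2 * l), (smearRem (2 * n + 1) G (ε / 2 ^ j) X +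
        2 * C * scaleProfile s (ε / 2 ^ j) X) := by
      calc (l : ℝ) * G X = ∑ j ∈ Finset.range l, G X := by simp
        _ ≤ ∑ j ∈ Finset.range l, (smearRem (2 * n + 1) G (ε / 2 ^ j) X +
            2 * C * scaleProfile s (ε / 2 ^ j) X) := by
            refine Finset.sum_le_sum fun j hj => ?_
            have hj' := Finset.mem_range.1 hj
            have : ε / 2 ^ l ≤ ε / 2 ^ j := by
              gcongr
              norm_num
            linarith [hKG j (h2.trans this), hF j]
        _ ≤ _ := Finset.sum_le_sum_of_subset_of_nonneg
            (Finset.range_subset_range.2 (by omega)) fun j _ _ => hT j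
    have h4 : ∑ i ∈ Finset.range I, C * scaleProfile s (ε / 2 ^ (2 * l + i)) X ≤
        I * C * ‖X‖ ^ (-s) := by
      calc _ ≤ ∑ i ∈ Finset.range I, C * ‖X‖ ^ (-s) := Finset.sum_le_sum fun i _ =>
            mul_le_mul_of_nonneg_left (scaleProfile_le_rpow hs hsn (hr _) hX) hC
        _ = _ := by simp [mul_assoc]
    have h5 : I * C * ‖X‖ ^ (-s) ≤ (l - 1) * G X := by
      have hl' : (0 : ℝ) ≤ l - 1 := by
        have : (1 : ℝ) ≤ l := by exact_mod_cast hl0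
        linarith
      calc _ ≤ (l - 1) * c' * ‖X‖ ^ (-s) := by gcongr
        _ = (l - 1) * (c' * ‖X‖ ^ (-s)) := by ring
        _ ≤ _ := by gcongr
    exact ⟨by linarith, fun _ => by linarith⟩
  · have h4 : ∑ i ∈ Finset.range I, C * scaleProfile s (ε / 2 ^ (2 * l + i)) X ≤
        C * scaleProfile s ε X := by
      calc _ ≤ ∑ i ∈ Finset.range I,
            C * ((2 / θ) ^ (3 * n + 2) / 2 ^ l * scaleProfile s ε X) :=
            Finset.sum_le_sum fun i _ => mul_le_mul_of_nonneg_left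
              (scaleProfile_small_le hsn hε hθ hθ1 (by omega) h) hC
        _ = (I * (2 / θ) ^ (3 * n + 2)) / 2 ^ l * (C * scaleProfile s ε X) := by
            simp only [Finset.sum_const, Finset.card_range, nsmul_eq_mul]; ring
        _ ≤ 1 * (C * scaleProfile s ε X) := by
            have := scaleProfile_pos (s := s) hε X
            gcongr
            rwa [div_le_one (by positivity)]
        _ = _ := one_mul _
    have h5 : smearRem (2 * n + 1) G ε X + 2 * C * scaleProfile s ε X ≤
        ∑ j ∈ Finset.range (2 * l), (smearRem (2 * n + 1) G (ε / 2 ^ j) X +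
        2 * C * scaleProfile s (ε / 2 ^ j) X) := by
      have := Finset.single_le_sum (fun j _ => hT j) (Finset.mem_range.2 (by omega : 0 < 2 * l))
      simpa using this
    have h6 := hK 0
    have h7 := hKG 0
    simp only [pow_zero, div_one] at h6 h7
    exact ⟨by linarith, fun hXε => by linarith [h7 hXε]⟩

end LowerBounds

/-! ### The decomposition of the potential at scale `ε` -/

/-- The scaling profile dominating `shortPart`. -/
noncomputable def shortProfile (q : ℕ) (a y : ℝ) : ℝ := (y ^ (-a) + 1) * ((1 + y) ^ (q + 1))⁻¹

lemma shortProfile_nonneg {q : ℕ} {a y : ℝ} (hy : 0 ≤ y) : 0 ≤ shortProfile q a y := by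
  unfold shortProfile; positivity

lemma log_term_le {s ε : ℝ} (hε : 0 < ε) (j : ℕ) :
    (if s = 0 then |Real.log (ε / 2 ^ j)| else 0) ≤
      (if s = 0 then |Real.log ε| else 0) + (if s = 0 then (j : ℝ) else 0) := by
  split_ifs with h
  · rw [Real.log_div hε.ne' (by positivity), Real.log_pow]
    refine (abs_sub _ _).trans ?_
    gcongr
    rw [abs_of_nonneg (by have := Real.log_pos one_lt_two; positivity)]
    exact mul_le_of_le_one_right (by positivity) (by linarith [Real.log_two_lt_d9])
  · simp

/-- Decomposition of a Riesz-type potential at scale `ε` into a positive definite part and a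
nonnegative localized part which controls the potential up to distance `ε`. -/
lemma exists_decomposition {n : ℕ} (hn : 0 < n) {s : ℝ} (hs : 0 ≤ s) (hsn : s < n)
    (P : PotentialConstants) :
    ∃ C, 0 < C ∧ ∃ J : ℕ, ∀ G : Euc n → ℝ, IsRieszType n s P G → ∀ ε, 0 < ε → ε < P.r₀ / 8 →
      ∃ p S q : Euc n → ℝ, Measurable p ∧ Measurable S ∧ AEStronglyMeasurable q ∧
        (∀ X, X ≠ 0 → p X + S X = G X) ∧
        (∀ ξ, ξ ≠ 0 → 0 ≤ q ξ) ∧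
        (∀ X, Integrable (fun ξ => q ξ * (1 - Real.cos (2 * Real.pi * inner ℝ X ξ))) ∧
          p 0 - p X = ∫ ξ, q ξ * (1 - Real.cos (2 * Real.pi * inner ℝ X ξ))) ∧
        (∀ X, X ≠ 0 → 0 ≤ S X) ∧
        (∀ X, X ≠ 0 → ‖X‖ ≤ ε →
          (if 0 < s then G X else 0) + (if s = 0 then 1 else 0) ≤ C * S X) ∧
        (∀ X, X ≠ 0 → S X ≤ C * ∑ j ∈ Finset.range J,
          (ε / 2 ^ j) ^ (-s) * shortProfile n (singExp s) (‖X‖ / (ε / 2 ^ j))) ∧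
        p 0 ≤ C * (ε ^ (-s) + if s = 0 then |Real.log ε| else 0) ∧
        ∃ B, ∀ X, |p X| ≤ B * (1 + ‖X‖) := by
  obtain ⟨C, hC, hest⟩ := exists_smearRem_estimates hn hs hsn P
  obtain ⟨CW, hCW, hWle⟩ := exists_tailKernel_le n
  obtain ⟨cW, hcW, hleW⟩ := exists_le_tailKernel n
  obtain ⟨_, -, hsc⟩ := exists_scaleControl hn hs P (K := 1) one_pos
  -- Twice what is needed to cancel the negative part, so that a surplus remains at every corrected
  -- scale.
  set c : ℝ := 2 * C / cW
  have hc : 0 < c := by positivity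
  obtain ⟨I, hI, hq⟩ := exists_longHat_nonneg hsn hc P.C₁_pos
  have hW : ∀ (X : Euc n) (r : ℝ), 0 < r →
      2 * C * scaleProfile s r X ≤ c * (r ^ (-s) * tailKernel (r⁻¹ • X)) := fun X r hr => by
    have h1 := hleW (r⁻¹ • X)
    rw [norm_smul, Real.norm_of_nonneg (inv_pos.2 hr).le, ← div_eq_inv_mul] at h1
    calc 2 * C * scaleProfile s r X =
          c * (r ^ (-s) * (cW * ((1 + ‖X‖ / r) ^ (3 * n + 2))⁻¹)) := by
          simp only [scaleProfile, c]; field_simp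
      _ ≤ _ := by gcongr
  -- The number `L` of corrected scales is fixed only now, in terms of `I`; positivity of `longHat`
  -- holds for every `L`.
  have hlow : ∃ L : ℕ, ∀ G : Euc n → ℝ, IsRieszType n s P G → ∀ ε, 0 < ε → ε < P.r₀ / 8 →
      ∀ X, X ≠ 0 → 0 ≤ (L + I : ℕ) * shortPart s c ε L I G X ∧ (‖X‖ ≤ ε →
        (if 0 < s then G X else 0) + (if s = 0 then 1 else 0) ≤
          (1 + 2 ^ (3 * n + 2) / C) * ((L + I : ℕ) * shortPart s c ε L I G X)) := by
    have hK : ∀ G : Euc n → ℝ, IsRieszType n s P G → ∀ ε, 0 < ε → ε < P.r₀ / 8 → ∀ X, X ≠ 0 →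
        ∀ j : ℕ, -(C * scaleProfile s (ε / 2 ^ j) X) ≤ smearRem (2 * n + 1) G (ε / 2 ^ j) X := by
      intro G hG ε hε hεr X hX j
      have h1 := (hest G hG (ε / 2 ^ j) (by positivity)
        ((div_le_self hε.le (one_le_pow₀ one_le_two)).trans_lt hεr)).1 X hX
      rwa [mul_assoc] at h1
    rcases hs.eq_or_lt with rfl | hs0
    · refine ⟨I + 1, fun G hG ε hε hεr X hX => ?_⟩
      have h1 := le_mul_shortPart_of_zero hC.le hI hε (hW X) (hK G hG ε hε hεr X hX)
      have h2 := mul_pos hC (scaleProfile_pos (s := 0) hε X)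
      refine ⟨h2.le.trans h1, fun hXε => ?_⟩
      rw [if_neg (lt_irrefl _), if_pos rfl, zero_add]
      have h3 := one_le_two_pow_mul_inv (3 * n + 2) (by positivity) ((div_le_one hε).2 hXε)
      have e : scaleProfile 0 ε X = ((1 + ‖X‖ / ε) ^ (3 * n + 2))⁻¹ := by simp [scaleProfile]
      rw [← e] at h3
      calc (1 : ℝ) ≤ 2 ^ (3 * n + 2) / C * (C * scaleProfile 0 ε X) := by
            rw [← mul_assoc, div_mul_cancel₀ _ hC.ne']; exact h3
        _ ≤ (1 + 2 ^ (3 * n + 2) / C) * (C * scaleProfile 0 ε X) := by gcongr; linarith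
        _ ≤ _ := by gcongr
    · obtain ⟨c', hc', θ, hθ, hθ1, hlb⟩ := exists_riesz_lower_bound hn hs0 hsn P
      obtain ⟨l₁, hl₁⟩ := exists_nat_ge (I * C / c' + 1)
      obtain ⟨l₂, hl₂⟩ := exists_nat_ge ((I : ℝ) * (2 / θ) ^ (3 * n + 2))
      set l := l₁ + l₂
      -- `l₁` makes the copies of `G` near the origin sufficient, and `l₂` makes the fine scales
      -- negligible away from it.
      have hl1 : (I : ℝ) * C ≤ (l - 1) * c' := by
        rw [← div_le_iff₀ hc']
        have : (0 : ℝ) ≤ l₂ := Nat.cast_nonneg _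
        simp only [l]; push_cast; linarith
      have hl2 : (I : ℝ) * (2 / θ) ^ (3 * n + 2) ≤ 2 ^ l := by
        have h1 : (l : ℝ) ≤ 2 ^ l := by exact_mod_cast Nat.lt_two_pow_self.le
        have : (0 : ℝ) ≤ l₁ := Nat.cast_nonneg _
        have : (l : ℝ) = l₁ + l₂ := by simp [l]
        linarith
      refine ⟨2 * l, fun G hG ε hε hεr X hX => ?_⟩
      have hr0 := P.r₀_pos
      have h1 := le_mul_shortPart_of_pos (G := G) (r₀ := P.r₀) hX hs hsn.le hC.le hI hε
        (by linarith) (hW X)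
        (hK G hG ε hε hεr X hX) (fun j hj => by
          have h1 := (hest G hG (ε / 2 ^ j) (by positivity)
            ((div_le_self hε.le (one_le_pow₀ one_le_two)).trans_lt hεr)).2.1 hs0 X hX hj
          rwa [mul_assoc] at h1) hθ hθ1 hc' (hlb G hG X hX) hl1 hl2
      refine ⟨h1.1, fun hXε => ?_⟩
      rw [if_pos hs0, if_neg hs0.ne', add_zero]
      refine (h1.2 hXε).trans (le_mul_of_one_le_left h1.1 ?_)
      have : 0 ≤ 2 ^ (3 * n + 2) / C := by positivity
      linarith
  obtain ⟨L, hL⟩ := hlow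
  set J : ℕ := L + I
  have hJ : (0 : ℝ) < J := by simp only [J]; positivity
  refine ⟨(1 + 2 ^ (3 * n + 2) / C) * J + (C + c * CW) + C * (2 ^ (J * n : ℕ) + J), by positivity,
    J, fun G hG ε hε hεr => ?_⟩
  obtain ⟨b, hb, -, -⟩ := hsc G hG
  obtain ⟨Ghat, hF, hGb⟩ := hG.fourier
  have hGm := hb.measurable
  have hr : ∀ j : ℕ, 0 < ε / 2 ^ j := fun j => by positivity
  have hrr : ∀ j : ℕ, ε / 2 ^ j < P.r₀ / 8 := fun j =>
    (div_le_self hε.le (one_le_pow₀ one_le_two)).trans_lt hεr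
  have hq0 : ∀ ξ, ξ ≠ 0 → 0 ≤ longHat s c ε L I Ghat ξ := fun ξ hξ =>
    hq L ε hε Ghat ξ hξ (hGb ξ hξ).1
  have hGabs : ∀ ξ, ξ ≠ 0 → |Ghat ξ| ≤ P.C₂ / ‖ξ‖ ^ ((n : ℝ) - s) := fun ξ hξ => by
    rw [abs_of_nonneg (le_trans (div_nonneg P.C₁_pos.le (by positivity)) (hGb ξ hξ).1)]
    exact (hGb ξ hξ).2
  refine ⟨longPart s c ε L I G, shortPart s c ε L I G, longHat s c ε L I Ghat,
    measurable_longPart hGm, measurable_shortPart hI hGm, ?_,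
    fun X _ => longPart_add_shortPart hI G X, hq0,
    fun X => hb.longPart_zero_sub hn (singExp_nonneg hs) (singExp_lt hn hsn) hs hsn.le hF hGabs c
      hε L I X, fun X hX => ?_, fun X hX hXε => ?_, fun X hX => ?_, ?_, ?_⟩
  · have hGa := aestronglyMeasurable_of_locallyIntegrableOn_compl hn hF.1
    unfold longHat
    refine AEStronglyMeasurable.const_mul (AEStronglyMeasurable.sub ?_
      (AEStronglyMeasurable.const_mul ?_ _)) _
    · refine Finset.aestronglyMeasurable_fun_sum _ fun j _ => hGa.mul ?_
      exact ((continuous_smoothMult _).comp (continuous_const_smul _)).aestronglyMeasurable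
    · refine (Finset.measurable_sum _ fun j _ => ?_).aestronglyMeasurable
      exact ((measurable_tailKernelHat.comp (measurable_const_smul _)).const_mul _).const_mul _
  · exact nonneg_of_mul_nonneg_right (hL G hG ε hε hεr X hX).1 hJ
  · have h1 := hL G hG ε hε hεr X hX
    have h2 := nonneg_of_mul_nonneg_right h1.1 hJ
    refine (h1.2 hXε).trans ?_
    rw [← mul_assoc]
    refine mul_le_mul_of_nonneg_right ?_ h2
    have : 0 ≤ C + c * CW := by positivity
    have : 0 ≤ C * (2 ^ (J * n : ℕ) + J) := by positivity
    linarith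
  · set T : ℕ → ℝ := fun j => (ε / 2 ^ j) ^ (-s) * shortProfile n (singExp s) (‖X‖ / (ε / 2 ^ j))
    have hT0 : ∀ j, 0 ≤ T j := fun j =>
      mul_nonneg (by positivity) (shortProfile_nonneg (by positivity))
    have h1 : ∑ j ∈ Finset.range J, smearRem (2 * n + 1) G (ε / 2 ^ j) X ≤
        C * ∑ j ∈ Finset.range J, T j := by
      rw [Finset.mul_sum]
      refine Finset.sum_le_sum fun j _ => ?_
      have := (hest G hG _ (hr j) (hrr j)).2.2.1 X hX
      rw [mul_assoc] at this
      exact (le_abs_self _).trans this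
    have h2 : ∑ j ∈ Finset.range L, (ε / 2 ^ j) ^ (-s) * tailKernel ((ε / 2 ^ j)⁻¹ • X) ≤
        CW * ∑ j ∈ Finset.range J, T j := by
      calc _ ≤ ∑ j ∈ Finset.range L, CW * T j := by
            refine Finset.sum_le_sum fun j _ => ?_
            have h3 := hWle ((ε / 2 ^ j)⁻¹ • X)
            rw [norm_smul, Real.norm_of_nonneg (inv_pos.2 (hr j)).le, ← div_eq_inv_mul] at h3
            have h4 : ((1 + ‖X‖ / (ε / 2 ^ j)) ^ (n + 1))⁻¹ ≤
                shortProfile n (singExp s) (‖X‖ / (ε / 2 ^ j)) := by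
              refine le_mul_of_one_le_left (by positivity) ?_
              have : 0 ≤ (‖X‖ / (ε / 2 ^ j)) ^ (-singExp s) := by positivity
              linarith
            calc _ ≤ (ε / 2 ^ j) ^ (-s) * (CW * shortProfile n (singExp s)
                  (‖X‖ / (ε / 2 ^ j))) := by
                  gcongr
                  exact h3.trans (by gcongr)
              _ = _ := by simp only [T]; ring
        _ = CW * ∑ j ∈ Finset.range L, T j := by rw [Finset.mul_sum]
        _ ≤ _ := by
            refine mul_le_mul_of_nonneg_left ?_ hCW
            exact Finset.sum_le_sum_of_subset_of_nonneg
              (Finset.range_subset_range.2 (by simp [J])) fun j _ _ => hT0 j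
    have hTs : 0 ≤ ∑ j ∈ Finset.range J, T j := Finset.sum_nonneg fun j _ => hT0 j
    have hJ1 : (1 : ℝ) ≤ J := by exact_mod_cast (show 1 ≤ L + I by omega)
    have hJi : (J : ℝ)⁻¹ ≤ 1 := inv_le_one_of_one_le₀ hJ1
    calc shortPart s c ε L I G X ≤ (J : ℝ)⁻¹ * ((C + c * CW) * ∑ j ∈ Finset.range J, T j) := by
          refine mul_le_mul_of_nonneg_left ?_ (by positivity)
          have := mul_le_mul_of_nonneg_left h2 hc.le
          linarith
      _ ≤ 1 * ((C + c * CW) * ∑ j ∈ Finset.range J, T j) := by gcongr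
      _ ≤ _ := by
          rw [one_mul]
          refine mul_le_mul_of_nonneg_right ?_ hTs
          have : 0 ≤ (1 + 2 ^ (3 * n + 2) / C) * J := by positivity
          have : 0 ≤ C * (2 ^ (J * n : ℕ) + J) := by positivity
          linarith
  · set E : ℝ := ε ^ (-s) + if s = 0 then |Real.log ε| else 0
    have hE : 0 ≤ E := by
      have : 0 ≤ (if s = 0 then |Real.log ε| else 0) := by split_ifs <;> positivity
      positivity
    have h1 : ∑ j ∈ Finset.range J, smoothPart (2 * n + 1) G (ε / 2 ^ j) 0 ≤
        J * (C * (2 ^ (J * n : ℕ) + J) * E) := by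
      calc _ ≤ ∑ j ∈ Finset.range J, C * (2 ^ (J * n : ℕ) + J) * E := by
            refine Finset.sum_le_sum fun j hj => ?_
            have hj' := (Finset.mem_range.1 hj).le
            have h2 := (hest G hG _ (hr j) (hrr j)).2.2.2.1
            refine (le_abs_self _).trans (h2.trans ?_)
            rw [mul_assoc]
            refine mul_le_mul_of_nonneg_left ?_ hC.le
            have h3 : (ε / 2 ^ j) ^ (-s) ≤ 2 ^ (J * n : ℕ) * ε ^ (-s) := by
              rw [Real.div_rpow hε.le (by positivity), div_eq_mul_inv,
                ← Real.rpow_neg (by positivity), neg_neg, mul_comm]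
              gcongr
              rw [pow_mul]
              calc ((2 : ℝ) ^ j) ^ s ≤ (2 ^ j) ^ (n : ℝ) :=
                    Real.rpow_le_rpow_of_exponent_le (one_le_pow₀ one_le_two) hsn.le
                _ = (2 ^ j) ^ n := Real.rpow_natCast _ _
                _ ≤ _ := by gcongr; norm_num
            have h4 := log_term_le (s := s) hε j
            have h5 : (if s = 0 then (j : ℝ) else 0) ≤ J * ε ^ (-s) := by
              split_ifs with h
              · rw [h, neg_zero, Real.rpow_zero, mul_one]; exact_mod_cast hj'
              · positivity
            have h6 : (1 : ℝ) ≤ 2 ^ (J * n : ℕ) := one_le_pow₀ one_le_two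
            have h7 : 0 ≤ (if s = 0 then |Real.log ε| else 0) := by split_ifs <;> positivity
            simp only [E]
            nlinarith
        _ = _ := by simp [J]
    -- The correction is subtracted in `longPart`, so for the upper bound at the origin it may be
    -- dropped.
    have h2 : 0 ≤ c * ∑ j ∈ Finset.range L, (ε / 2 ^ j) ^ (-s) *
        tailKernel ((ε / 2 ^ j)⁻¹ • (0 : Euc n)) :=
      mul_nonneg hc.le (Finset.sum_nonneg fun j _ =>
        mul_nonneg (by positivity) (tailKernel_nonneg _))
    calc longPart s c ε L I G 0 ≤ (J : ℝ)⁻¹ * (J * (C * (2 ^ (J * n : ℕ) + J) * E)) := by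
          refine mul_le_mul_of_nonneg_left ?_ (by positivity)
          linarith
      _ = C * (2 ^ (J * n : ℕ) + J) * E := inv_mul_cancel_left₀ hJ.ne' _
      _ ≤ _ := by
          refine mul_le_mul_of_nonneg_right ?_ hE
          have : 0 ≤ (1 + 2 ^ (3 * n + 2) / C) * J := by positivity
          have : 0 ≤ c * CW := by positivity
          linarith
  · choose B hB using fun j : ℕ => (hest G hG _ (hr j) (hrr j)).2.2.2.2
    refine ⟨(J : ℝ)⁻¹ * (∑ j ∈ Finset.range J, B j +
      c * ∑ j ∈ Finset.range L, (ε / 2 ^ j) ^ (-s) * CW), fun X => ?_⟩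
    rw [longPart, abs_mul, abs_of_pos (inv_pos.2 hJ), mul_assoc]
    refine mul_le_mul_of_nonneg_left ((abs_sub _ _).trans ?_) (inv_pos.2 hJ).le
    rw [add_mul]
    refine add_le_add ?_ ?_
    · rw [Finset.sum_mul]
      exact (Finset.abs_sum_le_sum_abs _ _).trans (Finset.sum_le_sum fun j _ => hB j X)
    · rw [abs_mul, abs_of_pos hc, mul_assoc, Finset.sum_mul]
      refine mul_le_mul_of_nonneg_left ((Finset.abs_sum_le_sum_abs _ _).trans
        (Finset.sum_le_sum fun j _ => ?_)) hc.le
      have h1 := hWle ((ε / 2 ^ j)⁻¹ • X)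
      have h2 : ((1 + ‖(ε / 2 ^ j)⁻¹ • X‖) ^ (n + 1))⁻¹ ≤ 1 :=
        inv_le_one_of_one_le₀ (one_le_pow₀ (by linarith [norm_nonneg ((ε / 2 ^ j)⁻¹ • X)]))
      have h3 : tailKernel ((ε / 2 ^ j)⁻¹ • X) ≤ CW := h1.trans (mul_le_of_le_one_right hCW h2)
      rw [abs_of_nonneg (mul_nonneg (by positivity) (tailKernel_nonneg _)), mul_assoc]
      have := norm_nonneg X
      gcongr
      exact h3.trans (le_mul_of_one_le_right hCW (by linarith))

/-! ### Conditionally positive definite kernels -/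

/-- The real part of the product of a characteristic function and a conjugate one, for the phase
`ι`. -/
noncomputable def trigCorr {n : ℕ} {E : Type*} [MeasurableSpace E] (ι : E → Euc n)
    (ν₁ ν₂ : Measure E) (ξ : Euc n) : ℝ :=
  (∫ x, Real.cos (2 * Real.pi * inner ℝ (ι x) ξ) ∂ν₁) *
    (∫ x, Real.cos (2 * Real.pi * inner ℝ (ι x) ξ) ∂ν₂) +
  (∫ x, Real.sin (2 * Real.pi * inner ℝ (ι x) ξ) ∂ν₁) *
    (∫ x, Real.sin (2 * Real.pi * inner ℝ (ι x) ξ) ∂ν₂)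

lemma integral_prod_one_sub_cos {E : Type*} [MeasurableSpace E] (ν₁ ν₂ : Measure E)
    [IsProbabilityMeasure ν₁] [IsProbabilityMeasure ν₂] {φ : E → ℝ} (hφ : Measurable φ) :
    ∫ z : E × E, (1 - Real.cos (φ z.1 - φ z.2)) ∂(ν₁.prod ν₂) =
      1 - ((∫ x, Real.cos (φ x) ∂ν₁) * (∫ x, Real.cos (φ x) ∂ν₂) +
        (∫ x, Real.sin (φ x) ∂ν₁) * (∫ x, Real.sin (φ x) ∂ν₂)) := by
  have hcos : ∀ (ν : Measure E) [IsProbabilityMeasure ν],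
      Integrable (fun x => Real.cos (φ x)) ν := fun ν _ =>
    (integrable_const (1 : ℝ)).mono' (Real.measurable_cos.comp hφ).aestronglyMeasurable
      (Eventually.of_forall fun x => Real.abs_cos_le_one (φ x))
  have hsin : ∀ (ν : Measure E) [IsProbabilityMeasure ν],
      Integrable (fun x => Real.sin (φ x)) ν := fun ν _ =>
    (integrable_const (1 : ℝ)).mono' (Real.measurable_sin.comp hφ).aestronglyMeasurable
      (Eventually.of_forall fun x => Real.abs_sin_le_one (φ x))
  have hc := (hcos ν₁).mul_prod (hcos ν₂)
  have hs := (hsin ν₁).mul_prod (hsin ν₂)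
  rw [← integral_prod_mul, ← integral_prod_mul, ← integral_add hc hs]
  simp only [Real.cos_sub]
  have h1 : Integrable (fun _ : E × E => (1 : ℝ)) (ν₁.prod ν₂) := integrable_const 1
  have h2 := integral_sub h1 (hc.add hs)
  simp only [integral_const, probReal_univ, smul_eq_mul, one_mul] at h2
  exact h2

section PositiveDefinite

variable {n : ℕ} {E : Type*} [MeasurableSpace E] [AddCommGroup E] [MeasurableSub₂ E]
  {p q : Euc n → ℝ} {ι : E → Euc n}

/-- Fubini for `q ξ (1 - cos)`. The integrand is nonnegative, so its joint integrability follows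
from that of the inner integral `p 0 - p`, without any integrability of `q` alone. The map `ι` lets
measures on `ℝᵈ` be tested with frequencies of the larger space. -/
lemma interaction_eq_sub_integral (hι : Measurable ι) (hsub : ∀ x y, ι (x - y) = ι x - ι y)
    (hq : AEStronglyMeasurable q) (hq0 : ∀ᵐ ξ, 0 ≤ q ξ)
    (hp : ∀ X, Integrable (fun ξ => q ξ * (1 - Real.cos (2 * Real.pi * inner ℝ X ξ))) ∧
      p 0 - p X = ∫ ξ, q ξ * (1 - Real.cos (2 * Real.pi * inner ℝ X ξ)))
    (ν₁ ν₂ : Measure E) [IsProbabilityMeasure ν₁] [IsProbabilityMeasure ν₂]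
    (hint : Integrable (fun z : E × E => p (ι (z.1 - z.2))) (ν₁.prod ν₂)) :
    Integrable (fun ξ => q ξ * (1 - trigCorr ι ν₁ ν₂ ξ)) ∧
    ∫ z, p (ι (z.1 - z.2)) ∂(ν₁.prod ν₂) = p 0 - ∫ ξ, q ξ * (1 - trigCorr ι ν₁ ν₂ ξ) := by
  set H : (E × E) × Euc n → ℝ := fun w =>
    q w.2 * (1 - Real.cos (2 * Real.pi * inner ℝ (ι (w.1.1 - w.1.2)) w.2)) with hH
  have hHm : AEStronglyMeasurable H ((ν₁.prod ν₂).prod volume) := by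
    refine AEStronglyMeasurable.mul hq.comp_snd (Measurable.aestronglyMeasurable ?_)
    have : Measurable fun w : (E × E) × Euc n => ι (w.1.1 - w.1.2) := by fun_prop
    exact (Real.measurable_cos.comp ((this.inner measurable_snd).const_mul _)).const_sub _
  have h1 : ∀ z : E × E, ∫ ξ, H (z, ξ) = p 0 - p (ι (z.1 - z.2)) := fun z =>
    (hp (ι (z.1 - z.2))).2.symm
  have hnorm : ∀ z : E × E, ∫ ξ, ‖H (z, ξ)‖ = p 0 - p (ι (z.1 - z.2)) := fun z => by
    rw [← h1]
    refine integral_congr_ae ?_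
    filter_upwards [hq0] with ξ hξ
    exact Real.norm_of_nonneg (mul_nonneg hξ (sub_nonneg.2 (Real.cos_le_one _)))
  have hsubi : Integrable (fun z : E × E => p 0 - p (ι (z.1 - z.2))) (ν₁.prod ν₂) :=
    Integrable.sub (integrable_const (p 0)) hint
  have hHi : Integrable H ((ν₁.prod ν₂).prod volume) := by
    refine (integrable_prod_iff hHm).2
      ⟨Eventually.of_forall fun z => (hp (ι (z.1 - z.2))).1, ?_⟩
    simp only [hnorm]
    exact hsubi
  have hinner : ∀ ξ, ∫ z, H (z, ξ) ∂(ν₁.prod ν₂) = q ξ * (1 - trigCorr ι ν₁ ν₂ ξ) := fun ξ => by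
    have hm : Measurable fun x => 2 * Real.pi * inner ℝ (ι x) ξ :=
      (hι.inner measurable_const).const_mul _
    rw [trigCorr, ← integral_prod_one_sub_cos ν₁ ν₂ hm, ← integral_const_mul]
    simp only [hH, hsub, inner_sub_left, mul_sub]
  have hright := hHi.integral_prod_right
  have hl := integral_prod H hHi
  have hr := integral_prod_symm H hHi
  simp only [hinner] at hright hr
  simp only [h1] at hl
  refine ⟨hright, ?_⟩
  rw [← hr, hl, integral_sub (integrable_const (p 0)) hint]
  simp

/-- The interaction energy of the difference of two probability measures through a conditionally
positive definite kernel is nonnegative. -/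
lemma interaction_sub_nonneg (hι : Measurable ι) (hsub : ∀ x y, ι (x - y) = ι x - ι y)
    (hq : AEStronglyMeasurable q) (hq0 : ∀ᵐ ξ, 0 ≤ q ξ)
    (hp : ∀ X, Integrable (fun ξ => q ξ * (1 - Real.cos (2 * Real.pi * inner ℝ X ξ))) ∧
      p 0 - p X = ∫ ξ, q ξ * (1 - Real.cos (2 * Real.pi * inner ℝ X ξ)))
    (ν₁ ν₂ : Measure E) [IsProbabilityMeasure ν₁] [IsProbabilityMeasure ν₂]
    (h11 : Integrable (fun z : E × E => p (ι (z.1 - z.2))) (ν₁.prod ν₁))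
    (h12 : Integrable (fun z : E × E => p (ι (z.1 - z.2))) (ν₁.prod ν₂))
    (h21 : Integrable (fun z : E × E => p (ι (z.1 - z.2))) (ν₂.prod ν₁))
    (h22 : Integrable (fun z : E × E => p (ι (z.1 - z.2))) (ν₂.prod ν₂)) :
    0 ≤ ∫ z, p (ι (z.1 - z.2)) ∂(ν₁.prod ν₁) - ∫ z, p (ι (z.1 - z.2)) ∂(ν₁.prod ν₂) -
      ∫ z, p (ι (z.1 - z.2)) ∂(ν₂.prod ν₁) + ∫ z, p (ι (z.1 - z.2)) ∂(ν₂.prod ν₂) := by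
  obtain ⟨i11, e11⟩ := interaction_eq_sub_integral hι hsub hq hq0 hp ν₁ ν₁ h11
  obtain ⟨i12, e12⟩ := interaction_eq_sub_integral hι hsub hq hq0 hp ν₁ ν₂ h12
  obtain ⟨i21, e21⟩ := interaction_eq_sub_integral hι hsub hq hq0 hp ν₂ ν₁ h21
  obtain ⟨i22, e22⟩ := interaction_eq_sub_integral hι hsub hq hq0 hp ν₂ ν₂ h22
  rw [e11, e12, e21, e22]
  have h : (∫ ξ, q ξ * (1 - trigCorr ι ν₁ ν₁ ξ)) + (∫ ξ, q ξ * (1 - trigCorr ι ν₂ ν₂ ξ)) ≤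
      (∫ ξ, q ξ * (1 - trigCorr ι ν₁ ν₂ ξ)) + ∫ ξ, q ξ * (1 - trigCorr ι ν₂ ν₁ ξ) := by
    rw [← integral_add i11 i22, ← integral_add i12 i21]
    refine integral_mono_ae (i11.add i22) (i12.add i21) ?_
    filter_upwards [hq0] with ξ hξ
    simp only [trigCorr]
    set c₁ := ∫ x, Real.cos (2 * Real.pi * inner ℝ (ι x) ξ) ∂ν₁
    set c₂ := ∫ x, Real.cos (2 * Real.pi * inner ℝ (ι x) ξ) ∂ν₂
    set s₁ := ∫ x, Real.sin (2 * Real.pi * inner ℝ (ι x) ξ) ∂ν₁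
    set s₂ := ∫ x, Real.sin (2 * Real.pi * inner ℝ (ι x) ξ) ∂ν₂
    -- This is `q` times the squared modulus of the difference of the two characteristic functions.
    -- The constants `p 0` have cancelled because both measures have mass one.
    have : 0 ≤ q ξ * ((c₁ - c₂) ^ 2 + (s₁ - s₂) ^ 2) := by positivity
    linarith
  linarith

end PositiveDefinite

/-! ### Interactions with a measure of bounded density -/

section BoundedDensity

variable {d : ℕ}

lemma densitySupNorm_nonneg (μ : Measure (Euc d)) : 0 ≤ densitySupNorm μ := ENNReal.toReal_nonneg

lemma le_densitySupNorm_smul {μ : Measure (Euc d)} [IsProbabilityMeasure μ] (hμ : μ ≪ volume)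
    (hM : MemLp (density μ) ∞ volume) :
    μ ≤ ENNReal.ofReal (densitySupNorm μ) • volume := by
  have h1 : ∀ᵐ x, μ.rnDeriv volume x ≤ ENNReal.ofReal (densitySupNorm μ) := by
    have h2 := enorm_ae_le_eLpNormEssSup (density μ) (volume : Measure (Euc d))
    filter_upwards [h2, μ.rnDeriv_lt_top volume] with x hx hx'
    rw [← eLpNorm_exponent_top] at hx
    rw [densitySupNorm, ENNReal.ofReal_toReal hM.2.ne]
    refine le_trans (le_of_eq ?_) hx
    rw [density, Real.enorm_of_nonneg ENNReal.toReal_nonneg, ENNReal.ofReal_toReal hx'.ne]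
  calc μ = volume.withDensity (μ.rnDeriv volume) := (Measure.withDensity_rnDeriv_eq μ _ hμ).symm
    _ ≤ volume.withDensity (fun _ => ENNReal.ofReal (densitySupNorm μ)) := withDensity_mono h1
    _ = _ := withDensity_const _

/-- Dominate `μ` by a multiple of Lebesgue measure in its own variable; translation (and reflection)
invariance then removes the dependence on the other variable. -/
lemma lintegral_sub_prod_le {μ ν : Measure (Euc d)} [IsProbabilityMeasure μ]
    [IsProbabilityMeasure ν] (hμ : μ ≪ volume)
    (hM : MemLp (density μ) ∞ volume) {f : Euc d → ℝ≥0∞} (hf : Measurable f) :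
    ∫⁻ z, f (z.1 - z.2) ∂(ν.prod μ) ≤ ENNReal.ofReal (densitySupNorm μ) * ∫⁻ x, f x ∧
    ∫⁻ z, f (z.1 - z.2) ∂(μ.prod ν) ≤ ENNReal.ofReal (densitySupNorm μ) * ∫⁻ x, f x := by
  have hle := le_densitySupNorm_smul hμ hM
  have hm : Measurable fun z : Euc d × Euc d => f (z.1 - z.2) := by fun_prop
  constructor
  · rw [lintegral_prod _ hm.aemeasurable]
    calc _ ≤ ∫⁻ _, (ENNReal.ofReal (densitySupNorm μ) * ∫⁻ x, f x) ∂ν := by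
          refine lintegral_mono fun x => ?_
          refine (lintegral_mono' hle le_rfl).trans (le_of_eq ?_)
          rw [lintegral_smul_measure, smul_eq_mul, lintegral_sub_left_eq_self]
      _ = _ := by simp
  · rw [lintegral_prod_symm _ hm.aemeasurable]
    calc _ ≤ ∫⁻ _, (ENNReal.ofReal (densitySupNorm μ) * ∫⁻ x, f x) ∂ν := by
          refine lintegral_mono fun x => ?_
          refine (lintegral_mono' hle le_rfl).trans (le_of_eq ?_)
          rw [lintegral_smul_measure, smul_eq_mul, lintegral_sub_right_eq_self]
      _ = _ := by simp

lemma integral_sub_prod_le_of_lintegral {κ : Measure (Euc d × Euc d)} {f : Euc d → ℝ}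
    (hf : Measurable f) (hf0 : ∀ x, 0 ≤ f x) (hfi : Integrable f) {M : ℝ} (hM : 0 ≤ M)
    (h : ∫⁻ z, ENNReal.ofReal (f (z.1 - z.2)) ∂κ ≤
      ENNReal.ofReal M * ∫⁻ x, ENNReal.ofReal (f x)) :
    Integrable (fun z => f (z.1 - z.2)) κ ∧ ∫ z, f (z.1 - z.2) ∂κ ≤ M * ∫ x, f x := by
  have hm : Measurable fun z : Euc d × Euc d => f (z.1 - z.2) := by fun_prop
  rw [← ofReal_integral_eq_lintegral_ofReal hfi (Eventually.of_forall hf0),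
    ← ENNReal.ofReal_mul hM] at h
  refine ⟨⟨hm.aestronglyMeasurable, ?_⟩, ?_⟩
  · rw [hasFiniteIntegral_iff_ofReal (Eventually.of_forall fun z => hf0 _)]
    exact h.trans_lt ENNReal.ofReal_lt_top
  · rw [integral_eq_lintegral_of_nonneg_ae (Eventually.of_forall fun z => hf0 _)
      hm.aestronglyMeasurable]
    exact ENNReal.toReal_le_of_le_ofReal (mul_nonneg hM (integral_nonneg hf0)) h

lemma integral_sub_prod_le {μ ν : Measure (Euc d)} [IsProbabilityMeasure μ]
    [IsProbabilityMeasure ν] (hμ : μ ≪ volume)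
    (hM : MemLp (density μ) ∞ volume) {f : Euc d → ℝ} (hf : Measurable f) (hf0 : ∀ x, 0 ≤ f x)
    (hfi : Integrable f) :
    (Integrable (fun z : Euc d × Euc d => f (z.1 - z.2)) (ν.prod μ) ∧
      ∫ z, f (z.1 - z.2) ∂(ν.prod μ) ≤ densitySupNorm μ * ∫ x, f x) ∧
    (Integrable (fun z : Euc d × Euc d => f (z.1 - z.2)) (μ.prod ν) ∧
      ∫ z, f (z.1 - z.2) ∂(μ.prod ν) ≤ densitySupNorm μ * ∫ x, f x) := by
  have h := lintegral_sub_prod_le (ν := ν) hμ hM hf.ennreal_ofReal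
  exact ⟨integral_sub_prod_le_of_lintegral hf hf0 hfi (densitySupNorm_nonneg μ) h.1,
    integral_sub_prod_le_of_lintegral hf hf0 hfi (densitySupNorm_nonneg μ) h.2⟩

lemma ae_prod_mem_compl_diagonal (hd : 0 < d) {μ ν : Measure (Euc d)} [IsProbabilityMeasure μ]
    [IsProbabilityMeasure ν] (hμ : μ ≪ volume) :
    (∀ᵐ z ∂(ν.prod μ), z ∈ (Set.diagonal (Euc d))ᶜ) ∧
      ∀ᵐ z ∂(μ.prod ν), z ∈ (Set.diagonal (Euc d))ᶜ := by
  have : Nonempty (Fin d) := ⟨⟨0, hd⟩⟩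
  have h0 : ∀ x : Euc d, μ {x} = 0 := fun x => hμ (measure_singleton x)
  have hD : MeasurableSet (Set.diagonal (Euc d)) := measurableSet_diagonal
  have h1 : (ν.prod μ) (Set.diagonal (Euc d)) = 0 := by
    rw [Measure.measure_prod_null hD]
    refine Eventually.of_forall fun x => ?_
    have : Prod.mk x ⁻¹' Set.diagonal (Euc d) = {x} := by
      ext y; simp [eq_comm]
    simp only [this, h0, Pi.zero_apply]
  have h2 : (μ.prod ν) (Set.diagonal (Euc d)) = 0 := by
    rw [← Measure.prod_swap, Measure.map_apply measurable_swap hD]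
    have : Prod.swap ⁻¹' Set.diagonal (Euc d) = Set.diagonal (Euc d) := by
      ext ⟨x, y⟩; simp [eq_comm]
    rw [this, h1]
  exact ⟨compl_mem_ae_iff.2 h1, compl_mem_ae_iff.2 h2⟩

lemma offDiagInteraction_eq_integral (hd : 0 < d) {μ ν : Measure (Euc d)} [IsProbabilityMeasure μ]
    [IsProbabilityMeasure ν] (hμ : μ ≪ volume) (f : Euc d → ℝ) :
    offDiagInteraction f ν μ = ∫ z, f (z.1 - z.2) ∂(ν.prod μ) ∧
      offDiagInteraction f μ ν = ∫ z, f (z.1 - z.2) ∂(μ.prod ν) := by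
  have h := ae_prod_mem_compl_diagonal (ν := ν) hd hμ
  unfold offDiagInteraction
  rw [Measure.restrict_eq_self_of_ae_mem h.1, Measure.restrict_eq_self_of_ae_mem h.2]
  exact ⟨rfl, rfl⟩

end BoundedDensity

/-! ### Integrals against the empirical measure -/

section Empirical

variable {d N : ℕ}

lemma isProbabilityMeasure_empiricalMeasure (hN : 1 ≤ N) (x : Fin N → Euc d) :
    IsProbabilityMeasure (empiricalMeasure x) := by
  refine ⟨?_⟩
  simp only [empiricalMeasure, Measure.smul_apply, Measure.finsetSum_apply, measure_univ,
    Finset.sum_const, Finset.card_univ, Fintype.card_fin, smul_eq_mul, nsmul_eq_mul, mul_one]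
  exact ENNReal.inv_mul_cancel (by exact_mod_cast (by omega : N ≠ 0)) (ENNReal.natCast_ne_top N)

lemma integrable_empiricalMeasure (hN : 1 ≤ N) (x : Fin N → Euc d) (f : Euc d → ℝ) :
    Integrable f (empiricalMeasure x) := by
  refine Integrable.smul_measure ?_ (ENNReal.inv_ne_top.2 (by exact_mod_cast (by omega : N ≠ 0)))
  exact integrable_finsetSum_measure.2 fun i _ => integrable_dirac (by simp)

lemma integral_empiricalMeasure (x : Fin N → Euc d) (f : Euc d → ℝ) :
    ∫ y, f y ∂(empiricalMeasure x) = (N : ℝ)⁻¹ * ∑ i, f (x i) := by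
  rw [empiricalMeasure, integral_smul_measure, integral_finsetSum_measure]
  · simp
  · exact fun i _ => integrable_dirac (by simp)

lemma integral_empiricalMeasure_prod (hN : 1 ≤ N) (x : Fin N → Euc d) {f : Euc d × Euc d → ℝ}
    (hf : Measurable f) :
    Integrable f ((empiricalMeasure x).prod (empiricalMeasure x)) ∧
    ∫ z, f z ∂((empiricalMeasure x).prod (empiricalMeasure x)) =
      1 / (N : ℝ) ^ 2 * ∑ i, ∑ j, f (x i, x j) := by
  have := isProbabilityMeasure_empiricalMeasure hN x
  have hi : Integrable f ((empiricalMeasure x).prod (empiricalMeasure x)) := by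
    rw [integrable_prod_iff hf.aestronglyMeasurable]
    exact ⟨Eventually.of_forall fun y => integrable_empiricalMeasure hN x _,
      integrable_empiricalMeasure hN x _⟩
  refine ⟨hi, ?_⟩
  rw [integral_prod _ hi]
  simp only [integral_empiricalMeasure, ← Finset.mul_sum]
  ring

lemma offDiagInteraction_empiricalMeasure (hN : 1 ≤ N) {x : Fin N → Euc d}
    (hx : Function.Injective x) {f : Euc d → ℝ} (hf : Measurable f) :
    offDiagInteraction f (empiricalMeasure x) (empiricalMeasure x) =
      1 / (N : ℝ) ^ 2 * ∑ i, ∑ j, if i ≠ j then f (x i - x j) else 0 := by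
  have hm : Measurable fun z : Euc d × Euc d => f (z.1 - z.2) := by fun_prop
  have hD : MeasurableSet (Set.diagonal (Euc d))ᶜ := measurableSet_diagonal.compl
  rw [offDiagInteraction, ← integral_indicator hD,
    (integral_empiricalMeasure_prod hN x (hm.indicator hD)).2]
  congr 1
  refine Finset.sum_congr rfl fun i _ => Finset.sum_congr rfl fun j _ => ?_
  by_cases h : i = j
  · simp [h]
  · rw [Set.indicator_of_mem, if_pos h]
    simpa using fun hc => h (hx hc)

lemma sum_offDiag_eq {f : Euc d → ℝ} (x : Fin N → Euc d) :
    ∑ i, ∑ j, f (x i - x j) =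
      (∑ i, ∑ j, if i ≠ j then f (x i - x j) else 0) + N * f 0 := by
  have h : ∀ i : Fin N, ∑ j, f (x i - x j) =
      (∑ j, if i ≠ j then f (x i - x j) else 0) + f 0 := fun i => by
    have h1 : ∑ j, (if i = j then f (x i - x j) else 0) = f 0 := by simp
    rw [← h1, ← Finset.sum_add_distrib]
    refine Finset.sum_congr rfl fun j _ => ?_
    by_cases hij : i = j <;> simp [hij]
  simp only [h, Finset.sum_add_distrib, Finset.sum_const, Finset.card_univ, Fintype.card_fin,
    nsmul_eq_mul]

end Empirical

/-! ### The embedding into the extended space -/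

section ZeroExtend

variable {d m : ℕ}

lemma zeroExtend_sub (x y : Euc d) : zeroExtend m (x - y) = zeroExtend m x - zeroExtend m y := by
  ext i
  refine Fin.addCases (fun i => ?_) (fun i => ?_) i <;> simp [zeroExtend]

lemma norm_zeroExtend (x : Euc d) : ‖zeroExtend m x‖ = ‖x‖ := by
  rw [EuclideanSpace.norm_eq, EuclideanSpace.norm_eq, Fin.sum_univ_add]
  simp [zeroExtend]

lemma zeroExtend_ne_zero {x : Euc d} (hx : x ≠ 0) : zeroExtend m x ≠ 0 := by
  rw [← norm_ne_zero_iff, norm_zeroExtend, norm_ne_zero_iff]; exact hx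

lemma measurable_zeroExtend : Measurable (zeroExtend m : Euc d → Euc (d + m)) := by
  refine (Isometry.of_dist_eq fun x y => ?_).continuous.measurable
  rw [dist_eq_norm, dist_eq_norm, ← zeroExtend_sub, norm_zeroExtend]

/-- For `m = 0` the embedding is the identity, so both cases of admissibility can be treated as a
potential on the larger space. -/
lemma IsAdmissible.exists_extension {s : ℝ} {P : PotentialConstants} {g : Euc d → ℝ}
    (h : IsAdmissible d m s P g) : ∃ G : Euc (d + m) → ℝ, IsRieszType (d + m) s P G ∧
      ∀ x, x ≠ 0 → G (zeroExtend m x) = g x := by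
  rcases h with ⟨-, rfl, hg⟩ | ⟨-, G, hGg, hG⟩
  · refine ⟨g, hg, fun x _ => congrArg g ?_⟩
    ext i
    exact Fin.append_left (fun i => x i) (fun _ : Fin 0 => (0 : ℝ)) i
  · exact ⟨G, hG, hGg⟩

end ZeroExtend

/-! ### Integrability of the two parts of the kernel -/

lemma integrable_shortProfile {d n : ℕ} (hd : 0 < d) (hdn : d ≤ n) {a : ℝ} (ha : 0 ≤ a)
    (had : a < d) : Integrable (fun x : Euc d => shortProfile n a ‖x‖) := by
  obtain ⟨V, -, hV⟩ := exists_integral_mul_shift_rpow_le hd ha had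
  have hu : Integrable (fun x : Euc d => ((1 + ‖x‖) ^ (n + 1))⁻¹) :=
    integrable_inv_one_add_norm_pow (by omega)
  have h1 := (hV _ 1 hu (fun _ => by positivity) (fun x => inv_le_one_of_one_le₀
    (one_le_pow₀ (by linarith [norm_nonneg x]))) 0 1 (by simp)).1
  simp only [zero_add, one_smul] at h1
  refine (h1.add hu).congr (Eventually.of_forall fun x => ?_)
  simp only [shortProfile, Pi.add_apply]; ring

lemma integral_scaled_shortProfile {d n : ℕ} (hd : 0 < d) (hdn : d ≤ n) {a : ℝ} (ha : 0 ≤ a)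
    (had : a < d) (s : ℝ) {r : ℝ} (hr : 0 < r) :
    Integrable (fun x : Euc d => r ^ (-s) * shortProfile n a (‖x‖ / r)) ∧
    ∫ x : Euc d, r ^ (-s) * shortProfile n a (‖x‖ / r) =
      r ^ ((d : ℝ) - s) * ∫ x : Euc d, shortProfile n a ‖x‖ := by
  have e : ∀ x : Euc d, ‖x‖ / r = ‖r⁻¹ • x‖ := fun x => by
    rw [norm_smul, Real.norm_of_nonneg (inv_pos.2 hr).le, div_eq_inv_mul]
  simp only [e]
  refine ⟨((integrable_shortProfile hd hdn ha had).comp_smul (inv_ne_zero hr.ne')).const_mul _, ?_⟩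
  rw [integral_const_mul, Measure.integral_comp_inv_smul volume
    (fun x : Euc d => shortProfile n a ‖x‖) r]
  simp only [finrank_euclideanSpace, Fintype.card_fin, abs_of_pos (pow_pos hr d), smul_eq_mul]
  rw [← mul_assoc, ← Real.rpow_natCast, ← Real.rpow_add hr]
  congr 2; ring

lemma log_one_add_norm_sub_le {d : ℕ} (x y : Euc d) :
    Real.log (1 + ‖x - y‖) ≤ Real.log (1 + ‖x‖) + Real.log (1 + ‖y‖) := by
  have hx := norm_nonneg x
  have hy := norm_nonneg y
  rw [← Real.log_mul (by positivity) (by positivity)]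
  refine Real.log_le_log (by positivity) ?_
  nlinarith [norm_sub_le x y, mul_nonneg hx hy]

/-- The logarithm of `1 + ‖x - y‖` is subadditive in the two points, so logarithmic moments of the
two measures suffice; for `s ≠ 0` the kernel is bounded. -/
lemma integrable_kernel_of_growth {d n : ℕ} {s B : ℝ} {p : Euc n → ℝ} (hp : Measurable p)
    (hB : ∀ X, |p X| ≤ B * (1 + if s = 0 then Real.log (1 + ‖X‖) else 0))
    {ι : Euc d → Euc n} (hι : Measurable ι) (hιn : ∀ x, ‖ι x‖ = ‖x‖)
    {ν₁ ν₂ : Measure (Euc d)} [IsProbabilityMeasure ν₁] [IsProbabilityMeasure ν₂]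
    (h₁ : s = 0 → Integrable (fun y => Real.log (1 + ‖y‖)) ν₁)
    (h₂ : s = 0 → Integrable (fun y => Real.log (1 + ‖y‖)) ν₂) :
    Integrable (fun z : Euc d × Euc d => p (ι (z.1 - z.2))) (ν₁.prod ν₂) := by
  have hm : Measurable fun z : Euc d × Euc d => p (ι (z.1 - z.2)) := by fun_prop
  have hB0 : 0 ≤ B := by
    have := (abs_nonneg _).trans (hB 0)
    simpa using this
  by_cases hs : s = 0
  · have hi : Integrable (fun z : Euc d × Euc d =>
        B * (1 + (Real.log (1 + ‖z.1‖) + Real.log (1 + ‖z.2‖)))) (ν₁.prod ν₂) :=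
      ((integrable_const (1 : ℝ)).add (((h₁ hs).comp_fst ν₂).add ((h₂ hs).comp_snd ν₁))).const_mul B
    refine hi.mono' hm.aestronglyMeasurable (Eventually.of_forall fun z => ?_)
    refine (hB _).trans ?_
    rw [if_pos hs, hιn]
    have := log_one_add_norm_sub_le z.1 z.2
    gcongr
  · refine (integrable_const B).mono' hm.aestronglyMeasurable (Eventually.of_forall fun z => ?_)
    refine (hB _).trans ?_
    rw [if_neg hs, add_zero, mul_one]

lemma offDiagInteraction_add {d : ℕ} {g f h : Euc d → ℝ} (hg : ∀ x, x ≠ 0 → g x = f x + h x)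
    {ν₁ ν₂ : Measure (Euc d)}
    (hf : Integrable (fun z : Euc d × Euc d => f (z.1 - z.2)) (ν₁.prod ν₂))
    (hh : Integrable (fun z : Euc d × Euc d => h (z.1 - z.2)) (ν₁.prod ν₂)) :
    offDiagInteraction g ν₁ ν₂ = offDiagInteraction f ν₁ ν₂ + offDiagInteraction h ν₁ ν₂ := by
  unfold offDiagInteraction
  rw [← integral_add hf.integrableOn hh.integrableOn]
  refine setIntegral_congr_fun measurableSet_diagonal.compl fun z hz => hg _ ?_
  exact sub_ne_zero.2 hz

/-! ### Lower bounds for the modulated energy of each part -/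

section Energy

variable {d N : ℕ} {x : Fin N → Euc d} {μ : Measure (Euc d)}

/-- The modulated energy of a conditionally positive definite kernel is bounded below by the
self-interaction. -/
lemma neg_div_le_modulatedEnergy {n : ℕ} (hd : 0 < d) (hN : 1 ≤ N) (hx : Function.Injective x)
    [IsProbabilityMeasure μ] (hμ : μ ≪ volume) {p q : Euc n → ℝ} {ι : Euc d → Euc n}
    (hpm : Measurable p) (hι : Measurable ι) (hsub : ∀ x y, ι (x - y) = ι x - ι y)
    (hq : AEStronglyMeasurable q) (hq0 : ∀ᵐ ξ, 0 ≤ q ξ)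
    (hp : ∀ X, Integrable (fun ξ => q ξ * (1 - Real.cos (2 * Real.pi * inner ℝ X ξ))) ∧
      p 0 - p X = ∫ ξ, q ξ * (1 - Real.cos (2 * Real.pi * inner ℝ X ξ)))
    (h12 : Integrable (fun z : Euc d × Euc d => p (ι (z.1 - z.2))) ((empiricalMeasure x).prod μ))
    (h21 : Integrable (fun z : Euc d × Euc d => p (ι (z.1 - z.2))) (μ.prod (empiricalMeasure x)))
    (h22 : Integrable (fun z : Euc d × Euc d => p (ι (z.1 - z.2))) (μ.prod μ)) :
    -(p 0 / N) ≤ modulatedEnergy (fun y => p (ι y)) x μ := by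
  have := isProbabilityMeasure_empiricalMeasure hN x
  have hN0 : (N : ℝ) ≠ 0 := by exact_mod_cast (by omega : N ≠ 0)
  have hm : Measurable fun z : Euc d × Euc d => p (ι (z.1 - z.2)) := by fun_prop
  have h11 := integral_empiricalMeasure_prod hN x hm
  have key := interaction_sub_nonneg hι hsub hq hq0 hp (empiricalMeasure x) μ h11.1 h12 h21 h22
  have hfm : Measurable fun y => p (ι y) := hpm.comp hι
  have hι0 : ι 0 = 0 := by simpa using hsub 0 0
  rw [modulatedEnergy, (offDiagInteraction_eq_integral (ν := empiricalMeasure x) hd hμ _).1,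
    (offDiagInteraction_eq_integral (ν := empiricalMeasure x) hd hμ _).2,
    (offDiagInteraction_eq_integral (ν := μ) hd hμ _).1,
    offDiagInteraction_empiricalMeasure hN hx hfm]
  rw [h11.2, sum_offDiag_eq (f := fun y => p (ι y)), hι0, mul_add] at key
  -- The `N` diagonal pairs are present in the positive definite form but excluded from the
  -- modulated energy; they account for the whole loss.
  have e : 1 / (N : ℝ) ^ 2 * (N * p 0) = p 0 / N := by field_simp
  rw [e] at key
  linarith

/-- The modulated energy of a nonnegative integrable kernel controls the particle interactions. -/
lemma sum_sub_le_modulatedEnergy (hd : 0 < d) (hN : 1 ≤ N) (hx : Function.Injective x)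
    [IsProbabilityMeasure μ] (hμ : μ ≪ volume) (hM : MemLp (density μ) ∞ volume)
    {f : Euc d → ℝ} (hf : Measurable f) (hf0 : ∀ x, 0 ≤ f x) (hfi : Integrable f) :
    1 / (N : ℝ) ^ 2 * (∑ i, ∑ j, if i ≠ j then f (x i - x j) else 0) -
      2 * (densitySupNorm μ * ∫ y, f y) ≤ modulatedEnergy f x μ := by
  have := isProbabilityMeasure_empiricalMeasure hN x
  have h := integral_sub_prod_le (ν := empiricalMeasure x) hμ hM hf hf0 hfi
  rw [modulatedEnergy, (offDiagInteraction_eq_integral (ν := empiricalMeasure x) hd hμ _).1,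
    (offDiagInteraction_eq_integral (ν := empiricalMeasure x) hd hμ _).2,
    (offDiagInteraction_eq_integral (ν := μ) hd hμ _).1,
    offDiagInteraction_empiricalMeasure hN hx hf]
  -- The self-interaction of `μ` has a favourable sign and is dropped; the factor `2` comes from the
  -- two cross terms.
  have h3 : 0 ≤ ∫ z, f (z.1 - z.2) ∂(μ.prod μ) := integral_nonneg fun z => hf0 _
  linarith [h.1.2, h.2.2]

lemma modulatedEnergy_add (hN : 1 ≤ N) {g f h : Euc d → ℝ} (hg : ∀ x, x ≠ 0 → g x = f x + h x)
    (hfm : Measurable f) (hhm : Measurable h)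
    (hf12 : Integrable (fun z : Euc d × Euc d => f (z.1 - z.2)) ((empiricalMeasure x).prod μ))
    (hf21 : Integrable (fun z : Euc d × Euc d => f (z.1 - z.2)) (μ.prod (empiricalMeasure x)))
    (hf22 : Integrable (fun z : Euc d × Euc d => f (z.1 - z.2)) (μ.prod μ))
    (hh12 : Integrable (fun z : Euc d × Euc d => h (z.1 - z.2)) ((empiricalMeasure x).prod μ))
    (hh21 : Integrable (fun z : Euc d × Euc d => h (z.1 - z.2)) (μ.prod (empiricalMeasure x)))
    (hh22 : Integrable (fun z : Euc d × Euc d => h (z.1 - z.2)) (μ.prod μ)) :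
    modulatedEnergy g x μ = modulatedEnergy f x μ + modulatedEnergy h x μ := by
  have h1 := offDiagInteraction_add hg
    (integral_empiricalMeasure_prod hN x (f := fun z => f (z.1 - z.2)) (by fun_prop)).1
    (integral_empiricalMeasure_prod hN x (f := fun z => h (z.1 - z.2)) (by fun_prop)).1
  rw [modulatedEnergy, modulatedEnergy, modulatedEnergy, h1, offDiagInteraction_add hg hf12 hh12,
    offDiagInteraction_add hg hf21 hh21, offDiagInteraction_add hg hf22 hh22]
  ring

end Energy

/-! ### Growth of the regular part and mass of the short-range part -/

lemma shortProfile_le_two {q : ℕ} {a y : ℝ} (ha : 0 ≤ a) (hy : 1 ≤ y) :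
    shortProfile q a y ≤ 2 := by
  have h1 : y ^ (-a) ≤ 1 := Real.rpow_le_one_of_one_le_of_nonpos hy (by linarith)
  have h2 : ((1 + y) ^ (q + 1))⁻¹ ≤ 1 := inv_le_one_of_one_le₀ (one_le_pow₀ (by linarith))
  have h3 : 0 ≤ y ^ (-a) := by positivity
  calc shortProfile q a y ≤ (y ^ (-a) + 1) * 1 := by unfold shortProfile; gcongr
    _ ≤ 2 := by linarith

/-- The regular part of the decomposition grows at most logarithmically, and is bounded for
`s > 0`. -/
lemma exists_growth_bound {n J : ℕ} {s : ℝ} (hs : 0 ≤ s) {P : PotentialConstants} {G : Euc n → ℝ}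
    (hG : IsRieszType n s P G) {C ε : ℝ} (hC : 0 ≤ C) (hε : 0 < ε) (hε1 : ε ≤ 1) {p S : Euc n → ℝ}
    (hpS : ∀ X, X ≠ 0 → p X + S X = G X) (hS0 : ∀ X, X ≠ 0 → 0 ≤ S X)
    (hS : ∀ X, X ≠ 0 → S X ≤ C * ∑ j ∈ Finset.range J,
      (ε / 2 ^ j) ^ (-s) * shortProfile n (singExp s) (‖X‖ / (ε / 2 ^ j)))
    (hp : ∃ B, ∀ X, |p X| ≤ B * (1 + ‖X‖)) :
    ∃ B, ∀ X, |p X| ≤ B * (1 + if s = 0 then Real.log (1 + ‖X‖) else 0) := by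
  obtain ⟨B, hB⟩ := hp
  set T : ℝ := C * ∑ j ∈ Finset.range J, (ε / 2 ^ j) ^ (-s) * 2
  have hT : 0 ≤ T := mul_nonneg hC (Finset.sum_nonneg fun j _ => by positivity)
  refine ⟨2 * |B| + T + |P.Cder 0|, fun X => ?_⟩
  set ℓ : ℝ := if s = 0 then Real.log (1 + ‖X‖) else 0
  have hℓ : 0 ≤ ℓ := by
    simp only [ℓ]; split_ifs
    · exact Real.log_nonneg (by linarith [norm_nonneg X])
    · exact le_rfl
  have hB0 := abs_nonneg B
  have hD0 := abs_nonneg (P.Cder 0)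
  -- The a priori linear growth of `p` is too weak for integrability against `μ`, so it is used only
  -- in the unit ball. Outside, `p = G - S` with `S` bounded and `G` bounded or logarithmic.
  rcases le_total ‖X‖ 1 with h | h
  · have h1 : |p X| ≤ |B| * 2 := (hB X).trans (by
      have := norm_nonneg X
      have := le_abs_self B
      gcongr; linarith)
    have h2 : 0 ≤ (2 * |B| + T + |P.Cder 0|) * ℓ := by positivity
    linarith
  · have hX : X ≠ 0 := norm_pos_iff.1 (by linarith)
    have hST : S X ≤ T := (hS X hX).trans (by
      refine mul_le_mul_of_nonneg_left (Finset.sum_le_sum fun j _ => ?_) hC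
      gcongr
      refine shortProfile_le_two (singExp_nonneg hs) ?_
      rw [one_le_div (by positivity)]
      exact (div_le_self hε.le (one_le_pow₀ one_le_two)).trans (hε1.trans h))
    have hGX : |G X| ≤ |P.Cder 0| * (1 + ℓ) := by
      rcases hs.eq_or_lt with rfl | hs0
      · refine hG.abs_le_of_zero hX |>.trans ?_
        have h1 : |Real.log ‖X‖| ≤ Real.log (1 + ‖X‖) := by
          rw [abs_of_nonneg (Real.log_nonneg h)]
          exact Real.log_le_log (by linarith) (by linarith)
        simp only [ℓ, if_true]
        gcongr
        exact le_abs_self _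
      · refine (hG.abs_le_of_pos hs0 hX).trans ?_
        have h1 := Real.rpow_le_one_of_one_le_of_nonpos h (by linarith : -s ≤ 0)
        have h2 := le_abs_self (P.Cder 0)
        gcongr
        linarith
    have e : p X = G X - S X := by rw [← hpS X hX]; ring
    have h3 : |p X| ≤ |G X| + T := by
      rw [e]
      refine (abs_sub _ _).trans ?_
      rw [abs_of_nonneg (hS0 X hX)]
      gcongr
    have h4 : 0 ≤ (2 * |B| + T) * ℓ := by positivity
    linarith

/-- Scaling gives mass of order `r ^ (d - s)` at each scale `r`, and `s ≤ d` bounds this by the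
value at the coarsest scale `ε`. The integral is over `ℝᵈ` although the profile decays at the rate
for `ℝⁿ`. -/
lemma setIntegral_short_le {d n J : ℕ} (hd : 0 < d) (hdn : d ≤ n) {a : ℝ} (ha : 0 ≤ a)
    (had : a < d) {s : ℝ} (hsd : s ≤ d) {C ε : ℝ} (hC : 0 ≤ C) (hε : 0 < ε) {f : Euc d → ℝ}
    (hfm : Measurable f) (hf0 : ∀ x, 0 ≤ f x)
    (hf : ∀ x, f x ≤ C * ∑ j ∈ Finset.range J,
      (ε / 2 ^ j) ^ (-s) * shortProfile n a (‖x‖ / (ε / 2 ^ j))) :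
    Integrable f ∧ ∫ x, f x ≤ C * J * (∫ x : Euc d, shortProfile n a ‖x‖) * ε ^ ((d : ℝ) - s) := by
  have h := fun j : ℕ => integral_scaled_shortProfile hd hdn ha had s
    (show 0 < ε / 2 ^ j by positivity)
  have hi := (integrable_finsetSum (Finset.range J) fun j _ => (h j).1).const_mul C
  have hfi : Integrable f := hi.mono' hfm.aestronglyMeasurable (Eventually.of_forall fun x => by
    rw [Real.norm_of_nonneg (hf0 x)]; exact hf x)
  have hV : 0 ≤ ∫ x : Euc d, shortProfile n a ‖x‖ :=
    integral_nonneg fun x => shortProfile_nonneg (norm_nonneg x)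
  refine ⟨hfi, (integral_mono hfi hi hf).trans ?_⟩
  rw [integral_const_mul, integral_finsetSum _ fun j _ => (h j).1, mul_assoc C, mul_assoc C]
  refine mul_le_mul_of_nonneg_left ?_ hC
  calc _ ≤ ∑ j ∈ Finset.range J, (∫ x : Euc d, shortProfile n a ‖x‖) * ε ^ ((d : ℝ) - s) := by
        refine Finset.sum_le_sum fun j _ => ?_
        rw [(h j).2, mul_comm]
        refine mul_le_mul_of_nonneg_left ?_ hV
        exact Real.rpow_le_rpow (by positivity) (div_le_self hε.le (one_le_pow₀ one_le_two))
          (by linarith)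
    _ = _ := by simp [mul_assoc]

/-! ### Control of microscale interactions -/

theorem corollary2p3 (d m : ℕ) (hd : 1 ≤ d) (s : ℝ) (hs₀ : 0 ≤ s) (hsd : s < d)
    (P : PotentialConstants) :
    ∃ C : ℝ, 0 < C ∧
      ∀ g : Euc d → ℝ, IsAdmissible d m s P g →
      ∀ N : ℕ, 1 ≤ N → ∀ x : Fin N → Euc d, Function.Injective x →
      ∀ μ : Measure (Euc d), IsProbabilityMeasure μ → μ ≪ volume → MemLp (density μ) ∞ volume →
      (s = 0 → Integrable (fun y => Real.log (1 + ‖y‖)) μ) →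
      ∀ ε : ℝ, 0 < ε → ε < min (1 / 8) (P.r₀ / 8) →
        (1 / (N : ℝ) ^ 2) *
            ∑ i : Fin N, ∑ j : Fin N,
              (if i ≠ j ∧ ‖x i - x j‖ ≤ ε then
                (if 0 < s then g (x i - x j) else 0) + (if s = 0 then 1 else 0)
              else 0)
          ≤ C * (modulatedEnergy g x μ
              + C * ((ε ^ (-s) + (if s = 0 then |Real.log ε| else 0)) / N
                + ε ^ 2
                + densitySupNorm μ *
                    (ε ^ ((d : ℝ) - s)
                      + (if s = 0 then ε ^ d * |Real.log ε| else 0)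
                      + (if s = (d : ℝ) - 2 then ε ^ 2 * |Real.log ε| else 0)))) := by
  have hdn : d ≤ d + m := Nat.le_add_right d m
  have hsn : s < (d + m : ℕ) := hsd.trans_le (by exact_mod_cast hdn)
  obtain ⟨C, hC, J, hdec⟩ := exists_decomposition (n := d + m) (by omega) hs₀ hsn P
  set V : ℝ := ∫ x : Euc d, shortProfile (d + m) (singExp s) ‖x‖
  have hV : 0 ≤ V := integral_nonneg fun x => shortProfile_nonneg (norm_nonneg x)
  -- `C` pays for `p 0 / N` and for the comparison of `g` with `S`; `2 C J V` pays for the two cross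
  -- terms of `S` with `μ`.
  refine ⟨C + 2 * (C * J * V), by positivity, ?_⟩
  intro g hg N hN x hx μ hμP hμ hM hlog ε hε hε8
  have hε1 : ε < 1 / 8 := hε8.trans_le (min_le_left _ _)
  obtain ⟨G, hG, hGg⟩ := hg.exists_extension
  obtain ⟨p, S, q, hpm, hSm, hqm, hpS, hq0, hp, hS0, hSG, hSup, hp0, hpB⟩ :=
    hdec G hG ε hε (hε8.trans_le (min_le_right _ _))
  obtain ⟨B, hB⟩ := exists_growth_bound hs₀ hG hC.le hε (by linarith) hpS hS0 hSup hpB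
  have hι : Measurable (zeroExtend m : Euc d → Euc (d + m)) := measurable_zeroExtend
  have hNP := isProbabilityMeasure_empiricalMeasure hN x
  have hlogN : s = 0 → Integrable (fun y => Real.log (1 + ‖y‖)) (empiricalMeasure x) :=
    fun _ => integrable_empiricalMeasure hN x _
  have hf12 := integrable_kernel_of_growth hpm hB hι norm_zeroExtend hlogN hlog
  have hf21 := integrable_kernel_of_growth hpm hB hι norm_zeroExtend hlog hlogN
  have hf22 := integrable_kernel_of_growth hpm hB hι norm_zeroExtend hlog hlog
  -- `S` is controlled only off the origin; the value there is irrelevant to the energy and is set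
  -- to zero to have bounds everywhere.
  set f : Euc d → ℝ := fun y => if y = 0 then 0 else S (zeroExtend m y)
  have hfm : Measurable f :=
    Measurable.ite (measurableSet_singleton 0) measurable_const (hSm.comp hι)
  have hf0 : ∀ y, 0 ≤ f y := fun y => by
    simp only [f]; split_ifs with h
    · exact le_rfl
    · exact hS0 _ (zeroExtend_ne_zero h)
  have hfV := setIntegral_short_le (by omega : 0 < d) hdn (singExp_nonneg hs₀)
    (singExp_lt (by omega) hsd) hsd.le hC.le hε hfm hf0 fun y => by
      simp only [f]; split_ifs with h
      · exact mul_nonneg hC.le (Finset.sum_nonneg fun j _ =>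
          mul_nonneg (by positivity) (shortProfile_nonneg (by positivity)))
      · have := hSup _ (zeroExtend_ne_zero (m := m) h)
        rwa [norm_zeroExtend] at this
  have hq0' : ∀ᵐ ξ, 0 ≤ q ξ := by
    have hne : ∀ᵐ z : Euc (d + m), z ≠ 0 := by
      simpa using ae_add_smul_ne_zero (by omega : 0 < d + m) (0 : Euc (d + m)) one_ne_zero
    filter_upwards [hne] with ξ hξ using hq0 ξ hξ
  have hEp := neg_div_le_modulatedEnergy (by omega : 0 < d) hN hx hμ hpm hι zeroExtend_sub hqm hq0'
    hp hf12 hf21 hf22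
  have hEf := sum_sub_le_modulatedEnergy (by omega : 0 < d) hN hx hμ hM hfm hf0 hfV.1
  have hi := integral_sub_prod_le (ν := empiricalMeasure x) hμ hM hfm hf0 hfV.1
  have hi' := integral_sub_prod_le (ν := μ) hμ hM hfm hf0 hfV.1
  have hE : modulatedEnergy g x μ =
      modulatedEnergy (fun y => p (zeroExtend m y)) x μ + modulatedEnergy f x μ :=
    modulatedEnergy_add hN (fun y hy => by
      simp only [f, if_neg hy]
      rw [hpS _ (zeroExtend_ne_zero hy), hGg y hy]) (hpm.comp hι) hfm hf12 hf21 hf22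
      hi.1.1 hi.2.1 hi'.1.1
  set T : ℝ := 1 / (N : ℝ) ^ 2 * ∑ i, ∑ j, if i ≠ j then f (x i - x j) else 0
  have hT0 : 0 ≤ T := mul_nonneg (by positivity) (Finset.sum_nonneg fun i _ =>
    Finset.sum_nonneg fun j _ => by split_ifs; exacts [hf0 _, le_rfl])
  have hlhs : (1 / (N : ℝ) ^ 2) * ∑ i : Fin N, ∑ j : Fin N,
      (if i ≠ j ∧ ‖x i - x j‖ ≤ ε then
        (if 0 < s then g (x i - x j) else 0) + (if s = 0 then 1 else 0) else 0) ≤ C * T := by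
    have hNi : 0 ≤ 1 / (N : ℝ) ^ 2 := by positivity
    simp only [T]
    rw [mul_left_comm C, Finset.mul_sum _ _ C]
    refine mul_le_mul_of_nonneg_left (Finset.sum_le_sum fun i _ => ?_) hNi
    rw [Finset.mul_sum]
    refine Finset.sum_le_sum fun j _ => ?_
    by_cases hij : i = j
    · simp [hij]
    have hne : x i - x j ≠ 0 := sub_ne_zero.2 fun h => hij (hx h)
    rw [if_pos hij]
    by_cases h : ‖x i - x j‖ ≤ ε
    · have h1 := hSG _ (zeroExtend_ne_zero (m := m) hne) (by rw [norm_zeroExtend]; exact h)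
      rw [hGg _ hne] at h1
      rw [if_pos ⟨hij, h⟩]
      simpa only [f, if_neg hne] using h1
    · rw [if_neg (fun hc => h hc.2)]
      exact mul_nonneg hC.le (hf0 _)
  set M := densitySupNorm μ
  have hM0 : 0 ≤ M := densitySupNorm_nonneg μ
  set K : ℝ := ε ^ (-s) + (if s = 0 then |Real.log ε| else 0)
  have hK0 : 0 ≤ K := by
    have : 0 ≤ (if s = 0 then |Real.log ε| else 0) := by split_ifs <;> positivity
    positivity
  have hN0 : (0 : ℝ) < N := by exact_mod_cast hN
  have hD : ε ^ ((d : ℝ) - s) ≤ ε ^ ((d : ℝ) - s)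
      + (if s = 0 then ε ^ d * |Real.log ε| else 0)
      + (if s = (d : ℝ) - 2 then ε ^ 2 * |Real.log ε| else 0) := by
    have h1 : 0 ≤ (if s = 0 then ε ^ d * |Real.log ε| else 0) := by split_ifs <;> positivity
    have h2 : 0 ≤ (if s = (d : ℝ) - 2 then ε ^ 2 * |Real.log ε| else 0) := by
      split_ifs <;> positivity
    linarith
  set D : ℝ := ε ^ ((d : ℝ) - s) + (if s = 0 then ε ^ d * |Real.log ε| else 0)
      + (if s = (d : ℝ) - 2 then ε ^ 2 * |Real.log ε| else 0)
  have hD0 : 0 ≤ D := le_trans (by positivity) hD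
  have h1 : p 0 / N ≤ C * (K / N) := by
    rw [← mul_div_assoc]; gcongr
  have h2 : M * ∫ y, f y ≤ C * J * V * (M * D) := by
    calc M * ∫ y, f y ≤ M * (C * J * V * D) := by
          refine mul_le_mul_of_nonneg_left (hfV.2.trans ?_) hM0
          exact mul_le_mul_of_nonneg_left hD (by positivity)
      _ = _ := by ring
  set A : ℝ := K / N + ε ^ 2 + M * D
  have hKN : 0 ≤ K / N := by positivity
  have hMD : 0 ≤ M * D := by positivity
  have hCJV : 0 ≤ C * J * V := by positivity
  have h3 : T ≤ modulatedEnergy g x μ + (C + 2 * (C * J * V)) * A := by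
    have h4 : C * (K / N) + 2 * (C * J * V) * (M * D) ≤ (C + 2 * (C * J * V)) * A := by
      have h5 : K / N ≤ A := by
        have : 0 ≤ ε ^ 2 := by positivity
        simp only [A]; linarith
      have h6 : M * D ≤ A := by
        have : 0 ≤ ε ^ 2 := by positivity
        simp only [A]; linarith
      rw [add_mul]
      gcongr
    linarith
  refine hlhs.trans ?_
  -- The modulated energy alone may be negative. The corrected energy dominates `T ≥ 0`, which is
  -- what allows the prefactor `C` to be enlarged to the final constant.
  have h7 : 0 ≤ modulatedEnergy g x μ + (C + 2 * (C * J * V)) * A := hT0.trans h3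
  calc C * T ≤ C * (modulatedEnergy g x μ + (C + 2 * (C * J * V)) * A) := by gcongr
    _ ≤ _ := mul_le_mul_of_nonneg_right (by linarith) h7
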